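/- An instance $I=(G,\chi,s,t)$ of Balance-fair Shortest Path consists of a finite undirected graph $G=(V,E)$, a vertex coloring $\chi\colon V\to\{1,\dots,c\}$ (not necessarily surjective), and two vertices $s,t\in V$. It is a yes-instance if there is a shortest $s$-$t$-path $P$ in $G$ such that the numbers of vertices of $P$ of any two of the $c$ colors differ by at most one (a color that does not occur on $P$ counts zero). A cograph is a graph without an induced path on four vertices, and the distance of $G$ to cographs is the least number of vertices whose removal from $G$ leaves a cograph. Balance-fair Shortest Path parameterized by the distance $k$ to cographs has a kernel of size $O(k^5)$, computable in $O(n^{10})$ time. Precisely: there are a constant $C$ and an algorithm (one fixed program of a unit-cost word RAM with words of $O(\log(n+c))$ bits, the graphs in the input and in the output being given by their adjacency matrices) that, given any instance $I$ with $n$ vertices and $c$ colors whose graph has distance $k\ge 0$ to cographs, computes in at most $C\,n^{10}$ steps an instance $I'$ of the same problem such that $I$ is a yes-instance if and only if $I'$ is a yes-instance, and $$n'+m'+c'+k'\le C\,(k+1)^5,$$ where $n'$, $m'$ and $c'$ are the numbers of vertices, edges and colors of $I'$ and $k'$ is the distance of its graph to cographs. The algorithm is not given $k$. -/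

import Mathlib

namespace BalanceFair

noncomputable section

/-! ### Cographs and distance to cographs -/

/-- A cograph is a graph without an induced path on four vertices (that is, of length three). -/
def IsCograph {V : Type*} (G : SimpleGraph V) : Prop :=
  IsEmpty (SimpleGraph.pathGraph 4 ↪g G)

/-- The distance to cographs: the least number of vertices whose removal leaves a cograph.
The set below is nonempty, because all the vertices may be removed. -/
def distToCographs {V : Type*} [Fintype V] (G : SimpleGraph V) : ℕ :=
  sInf {m | ∃ X : Finset V, X.card = m ∧ IsCograph (G.induce {v | v ∉ X})}

/-! ### The problem Balance-fair Shortest Path -/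

/-- An instance: an undirected graph on the vertices `0, …, n - 1`, a vertex coloring with
colors `0, …, c - 1` (not all of which have to be used), and two vertices `s` and `t`. -/
structure Inst where
  n : ℕ
  graph : SimpleGraph (Fin n)
  c : ℕ
  color : Fin n → Fin c
  s : Fin n
  t : Fin n

namespace Inst

/-- The number of vertices of color `i` on `p`. -/
def colorCount (I : Inst) {u v : Fin I.n} (p : I.graph.Walk u v) (i : Fin I.c) : ℕ :=
  (p.support.toFinset.filter (fun w => I.color w = i)).card

/-- The numbers of vertices of any two colors differ by at most one, that is, the maximum over
all colors exceeds the minimum over all colors by at most one. -/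
def IsBalanceFair (I : Inst) {u v : Fin I.n} (p : I.graph.Walk u v) : Prop :=
  ∀ i j : Fin I.c, I.colorCount p i ≤ I.colorCount p j + 1

/-- `I` is a yes-instance: there is a balance-fair shortest `s`-`t`-path. -/
def IsYes (I : Inst) : Prop :=
  ∃ p : I.graph.Walk I.s I.t,
    p.IsPath ∧ p.length = I.graph.dist I.s I.t ∧ I.IsBalanceFair p

/-- The parameter `k` of an instance: the distance of its graph to cographs. -/
def param (I : Inst) : ℕ := distToCographs I.graph

/-- The size `|I|` of an instance: number of vertices, plus number of edges, plus number of
colors. -/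
def size (I : Inst) : ℕ := I.n + I.graph.edgeSet.ncard + I.c

end Inst

/-! ### The machine model: structured programs of a word RAM with unit costs

A program uses registers `0, 1, 2, …` and arrays `0, 1, 2, …`, of which it can name only
finitely many; each register and each array cell holds a natural number. An array cell is
addressed by a computed index. A machine word holds the numbers up to a bound `W`; a
computation in which a larger number arises is not a legal run. -/

/-- Expressions; `sub` is truncated subtraction, `lt` and `eq` return `1` (true) or
`0` (false), and `get a e` reads the cell of the array `a` at the index `e`. -/
inductive Expr : Type
  | lit (k : ℕ)
  | var (x : ℕ)
  | get (a : ℕ) (e : Expr)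
  | add (e f : Expr)
  | sub (e f : Expr)
  | mul (e f : Expr)
  | lt (e f : Expr)
  | eq (e f : Expr)

/-- Programs; `loop e p` is "while `e ≠ 0` do `p`". -/
inductive Prog : Type
  | skip
  | assign (x : ℕ) (e : Expr)
  | store (a : ℕ) (e f : Expr)
  | seq (p q : Prog)
  | cond (e : Expr) (p q : Prog)
  | loop (e : Expr) (p : Prog)

/-- A memory configuration: contents of the registers and of the arrays. -/
structure State where
  reg : ℕ → ℕ
  arr : ℕ → ℕ → ℕ

namespace State

/-- Overwrite the register `x`. -/
def setReg (σ : State) (x v : ℕ) : State :=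
  { σ with reg := Function.update σ.reg x v }

/-- Overwrite the cell at index `i` of the array `a`. -/
def setArr (σ : State) (a i v : ℕ) : State :=
  { σ with arr := Function.update σ.arr a (Function.update (σ.arr a) i v) }

end State

namespace Expr

/-- The value of an expression. -/
def eval (σ : State) : Expr → ℕ
  | lit k => k
  | var x => σ.reg x
  | get a e => σ.arr a (e.eval σ)
  | add e f => e.eval σ + f.eval σ
  | sub e f => e.eval σ - f.eval σ
  | mul e f => e.eval σ * f.eval σ
  | lt e f => if e.eval σ < f.eval σ then 1 else 0
  | eq e f => if e.eval σ = f.eval σ then 1 else 0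

/-- The time for evaluating an expression: one unit for each operation, each constant, and each
access to the memory. -/
def cost : Expr → ℕ
  | lit _ => 1
  | var _ => 1
  | get _ e => e.cost + 1
  | add e f => e.cost + f.cost + 1
  | sub e f => e.cost + f.cost + 1
  | mul e f => e.cost + f.cost + 1
  | lt e f => e.cost + f.cost + 1
  | eq e f => e.cost + f.cost + 1

/-- All values that arise in the evaluation of an expression, array indices included, fit into
a machine word, that is, are at most `W`. -/
def Fits (W : ℕ) (σ : State) : Expr → Prop
  | lit k => k ≤ W
  | var x => σ.reg x ≤ W
  | get a e => e.Fits W σ ∧ σ.arr a (e.eval σ) ≤ W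
  | add e f => e.Fits W σ ∧ f.Fits W σ ∧ e.eval σ + f.eval σ ≤ W
  | sub e f => e.Fits W σ ∧ f.Fits W σ
  | mul e f => e.Fits W σ ∧ f.Fits W σ ∧ e.eval σ * f.eval σ ≤ W
  | lt e f => e.Fits W σ ∧ f.Fits W σ ∧ 1 ≤ W
  | eq e f => e.Fits W σ ∧ f.Fits W σ ∧ 1 ≤ W

end Expr

/-- `Runs W p σ T τ`: with words that hold the numbers up to `W`, the program `p` started in the
configuration `σ` halts after exactly `T` time units in the configuration `τ`. -/
inductive Runs (W : ℕ) : Prog → State → ℕ → State → Prop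
  | skip (σ : State) : Runs W Prog.skip σ 1 σ
  | assign (x : ℕ) (e : Expr) (σ : State) (he : e.Fits W σ) :
      Runs W (Prog.assign x e) σ (e.cost + 1) (σ.setReg x (e.eval σ))
  | store (a : ℕ) (e f : Expr) (σ : State) (he : e.Fits W σ) (hf : f.Fits W σ) :
      Runs W (Prog.store a e f) σ (e.cost + f.cost + 1) (σ.setArr a (e.eval σ) (f.eval σ))
  | seq (p q : Prog) (σ τ υ : State) (A B : ℕ) (hp : Runs W p σ A τ) (hq : Runs W q τ B υ) :
      Runs W (Prog.seq p q) σ (A + B) υ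
  | cond_true (e : Expr) (p q : Prog) (σ τ : State) (A : ℕ) (he : e.Fits W σ)
      (h : e.eval σ ≠ 0) (hp : Runs W p σ A τ) :
      Runs W (Prog.cond e p q) σ (e.cost + 1 + A) τ
  | cond_false (e : Expr) (p q : Prog) (σ τ : State) (A : ℕ) (he : e.Fits W σ)
      (h : e.eval σ = 0) (hq : Runs W q σ A τ) :
      Runs W (Prog.cond e p q) σ (e.cost + 1 + A) τ
  | loop_done (e : Expr) (p : Prog) (σ : State) (he : e.Fits W σ) (h : e.eval σ = 0) :
      Runs W (Prog.loop e p) σ (e.cost + 1) σ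
  | loop_step (e : Expr) (p : Prog) (σ τ υ : State) (A B : ℕ) (he : e.Fits W σ)
      (h : e.eval σ ≠ 0) (hp : Runs W p σ A τ) (hl : Runs W (Prog.loop e p) τ B υ) :
      Runs W (Prog.loop e p) σ (e.cost + 1 + A + B) υ

/-! ### Input and output of a program -/

open Classical in
/-- The configuration in which a program is started on the input `I`: the registers `0, 1, 2, 3`
hold `n`, `c`, `s`, `t`, the array `0` holds the adjacency matrix row by row (entry `(i, j)` at
the index `i * n + j`), and the array `1` holds the colors. The rest of the memory is `0`. -/
def Inst.input (I : Inst) : State where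
  reg x :=
    if x = 0 then I.n else if x = 1 then I.c else if x = 2 then (I.s : ℕ)
    else if x = 3 then (I.t : ℕ) else 0
  arr a x :=
    if a = 0 then
      (if ∃ i j : Fin I.n, I.graph.Adj i j ∧ x = (i : ℕ) * I.n + (j : ℕ) then 1 else 0)
    else if a = 1 then (if h : x < I.n then (I.color ⟨x, h⟩ : ℕ) else 0)
    else 0

open Classical in
/-- The configuration `σ` holds the instance `I`, in the same format, as the output of a program.
The rest of the memory is arbitrary. -/
def Inst.IsOutput (I : Inst) (σ : State) : Prop :=
  σ.reg 0 = I.n ∧ σ.reg 1 = I.c ∧ σ.reg 2 = (I.s : ℕ) ∧ σ.reg 3 = (I.t : ℕ) ∧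
  (∀ i j : Fin I.n,
    σ.arr 0 ((i : ℕ) * I.n + (j : ℕ)) = if I.graph.Adj i j then 1 else 0) ∧
  (∀ i : Fin I.n, σ.arr 1 (i : ℕ) = (I.color i : ℕ))

end

end BalanceFair

/-! A greedy pass over all quadruples marks the vertices of pairwise disjoint induced four-vertex
paths; `s` and `t` are marked as well. Every set whose removal leaves a cograph meets each of these
paths, so the marked set `X` has `m ≤ 4k + 2` vertices, and `X` meets every induced four-vertex
path. Four consecutive vertices of a shortest path induce such a path. A shortest `s`-`t`-path
therefore splits at `X` into pieces with at most three inner vertices (`IsKernel.walk_induction`),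
and it has at most `4m` edges (`IsKernel.length_le`).

The kernel consists of a copy of `X` and of selected triples `u, v, w`, each of them a fresh copy
attached only to the two ends of its piece. Repetitions `u = v` or `v = w` encode shorter pieces.
Triples are grouped by their two ends and by the pattern of equalities among their vertices and
colors. Put `M = 16m`. A candidate is added only if, for each choice of fixed positions among the
three, fewer than `M ^ f` stored triples of its group have its colors there, where `f` is the number
of free positions. Hence a group has at most `M ^ 3` triples, and there are `O(m ^ 5)` vertices in
all (`KData.Valid.N_le`).

When a candidate is rejected, some choice of positions is saturated. If at each position a set of
fewer than `M / 3` colors is forbidden, not containing the candidate's own color, then fewer than a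
third of the saturating triples are bad at each position, so a good one remains
(`KData.Valid.exists_avoiding`). This is used in two ways. If `3c ≤ 16m`, all colors but the own one
can be forbidden, and the replacement has the same colors. If `3c > 16m`, a shortest path is too
short to contain all colors, so it is balance-fair exactly if its colors are distinct; the other
colors on the path number at most `4m < M / 3` and can be forbidden, while the pattern preserves
distinctness inside the piece. Replacing the pieces successively gives a kernel path
(`IsKernel.exists_lift`). Conversely, sending each copy to its original is a color-preserving graph
homomorphism, so kernel walks project to walks of equal length (`IsKernel.exists_lower`). With many
colors the kernel is recolored injectively with one spare color, which keeps the distinctness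
criterion.

Each triple vertex has boundedly many possible neighbors, and removing the copy of `X` leaves
components of at most three vertices; this bounds the edges and the new parameter
(`IsKernel.edges_le`, `IsKernel.param_le`). On the machine, up to `n ^ 5` candidates are each
compared with `O(n ^ 5)` stored vertices, within `O(n ^ 10)` steps. The parameter `k` enters only
the analysis. -/

namespace BalanceFair

/-! ### Reasoning about programs -/

/-- Does the program contain an assignment to the register `y`? -/
def Prog.wr : Prog → ℕ → Bool
  | .skip, _ => false
  | .assign x _, y => Nat.beq x y
  | .store _ _ _, _ => false
  | .seq p q, y => p.wr y || q.wr y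
  | .cond _ p q, y => p.wr y || q.wr y
  | .loop _ p, y => p.wr y

/-- Does the program contain a store into the array `b`? -/
def Prog.wa : Prog → ℕ → Bool
  | .skip, _ => false
  | .assign _ _, _ => false
  | .store a _ _, b => Nat.beq a b
  | .seq p q, y => p.wa y || q.wa y
  | .cond _ p q, y => p.wa y || q.wa y
  | .loop _ p, y => p.wa y

@[simp] theorem State.setReg_reg (σ : State) (x v y : ℕ) :
    (σ.setReg x v).reg y = if y = x then v else σ.reg y := by
  simp [State.setReg, Function.update_apply]

@[simp] theorem State.setReg_arr (σ : State) (x v : ℕ) : (σ.setReg x v).arr = σ.arr := rfl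

@[simp] theorem State.setArr_reg (σ : State) (a i v : ℕ) : (σ.setArr a i v).reg = σ.reg := rfl

@[simp] theorem State.setArr_arr (σ : State) (a i v b : ℕ) :
    (σ.setArr a i v).arr b = if b = a then Function.update (σ.arr a) i v else σ.arr b := by
  simp [State.setArr, Function.update_apply]

/-- `τ` arises from `σ` by changes to registers and arrays that occur in `p` as targets. -/
structure Frame (p : Prog) (σ τ : State) : Prop where
  reg : ∀ x, p.wr x = false → τ.reg x = σ.reg x
  arr : ∀ a, p.wa a = false → τ.arr a = σ.arr a

theorem Frame.refl (p : Prog) (σ : State) : Frame p σ σ := ⟨fun _ _ => rfl, fun _ _ => rfl⟩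

theorem Frame.trans {p : Prog} {σ τ υ : State} (h : Frame p σ τ) (h' : Frame p τ υ) :
    Frame p σ υ :=
  ⟨fun x hx => (h'.reg x hx).trans (h.reg x hx), fun x hx => (h'.arr x hx).trans (h.arr x hx)⟩

theorem Frame.mono {p q : Prog} {σ τ : State} (h : Frame p σ τ)
    (hr : ∀ x, q.wr x = false → p.wr x = false) (ha : ∀ x, q.wa x = false → p.wa x = false) :
    Frame q σ τ :=
  ⟨fun x hx => h.reg x (hr x hx), fun x hx => h.arr x (ha x hx)⟩

/-- Since targets of writes are read off the program text by Boolean functions, preservation of a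
named register or array later reduces to a computation. -/
theorem Runs.frame {W : ℕ} {p : Prog} {σ τ : State} {t : ℕ} (h : Runs W p σ t τ) :
    Frame p σ τ := by
  induction h with
  | skip σ => exact Frame.refl _ _
  | assign x e σ he =>
    refine ⟨fun y hy => ?_, fun a _ => rfl⟩
    have : ¬ y = x := by rintro rfl; simp [Prog.wr] at hy
    simp [this]
  | store a e f σ he hf =>
    refine ⟨fun y hy => rfl, fun b hb => ?_⟩
    have : ¬ b = a := by rintro rfl; simp [Prog.wa] at hb
    simp [this]
  | seq p q σ τ υ A B hp hq ihp ihq =>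
    refine Frame.trans (ihp.mono ?_ ?_) (ihq.mono ?_ ?_) <;> intro x hx <;>
      simp [Prog.wr, Prog.wa] at hx <;> simp [hx]
  | cond_true e p q σ τ A he h hp ih =>
    refine ih.mono ?_ ?_ <;> intro x hx <;> simp [Prog.wr, Prog.wa] at hx <;> simp [hx]
  | cond_false e p q σ τ A he h hp ih =>
    refine ih.mono ?_ ?_ <;> intro x hx <;> simp [Prog.wr, Prog.wa] at hx <;> simp [hx]
  | loop_done e p σ he h => exact Frame.refl _ _
  | loop_step e p σ τ υ A B he h hp hl ihp ihl =>
    exact Frame.trans (ihp.mono (fun x hx => hx) (fun x hx => hx)) ihl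

/-- All the registers and cells hold values at most `B`. -/
def Bdd (B : ℕ) (σ : State) : Prop := (∀ x, σ.reg x ≤ B) ∧ ∀ a i, σ.arr a i ≤ B

theorem Bdd.setReg {B : ℕ} {σ : State} (h : Bdd B σ) (x : ℕ) {v : ℕ} (hv : v ≤ B) :
    Bdd B (σ.setReg x v) := by
  refine ⟨fun y => ?_, h.2⟩
  rw [State.setReg_reg]
  split_ifs
  · exact hv
  · exact h.1 y

theorem Bdd.setArr {B : ℕ} {σ : State} (h : Bdd B σ) (a i : ℕ) {v : ℕ} (hv : v ≤ B) :
    Bdd B (σ.setArr a i v) := by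
  refine ⟨h.1, fun b j => ?_⟩
  rw [State.setArr_arr]
  split_ifs
  · rw [Function.update_apply]
    split_ifs
    · exact hv
    · exact h.2 _ _
  · exact h.2 _ _

/-- All literals of the expression are at most `20`. -/
def Expr.litsLe : Expr → Bool
  | .lit k => Nat.ble k 20
  | .var _ => true
  | .get _ e => e.litsLe
  | .add e f => e.litsLe && f.litsLe
  | .sub e f => e.litsLe && f.litsLe
  | .mul e f => e.litsLe && f.litsLe
  | .lt e f => e.litsLe && f.litsLe
  | .eq e f => e.litsLe && f.litsLe

/-- Bounds under which expressions of moderate size fit into words. -/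
structure Env (W B : ℕ) : Prop where
  lit : 20 ≤ B
  pow : (B + 2) ^ 200 ≤ W

/-- The expression has small literals and moderate size. -/
def Expr.ok (e : Expr) : Bool := e.litsLe && Nat.ble e.cost 200

/-- Each leaf contributes one factor `B + 2`, and each operation is paid for by exponents: products
add them, and a sum costs at most one extra factor because `2 ≤ B + 2`. -/
theorem Expr.fits_aux {W B : ℕ} (hB : 20 ≤ B) {σ : State} (hσ : Bdd B σ) (e : Expr)
    (he : e.litsLe = true) (hW : (B + 2) ^ e.cost ≤ W) :
    e.Fits W σ ∧ e.eval σ ≤ (B + 2) ^ e.cost := by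
  have mono : ∀ {a b : ℕ}, a ≤ b → (B + 2) ^ a ≤ (B + 2) ^ b :=
    fun h => Nat.pow_le_pow_right (by omega) h
  have two : ∀ (a b : ℕ), (B + 2) ^ a + (B + 2) ^ b ≤ (B + 2) ^ (a + b + 1) := by
    intro a b
    have h1 : (B + 2) ^ a ≤ (B + 2) ^ (a + b) := mono (by omega)
    have h2 : (B + 2) ^ b ≤ (B + 2) ^ (a + b) := mono (by omega)
    rw [pow_succ]
    have h3 := Nat.mul_le_mul_left ((B + 2) ^ (a + b)) (show 2 ≤ B + 2 by omega)
    omega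
  have one : ∀ a : ℕ, 1 ≤ (B + 2) ^ a := fun a => Nat.one_le_pow _ _ (by omega)
  induction e with
  | lit k =>
    simp only [Expr.litsLe, Nat.ble_eq] at he
    simp only [Expr.cost, pow_one] at hW
    simp only [Expr.Fits, Expr.eval, Expr.cost, pow_one]
    omega
  | var x =>
    have := hσ.1 x
    simp only [Expr.cost, pow_one] at hW
    simp only [Expr.Fits, Expr.eval, Expr.cost, pow_one]
    omega
  | get a e ih =>
    have h1 := mono (show e.cost ≤ e.cost + 1 by omega)
    have h2 := mono (show 1 ≤ e.cost + 1 by omega)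
    simp only [Expr.cost] at hW
    simp only [Expr.Fits, Expr.eval, Expr.cost]
    obtain ⟨i1, i2⟩ := ih he (h1.trans hW)
    have := hσ.2 a (e.eval σ)
    simp only [pow_one] at h2
    exact ⟨⟨i1, by omega⟩, by omega⟩
  | add e f ihe ihf =>
    simp only [Expr.litsLe, Bool.and_eq_true] at he
    simp only [Expr.cost] at hW
    obtain ⟨i1, i2⟩ := ihe he.1 ((mono (by omega)).trans hW)
    obtain ⟨j1, j2⟩ := ihf he.2 ((mono (by omega)).trans hW)
    have := two e.cost f.cost
    simp only [Expr.Fits, Expr.eval, Expr.cost]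
    exact ⟨⟨i1, j1, by omega⟩, by omega⟩
  | sub e f ihe ihf =>
    simp only [Expr.litsLe, Bool.and_eq_true] at he
    simp only [Expr.cost] at hW
    obtain ⟨i1, i2⟩ := ihe he.1 ((mono (by omega)).trans hW)
    obtain ⟨j1, j2⟩ := ihf he.2 ((mono (by omega)).trans hW)
    have := two e.cost f.cost
    simp only [Expr.Fits, Expr.eval, Expr.cost]
    exact ⟨⟨i1, j1⟩, by omega⟩
  | mul e f ihe ihf =>
    simp only [Expr.litsLe, Bool.and_eq_true] at he
    simp only [Expr.cost] at hW
    obtain ⟨i1, i2⟩ := ihe he.1 ((mono (by omega)).trans hW)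
    obtain ⟨j1, j2⟩ := ihf he.2 ((mono (by omega)).trans hW)
    have h1 : e.eval σ * f.eval σ ≤ (B + 2) ^ (e.cost + f.cost + 1) := by
      calc _ ≤ (B + 2) ^ e.cost * (B + 2) ^ f.cost := Nat.mul_le_mul i2 j2
        _ = (B + 2) ^ (e.cost + f.cost) := (pow_add _ _ _).symm
        _ ≤ _ := mono (by omega)
    simp only [Expr.Fits, Expr.eval, Expr.cost]
    exact ⟨⟨i1, j1, by omega⟩, by omega⟩
  | lt e f ihe ihf =>
    simp only [Expr.litsLe, Bool.and_eq_true] at he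
    simp only [Expr.cost] at hW
    obtain ⟨i1, i2⟩ := ihe he.1 ((mono (by omega)).trans hW)
    obtain ⟨j1, j2⟩ := ihf he.2 ((mono (by omega)).trans hW)
    have := one (e.cost + f.cost + 1)
    simp only [Expr.Fits, Expr.eval, Expr.cost]
    exact ⟨⟨i1, j1, by omega⟩, by split_ifs <;> omega⟩
  | eq e f ihe ihf =>
    simp only [Expr.litsLe, Bool.and_eq_true] at he
    simp only [Expr.cost] at hW
    obtain ⟨i1, i2⟩ := ihe he.1 ((mono (by omega)).trans hW)
    obtain ⟨j1, j2⟩ := ihf he.2 ((mono (by omega)).trans hW)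
    have := one (e.cost + f.cost + 1)
    simp only [Expr.Fits, Expr.eval, Expr.cost]
    exact ⟨⟨i1, j1, by omega⟩, by split_ifs <;> omega⟩

theorem Expr.fits {W B : ℕ} (env : Env W B) {σ : State} (hσ : Bdd B σ) {e : Expr}
    (he : e.ok = true) : e.Fits W σ := by
  simp only [Expr.ok, Bool.and_eq_true, Nat.ble_eq] at he
  exact (Expr.fits_aux env.lit hσ e he.1
    ((Nat.pow_le_pow_right (by omega) he.2).trans env.pow)).1

/-- Started in `σ`, the program `p` halts after at most `T` steps in a configuration that holds
only values up to `B` and that satisfies `Q`. -/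
def Ok (W B : ℕ) (σ : State) (p : Prog) (T : ℕ) (Q : State → Prop) : Prop :=
  ∃ t τ, t ≤ T ∧ Runs W p σ t τ ∧ Bdd B τ ∧ Q τ

section Rules

variable {W B : ℕ} {σ : State} {p q : Prog} {T T' : ℕ} {Q Q' : State → Prop}

theorem Ok.mono (h : Ok W B σ p T Q) (hT : T ≤ T')
    (hQ : ∀ τ, Bdd B τ → Frame p σ τ → Q τ → Q' τ) : Ok W B σ p T' Q' := by
  obtain ⟨t, τ, ht, hr, hb, hq⟩ := h
  exact ⟨t, τ, ht.trans hT, hr, hb, hQ τ hb hr.frame hq⟩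

theorem Ok.time (h : Ok W B σ p T Q) (hT : T ≤ T') : Ok W B σ p T' Q :=
  h.mono hT fun _ _ _ h => h

theorem Ok.skip (hσ : Bdd B σ) (h : Q σ) : Ok W B σ .skip 1 Q :=
  ⟨1, σ, le_rfl, .skip σ, hσ, h⟩

theorem Ok.assign (env : Env W B) (hσ : Bdd B σ) {x : ℕ} {e : Expr} (he : e.ok = true)
    (hB : e.eval σ ≤ B) (h : Q (σ.setReg x (e.eval σ))) :
    Ok W B σ (.assign x e) (e.cost + 1) Q :=
  ⟨_, _, le_rfl, .assign x e σ (Expr.fits env hσ he), hσ.setReg x hB, h⟩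

theorem Ok.store (env : Env W B) (hσ : Bdd B σ) {a : ℕ} {e f : Expr} (he : e.ok = true)
    (hf : f.ok = true) (hB : f.eval σ ≤ B) (h : Q (σ.setArr a (e.eval σ) (f.eval σ))) :
    Ok W B σ (.store a e f) (e.cost + f.cost + 1) Q :=
  ⟨_, _, le_rfl, .store a e f σ (Expr.fits env hσ he) (Expr.fits env hσ hf), hσ.setArr a _ hB, h⟩

/-- In this continuation form the postcondition of `p` is the correctness of the rest, so a proof
can follow the program text without naming intermediate assertions. -/
theorem Ok.seq (hp : Ok W B σ p T (fun τ => Bdd B τ → Ok W B τ q T' Q)) :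
    Ok W B σ (.seq p q) (T + T') Q := by
  obtain ⟨t, τ, ht, hr, hb, hq⟩ := hp
  obtain ⟨t', υ, ht', hr', hb', hq'⟩ := hq hb
  exact ⟨t + t', υ, by omega, .seq _ _ _ _ _ _ _ hr hr', hb', hq'⟩

theorem Ok.cond (env : Env W B) (hσ : Bdd B σ) {e : Expr} (he : e.ok = true)
    (hp : e.eval σ ≠ 0 → Ok W B σ p T Q) (hq : e.eval σ = 0 → Ok W B σ q T Q) :
    Ok W B σ (.cond e p q) (e.cost + 1 + T) Q := by
  by_cases h : e.eval σ = 0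
  · obtain ⟨t, τ, ht, hr, hb, hq⟩ := hq h
    exact ⟨_, τ, by omega, .cond_false e _ _ _ _ _ (Expr.fits env hσ he) h hr, hb, hq⟩
  · obtain ⟨t, τ, ht, hr, hb, hq⟩ := hp h
    exact ⟨_, τ, by omega, .cond_true e _ _ _ _ _ (Expr.fits env hσ he) h hr, hb, hq⟩

end Rules

/-! ### Counting loops and nests of them -/

/-- The loop "for `x` from `0` to the content of the register `r` minus one do `p`". -/
def forP (x r : ℕ) (p : Prog) : Prog :=
  .seq (.assign x (.lit 0))
    (.loop (.lt (.var x) (.var r)) (.seq p (.assign x (.add (.var x) (.lit 1)))))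

theorem forP_wr (x r : ℕ) (p : Prog) (y : ℕ) :
    (forP x r p).wr y = false ↔ y ≠ x ∧ p.wr y = false := by
  simp only [forP, Prog.wr, Bool.or_eq_false_iff]
  rw [← Bool.not_eq_true, Nat.beq_eq]
  tauto

theorem forP_wa (x r : ℕ) (p : Prog) (y : ℕ) : (forP x r p).wa y = p.wa y := by
  simp [forP, Prog.wa]

/-- The proof is by induction on the number of remaining rounds. The invariant is required after the
counter has been advanced, because the increment follows the body. -/
theorem Ok.forP {W B : ℕ} (env : Env W B) {σ : State} (hσ : Bdd B σ) {x r : ℕ} {p : Prog}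
    {T N : ℕ} (hx : p.wr x = false) (hr : p.wr r = false) (hxr : r ≠ x) (hN : σ.reg r = N)
    (Inv : ℕ → State → Prop) (h0 : Inv 0 (σ.setReg x 0))
    (step : ∀ i < N, ∀ τ, Bdd B τ → Frame (forP x r p) σ τ → τ.reg x = i → Inv i τ →
      Ok W B τ p T (fun τ' => Inv (i + 1) (τ'.setReg x (i + 1)))) :
    Ok W B σ (forP x r p) (6 + N * (T + 8)) (Inv N) := by
  have hrf : (BalanceFair.forP x r p).wr r = false := (forP_wr x r p r).2 ⟨hxr, hr⟩
  have hNB : N ≤ B := hN ▸ hσ.1 r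
  have key : ∀ k i τ, i + k = N → Bdd B τ → Frame (BalanceFair.forP x r p) σ τ → τ.reg x = i →
      Inv i τ → Ok W B τ
        (.loop (.lt (.var x) (.var r)) (.seq p (.assign x (.add (.var x) (.lit 1)))))
        (4 + k * (T + 8)) (Inv N) := by
    intro k
    induction k with
    | zero =>
      intro i τ hi hb hf hxi hinv
      obtain rfl : i = N := by omega
      have hri : τ.reg r = i := (hf.reg r hrf).trans hN
      refine ⟨_, τ, ?_, .loop_done _ _ _ (Expr.fits env hb rfl) ?_, hb, hinv⟩
      · simp [Expr.cost]
      · simp [Expr.eval, hri, hxi]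
    | succ k ih =>
      intro i τ hi hb hf hxi hinv
      have hri : τ.reg r = N := (hf.reg r hrf).trans hN
      obtain ⟨t, υ, ht, hrun, hbu, hq⟩ := step i (by omega) τ hb hf hxi hinv
      have hfu : Frame (BalanceFair.forP x r p) τ υ :=
        hrun.frame.mono (fun y hy => ((forP_wr x r p y).1 hy).2)
          (fun y hy => (forP_wa x r p y).symm.trans hy)
      have hux : υ.reg x = i := (hrun.frame.reg x hx).trans hxi
      have hev : (Expr.add (.var x) (.lit 1)).eval υ = i + 1 := by simp [Expr.eval, hux]
      have hrun2 := Runs.assign (W := W) x (.add (.var x) (.lit 1)) υ (Expr.fits env hbu rfl)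
      rw [hev] at hrun2
      have hb2 : Bdd B (υ.setReg x (i + 1)) := hbu.setReg x (by omega)
      have hf2 : Frame (BalanceFair.forP x r p) σ (υ.setReg x (i + 1)) := by
        refine (hf.trans hfu).trans ⟨fun y hy => ?_, fun _ _ => rfl⟩
        simp [((forP_wr x r p y).1 hy).1]
      obtain ⟨t', ω, ht', hrun', hbw, hqw⟩ :=
        ih (i + 1) _ (by omega) hb2 hf2 (by simp) hq
      refine ⟨_, ω, ?_, .loop_step _ _ _ _ _ _ _ (Expr.fits env hb rfl) ?_
        (.seq _ _ _ _ _ _ _ hrun hrun2) hrun', hbw, hqw⟩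
      · simp only [Expr.cost]
        rw [Nat.succ_mul]
        omega
      · simp only [Expr.eval, hri, hxi]
        rw [if_pos (by omega)]
        exact one_ne_zero
  have hf1 : Frame (BalanceFair.forP x r p) σ (σ.setReg x 0) := by
    refine ⟨fun y hy => ?_, fun _ _ => rfl⟩
    simp [((forP_wr x r p y).1 hy).1]
  obtain ⟨t, τ, ht, hrun, hb, hq⟩ := key N 0 (σ.setReg x 0) (by omega) (hσ.setReg x (by omega))
    hf1 (by simp) h0
  refine ⟨2 + t, τ, by omega, ?_, hb, hq⟩
  exact .seq _ _ _ _ _ _ _ (.assign x (.lit 0) σ (Expr.fits env hσ rfl)) hrun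

/-- Nested loops; the list holds the pairs of a loop variable and a bound register. -/
def nest : List (ℕ × ℕ) → Prog → Prog
  | [], p => p
  | (x, r) :: l, p => forP x r (nest l p)

/-- The loop variables of a nest are distinct, and neither they nor the bounds are overwritten. -/
def nestOk : List (ℕ × ℕ) → Prog → Bool
  | [], _ => true
  | (x, r) :: l, p =>
    !((nest l p).wr x) && ((x, r) :: l).all (fun yr => !((nest ((x, r) :: l) p).wr yr.2)) &&
      nestOk l p

/-- Time of a nest with the given numbers of iterations. -/
def nestTime : List ℕ → ℕ → ℕ
  | [], T => T
  | N :: l, T => 6 + N * (nestTime l T + 8)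

/-- Induction on the list of loops. For the inner nest the outer index becomes the first entry of
`is`, and `Ctx` is strengthened to remember its register and its bound. The projection `view` hides
the counters, so advancing them cannot disturb the invariant; monotonicity along `R` keeps what
earlier rounds established. -/
theorem nest_ok_aux {W B : ℕ} (env : Env W B) {α : Type*} (view : State → α) (Inv : α → Prop)
    (R : α → α → Prop) (hrefl : ∀ a, R a a) (htrans : ∀ a b c, R a b → R b c → R a c)
    (p : Prog) (T : ℕ) (l : List (ℕ × ℕ)) (hl : nestOk l p = true)
    (hview : ∀ x ∈ l.map Prod.fst, ∀ τ v, view (State.setReg τ x v) = view τ)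
    (φ : List ℕ → α → Prop) (hstab : ∀ is a b, φ is a → R a b → φ is b)
    (Ctx : State → Prop) (hCtx : ∀ τ τ', Ctx τ → Frame (nest l p) τ τ' → Ctx τ')
    (body : ∀ is τ, Bdd B τ → Ctx τ →
      List.Forall₂ (fun i xr => i < τ.reg xr.2 ∧ τ.reg xr.1 = i) is l → Inv (view τ) →
      Ok W B τ p T (fun τ' => Inv (view τ') ∧ R (view τ) (view τ') ∧ φ is (view τ')))
    (σ : State) (hσ : Bdd B σ) (hc : Ctx σ) (hI : Inv (view σ)) :
    Ok W B σ (nest l p) (nestTime (l.map fun xr => σ.reg xr.2) T) (fun τ' => Inv (view τ') ∧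
      R (view σ) (view τ') ∧
      ∀ is, List.Forall₂ (fun i xr => i < σ.reg xr.2) is l → φ is (view τ')) := by
  induction l generalizing φ Ctx σ with
  | nil =>
    refine (body [] σ hσ hc List.Forall₂.nil hI).mono le_rfl ?_
    rintro τ - - ⟨h1, h2, h3⟩
    refine ⟨h1, h2, fun is his => ?_⟩
    cases his
    exact h3
  | cons xr l ih =>
    obtain ⟨x, r⟩ := xr
    simp only [nestOk, Bool.and_eq_true, Bool.not_eq_true'] at hl
    obtain ⟨⟨hx, hr⟩, hl⟩ := hl
    simp only [List.all_eq_true, Bool.not_eq_true'] at hr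
    have hrf : (nest ((x, r) :: l) p).wr r = false := hr _ List.mem_cons_self
    obtain ⟨hxr', hr'⟩ := (forP_wr x r _ r).1 hrf
    have hvx : ∀ τ v, view (State.setReg τ x v) = view τ := hview x (by simp)
    have hwx : ∀ y, (nest ((x, r) :: l) p).wr y = false → (nest l p).wr y = false :=
      fun y hy => ((forP_wr x r _ y).1 hy).2
    have hwa : ∀ y, (nest ((x, r) :: l) p).wa y = false → (nest l p).wa y = false :=
      fun y hy => (forP_wa x r _ y).symm.trans hy
    have hframe : ∀ {τ τ'}, Frame (nest l p) τ τ' → Frame (nest ((x, r) :: l) p) τ τ' :=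
      fun h => h.mono hwx hwa
    have hbd : ∀ {τ}, Frame (nest ((x, r) :: l) p) σ τ → ∀ yr ∈ l, τ.reg yr.2 = σ.reg yr.2 :=
      fun h yr hyr => h.reg _ (hr yr (List.mem_cons_of_mem _ hyr))
    have hall : ∀ {τ} (P : ℕ → ℕ → ℕ → Prop) (is), Frame (nest ((x, r) :: l) p) σ τ →
        (List.Forall₂ (fun i yr => P i (τ.reg yr.2) yr.1) is l ↔
          List.Forall₂ (fun i yr => P i (σ.reg yr.2) yr.1) is l) := by
      intro τ P is hf
      have := hbd hf
      clear * - this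
      induction is generalizing l with
      | nil => cases l <;> simp
      | cons i is ih =>
        cases l with
        | nil => simp
        | cons y l =>
          simp only [List.forall₂_cons]
          exact and_congr (by rw [this y (by simp)])
            (ih l fun yr h => this yr (List.mem_cons_of_mem _ h))
    refine (Ok.forP env hσ (T := nestTime (l.map fun xr => σ.reg xr.2) T) hx hr' hxr' rfl
      (fun i τ => Inv (view τ) ∧ R (view σ) (view τ) ∧ ∀ j < i, ∀ is,
        List.Forall₂ (fun i xr => i < σ.reg xr.2) is l → φ (j :: is) (view τ)) ?_ ?_).mono
          le_rfl ?_
    · rw [hvx]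
      exact ⟨hI, hrefl _, by omega⟩
    · rintro i hi τ hb hf hxi ⟨hI', hR, hφ⟩
      have hmap : (l.map fun xr => σ.reg xr.2) = l.map fun xr => τ.reg xr.2 :=
        List.map_congr_left fun yr hyr => (hbd hf yr hyr).symm
      rw [hmap]
      refine (ih hl (fun y hy => hview y (by simp [hy])) (fun is => φ (i :: is))
        (fun is a b => hstab (i :: is) a b) (fun τ => Ctx τ ∧ τ.reg x = i ∧ τ.reg r = σ.reg r) ?_ ?_ τ hb ?_ hI').mono
          le_rfl ?_
      · rintro υ υ' ⟨hυ, hυx, hυr⟩ hf'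
        exact ⟨hCtx _ _ hυ (hframe hf'), (hf'.reg x hx).trans hυx, (hf'.reg r hr').trans hυr⟩
      · rintro is υ hbυ ⟨hυ, hυx, hυr⟩ his hIυ
        exact body (i :: is) υ hbυ hυ (List.Forall₂.cons ⟨hυr ▸ hi, hυx⟩ his) hIυ
      · exact ⟨hCtx _ _ hc hf, hxi, hf.reg r hrf⟩
      · rintro υ hbυ hfυ ⟨g1, g2, g3⟩
        rw [hvx]
        refine ⟨g1, htrans _ _ _ hR g2, fun j hj is his => ?_⟩
        rcases Nat.lt_succ_iff_lt_or_eq.1 hj with hj | rfl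
        · exact hstab _ _ _ (hφ j hj is his) g2
        · exact g3 is ((hall (fun i b _ => i < b) is hf).2 his)
    · rintro τ - - ⟨h1, h2, h3⟩
      refine ⟨h1, h2, fun is his => ?_⟩
      cases his with
      | cons hi his => exact h3 _ hi _ his

/-- Nested loops: `Inv` is an invariant, `R` a preorder along which the memory develops, and
`φ is` holds once the body was executed for the values `is` of the loop variables. -/
theorem Ok.nest {W B : ℕ} (env : Env W B) {σ : State} (hσ : Bdd B σ) {α : Type*}
    (view : State → α) (Inv : α → Prop) (R : α → α → Prop) (φ : List ℕ → α → Prop)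
    {p : Prog} {T : ℕ} {l : List (ℕ × ℕ)} (hI : Inv (view σ)) (hl : nestOk l p = true)
    (hview : ∀ x ∈ l.map Prod.fst, ∀ τ v, view (State.setReg τ x v) = view τ)
    (hrefl : ∀ a, R a a) (htrans : ∀ a b c, R a b → R b c → R a c)
    (hstab : ∀ is a b, φ is a → R a b → φ is b)
    (body : ∀ is τ, Bdd B τ → Frame (nest l p) σ τ →
      List.Forall₂ (fun i xr => i < τ.reg xr.2 ∧ τ.reg xr.1 = i) is l → Inv (view τ) →
      Ok W B τ p T (fun τ' => Inv (view τ') ∧ R (view τ) (view τ') ∧ φ is (view τ'))) :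
    Ok W B σ (BalanceFair.nest l p) (nestTime (l.map fun xr => σ.reg xr.2) T)
      (fun τ' => Inv (view τ') ∧ R (view σ) (view τ') ∧
        ∀ is, List.Forall₂ (fun i xr => i < σ.reg xr.2) is l → φ is (view τ')) :=
  nest_ok_aux env view Inv R hrefl htrans p T l hl hview φ hstab (Frame (BalanceFair.nest l p) σ)
    (fun _ _ h h' => h.trans h') body σ hσ (Frame.refl _ _) hI

end BalanceFair

namespace BalanceFair

/-! ### Families of segments -/

/-- The vertices `a, b, c, d` induce a path, in this order. -/
def IsP4 (adj : ℕ → ℕ → Prop) (a b c d : ℕ) : Prop :=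
  adj a b ∧ adj b c ∧ adj c d ∧ ¬ adj a c ∧ ¬ adj a d ∧ ¬ adj b d

/-- Truth value as a number. -/
def ind (p : Prop) [Decidable p] : ℕ := if p then 1 else 0

theorem ind_le (p : Prop) [Decidable p] : ind p ≤ 1 := by
  unfold ind
  split_ifs <;> omega

theorem ind_eq_iff {p q : Prop} [Decidable p] [Decidable q] : ind p = ind q ↔ (p ↔ q) := by
  unfold ind
  split_ifs with h1 h2 h2 <;> simp [h1, h2]

/-- The code of the pattern of equalities between three vertices and between their colors. -/
def gcode (u v w a b c : ℕ) : ℕ :=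
  ind (u = v) + 2 * ind (v = w) + 4 * ind (a = b) + 8 * ind (b = c) + 16 * ind (a = c)

theorem gcode_lt (u v w a b c : ℕ) : gcode u v w a b c < 32 := by
  have h1 := ind_le (u = v)
  have h2 := ind_le (v = w)
  have h3 := ind_le (a = b)
  have h4 := ind_le (b = c)
  have h5 := ind_le (a = c)
  unfold gcode
  omega

/-- The weights are distinct powers of two, so the five indicators are the binary digits of the
code. The equality of the first and third vertex is not recorded: it is never needed. -/
theorem gcode_eq {u v w a b c u' v' w' a' b' c' : ℕ}
    (h : gcode u v w a b c = gcode u' v' w' a' b' c') :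
    (u = v ↔ u' = v') ∧ (v = w ↔ v' = w') ∧ (a = b ↔ a' = b') ∧ (b = c ↔ b' = c') ∧
      (a = c ↔ a' = c') := by
  simp only [← ind_eq_iff]
  have h1 := ind_le (u = v)
  have h2 := ind_le (v = w)
  have h3 := ind_le (a = b)
  have h4 := ind_le (b = c)
  have h5 := ind_le (a = c)
  have h1' := ind_le (u' = v')
  have h2' := ind_le (v' = w')
  have h3' := ind_le (a' = b')
  have h4' := ind_le (b' = c')
  have h5' := ind_le (a' = c')
  unfold gcode at h
  omega

/-- The vertices of the graph under construction: there are `N` of them, `org` and `oc` give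
their original vertices and colors. Apart from an initial part, they come in triples
`q, q + 1, q + 2` with base `q`. The array `sg` gives the base, `A q` and `B q` the successors of
the two initial vertices that the triple joins, and `G q` the code of the triple. -/
structure KData where
  N : ℕ
  org : ℕ → ℕ
  oc : ℕ → ℕ
  sg : ℕ → ℕ
  A : ℕ → ℕ
  B : ℕ → ℕ
  G : ℕ → ℕ

/-- The walk `x, u, v, w, y` that may pause at `v` and at `w`. -/
def Link (adj : ℕ → ℕ → Prop) (x u v w y : ℕ) : Prop :=
  adj x u ∧ (u = v ∨ adj u v) ∧ (v = w ∨ adj v w) ∧ adj w y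

/-- The number `M` for free positions and `1` for fixed ones. -/
def bd (M e : ℕ) : ℕ := if e = 0 then M else 1

namespace KData

/-- The triple at `q` belongs to the group of `a, b, g` and agrees with the colors `c₁, c₂, c₃`
at the positions for which `e₁, e₂, e₃` are nonzero. -/
def Agrees (D : KData) (a b g e₁ e₂ e₃ c₁ c₂ c₃ q : ℕ) : Prop :=
  D.A q = a ∧ D.B q = b ∧ D.G q = g ∧ (e₁ = 0 ∨ D.oc q = c₁) ∧ (e₂ = 0 ∨ D.oc (q + 1) = c₂) ∧
    (e₃ = 0 ∨ D.oc (q + 2) = c₃)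

instance (D : KData) (a b g e₁ e₂ e₃ c₁ c₂ c₃ : ℕ) :
    DecidablePred (D.Agrees a b g e₁ e₂ e₃ c₁ c₂ c₃) := fun q => by
  unfold Agrees
  infer_instance

/-- The set of triples that agree with the given data. -/
def agr (D : KData) (a b g e₁ e₂ e₃ c₁ c₂ c₃ : ℕ) : Finset ℕ :=
  (Finset.range D.N).filter (D.Agrees a b g e₁ e₂ e₃ c₁ c₂ c₃)

/-- The properties of the data during the construction, with `m` initial vertices. -/
structure Valid (D : KData) (adj : ℕ → ℕ → Prop) (col : ℕ → ℕ) (n m M : ℕ) : Prop where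
  mpos : 0 < m
  mN : m ≤ D.N
  Mpos : 0 < M
  org_lt : ∀ p < D.N, D.org p < n
  oc_eq : ∀ p < D.N, D.oc p = col (D.org p)
  sg_init : ∀ p < m, D.sg p = 0
  sg_triple : ∀ p, m ≤ p → p < D.N → D.sg p ≤ p ∧ p ≤ D.sg p + 2 ∧ D.A (D.sg p) ≠ 0
  base : ∀ q, D.A q ≠ 0 → m ≤ q ∧ q + 2 < D.N ∧ D.sg q = q ∧ D.sg (q + 1) = q ∧
    D.sg (q + 2) = q
  ends : ∀ q, D.A q ≠ 0 → D.A q ≤ m ∧ D.B q ≠ 0 ∧ D.B q ≤ m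
  B_zero : ∀ q, D.A q = 0 → D.B q = 0
  link : ∀ q, D.A q ≠ 0 → Link adj (D.org (D.A q - 1)) (D.org q) (D.org (q + 1))
    (D.org (q + 2)) (D.org (D.B q - 1))
  code : ∀ q, D.A q ≠ 0 → D.G q = gcode (D.org q) (D.org (q + 1)) (D.org (q + 2))
    (D.oc q) (D.oc (q + 1)) (D.oc (q + 2))
  count : ∀ a b g e₁ e₂ e₃ c₁ c₂ c₃, a ≠ 0 →
    (D.agr a b g e₁ e₂ e₃ c₁ c₂ c₃).card ≤ bd M e₁ * bd M e₂ * bd M e₃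

/-- Append a triple. -/
def push (D : KData) (col : ℕ → ℕ) (i j u v w g : ℕ) : KData where
  N := D.N + 3
  org := Function.update (Function.update (Function.update D.org D.N u) (D.N + 1) v) (D.N + 2) w
  oc := Function.update (Function.update (Function.update D.oc D.N (col u)) (D.N + 1) (col v))
    (D.N + 2) (col w)
  sg := Function.update (Function.update (Function.update D.sg D.N D.N) (D.N + 1) D.N)
    (D.N + 2) D.N
  A := Function.update D.A D.N (i + 1)
  B := Function.update D.B D.N (j + 1)
  G := Function.update D.G D.N g

section

variable {D : KData} {adj : ℕ → ℕ → Prop} {col : ℕ → ℕ} {n m M : ℕ}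

theorem upd3 (f : ℕ → ℕ) (N a b c p : ℕ) :
    Function.update (Function.update (Function.update f N a) (N + 1) b) (N + 2) c p =
      if p = N + 2 then c else if p = N + 1 then b else if p = N then a else f p := by
  simp only [Function.update_apply]

theorem Valid.A_eq_zero (h : D.Valid adj col n m M) {q : ℕ} (hq : D.N ≤ q + 2) : D.A q = 0 := by
  by_contra h'
  have := (h.base q h').2.1
  omega

theorem mem_agr {a b g e₁ e₂ e₃ c₁ c₂ c₃ q : ℕ} :
    q ∈ D.agr a b g e₁ e₂ e₃ c₁ c₂ c₃ ↔ q < D.N ∧ D.Agrees a b g e₁ e₂ e₃ c₁ c₂ c₃ q := by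
  simp [agr]

/-- The only new base is the old `N`: the next two positions still have `A` equal to zero, and an
old triple lies completely below `N`, so the colors it is compared with are untouched. -/
theorem agr_push (h : D.Valid adj col n m M) (i j u v w g a b g' e₁ e₂ e₃ c₁ c₂ c₃ : ℕ)
    (ha : a ≠ 0) :
    (D.push col i j u v w g).agr a b g' e₁ e₂ e₃ c₁ c₂ c₃ =
      if a = i + 1 ∧ b = j + 1 ∧ g' = g ∧ (e₁ = 0 ∨ col u = c₁) ∧ (e₂ = 0 ∨ col v = c₂) ∧
        (e₃ = 0 ∨ col w = c₃) then insert D.N (D.agr a b g' e₁ e₂ e₃ c₁ c₂ c₃)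
      else D.agr a b g' e₁ e₂ e₃ c₁ c₂ c₃ := by
  have h1 := h.A_eq_zero (q := D.N) (by omega)
  have key : ∀ q, q ∈ (D.push col i j u v w g).agr a b g' e₁ e₂ e₃ c₁ c₂ c₃ ↔
      (q = D.N ∧ (a = i + 1 ∧ b = j + 1 ∧ g' = g ∧ (e₁ = 0 ∨ col u = c₁) ∧
        (e₂ = 0 ∨ col v = c₂) ∧ (e₃ = 0 ∨ col w = c₃))) ∨
      q ∈ D.agr a b g' e₁ e₂ e₃ c₁ c₂ c₃ := by
    intro q
    simp only [mem_agr, Agrees, push, Function.update_apply]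
    rcases lt_trichotomy q D.N with hq | rfl | hq
    · by_cases hA : D.A q = a
      · have := (h.base q (by omega)).2.1
        simp [show q < D.N + 3 by omega, show ¬ q = D.N by omega, show ¬ q = D.N + 1 by omega,
          show ¬ q = D.N + 2 by omega, show ¬ q + 1 = D.N by omega,
          show ¬ q + 2 = D.N by omega, show ¬ q + 2 = D.N + 1 by omega, hq]
      · have h3 : q ≠ D.N := by omega
        simp [hA, h3]
    · simp [eq_comm (a := a), eq_comm (a := b), eq_comm (a := g')]
    · have hA := h.A_eq_zero (q := q) (by omega)
      have h3 : q ≠ D.N := by omega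
      simp [hA, h3, ha.symm]
  ext q
  rw [key]
  split_ifs with hc
  · simp [hc]
  · simp [hc]

/-- Only counts that include the new triple can grow. For these the prescribed colors are the
candidate's own, so the strict inequalities of the acceptance test leave room for one more. -/
theorem Valid.push (h : D.Valid adj col n m M) {i j u v w : ℕ} (hi : i < m) (hj : j < m)
    (hu : u < n) (hv : v < n) (hw : w < n) (hl : Link adj (D.org i) u v w (D.org j))
    (hc : ∀ e₁ < 2, ∀ e₂ < 2, ∀ e₃ < 2,
      (D.agr (i + 1) (j + 1) (gcode u v w (col u) (col v) (col w)) e₁ e₂ e₃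
        (col u) (col v) (col w)).card < bd M e₁ * bd M e₂ * bd M e₃) :
    (D.push col i j u v w (gcode u v w (col u) (col v) (col w))).Valid adj col n m M := by
  have hmN := h.mN
  have hbase := h.base
  have hA : (D.push col i j u v w (gcode u v w (col u) (col v) (col w))).A =
    Function.update D.A D.N (i + 1) := rfl
  have hcases : ∀ q, (D.push col i j u v w (gcode u v w (col u) (col v) (col w))).A q ≠ 0 →
      q = D.N ∨ (q + 2 < D.N ∧ D.A q ≠ 0) := by
    intro q hq
    rw [hA, Function.update_apply] at hq
    split_ifs at hq with h1
    · exact Or.inl h1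
    · exact Or.inr ⟨(hbase q hq).2.1, hq⟩
  refine ⟨h.mpos, ?_, h.Mpos, ?_, ?_, ?_, ?_, ?_, ?_, ?_, ?_, ?_, ?_⟩
  · simp only [KData.push]
    omega
  · intro p hp
    simp only [KData.push] at hp
    simp only [KData.push, upd3]
    split_ifs
    any_goals assumption
    exact h.org_lt p (by omega)
  · intro p hp
    simp only [KData.push] at hp
    simp only [KData.push, upd3]
    split_ifs
    any_goals rfl
    exact h.oc_eq p (by omega)
  · intro p hp
    simp only [KData.push, upd3]
    rw [if_neg (by omega), if_neg (by omega), if_neg (by omega)]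
    exact h.sg_init p hp
  · intro p hmp hp
    simp only [KData.push] at hp
    simp only [KData.push, Function.update_apply]
    rcases lt_or_ge p D.N with hpN | hpN
    · rw [if_neg (by omega), if_neg (by omega), if_neg (by omega)]
      obtain ⟨h1, h2, h3⟩ := h.sg_triple p hmp hpN
      rw [if_neg (by omega)]
      exact ⟨h1, h2, h3⟩
    · have : p = D.N ∨ p = D.N + 1 ∨ p = D.N + 2 := by omega
      rcases this with rfl | rfl | rfl <;> simp
  · intro q hq
    simp only [KData.push, upd3]
    rcases hcases q hq with rfl | ⟨h1, h2⟩
    · simp [hmN]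
    · rw [if_neg (by omega), if_neg (by omega), if_neg (by omega), if_neg (by omega),
        if_neg (by omega), if_neg (by omega), if_neg (by omega), if_neg (by omega),
        if_neg (by omega)]
      obtain ⟨g1, g2, g3⟩ := h.base q h2
      exact ⟨g1, by omega, g3⟩
  · intro q hq
    simp only [KData.push, Function.update_apply]
    rcases hcases q hq with rfl | ⟨h1, h2⟩
    · simp
      omega
    · rw [if_neg (by omega), if_neg (by omega)]
      exact h.ends q h2
  · intro q hq
    rw [hA, Function.update_apply] at hq
    split_ifs at hq with h1
    simp only [KData.push, Function.update_apply, if_neg h1]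
    exact h.B_zero q hq
  · intro q hq
    simp only [KData.push, Function.update_apply]
    rcases hcases q hq with rfl | ⟨h1, h2⟩
    · simp only [if_true, Nat.add_sub_cancel]
      rw [if_neg (by omega), if_neg (by omega), if_neg (by omega), if_neg (by omega),
        if_neg (by omega), if_neg (by omega), if_neg (by omega), if_neg (by omega),
        if_neg (by omega)]
      exact hl
    · obtain ⟨g1, g2, g3⟩ := h.ends q h2
      simp only [show ¬ q = D.N + 2 by omega, show ¬ q = D.N + 1 by omega, show ¬ q = D.N by omega,
        show ¬ q + 1 = D.N + 2 by omega, show ¬ q + 1 = D.N + 1 by omega,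
        show ¬ q + 1 = D.N by omega, show ¬ q + 2 = D.N + 2 by omega,
        show ¬ q + 2 = D.N + 1 by omega, show ¬ q + 2 = D.N by omega,
        show ¬ D.A q - 1 = D.N + 2 by omega, show ¬ D.A q - 1 = D.N + 1 by omega,
        show ¬ D.A q - 1 = D.N by omega, show ¬ D.B q - 1 = D.N + 2 by omega,
        show ¬ D.B q - 1 = D.N + 1 by omega, show ¬ D.B q - 1 = D.N by omega, if_false]
      exact h.link q h2
  · intro q hq
    simp only [KData.push, Function.update_apply]
    rcases hcases q hq with rfl | ⟨h1, h2⟩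
    · simp
    · rw [if_neg (by omega : ¬ q = D.N)]
      simp only [show ¬ q = D.N + 2 by omega, show ¬ q = D.N + 1 by omega, show ¬ q = D.N by omega,
        show ¬ q + 1 = D.N + 2 by omega, show ¬ q + 1 = D.N + 1 by omega,
        show ¬ q + 1 = D.N by omega, show ¬ q + 2 = D.N + 2 by omega,
        show ¬ q + 2 = D.N + 1 by omega, show ¬ q + 2 = D.N by omega, if_false]
      exact h.code q h2
  · intro a b g e₁ e₂ e₃ c₁ c₂ c₃ ha
    rw [agr_push h _ _ _ _ _ _ _ _ _ _ _ _ _ _ _ ha]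
    split_ifs with hm
    · obtain ⟨rfl, rfl, rfl, h1, h2, h3⟩ := hm
      -- The invariant allows arbitrary selectors, but only whether they vanish matters; this
      -- reduces them to the eight choices that are tested.
      have hb : ∀ e, bd M e = bd M (ind (e ≠ 0)) := by
        intro e
        by_cases he : e = 0 <;> simp [bd, ind, he]
      have := hc (ind (e₁ ≠ 0)) (Nat.lt_succ_of_le (ind_le _)) (ind (e₂ ≠ 0))
        (Nat.lt_succ_of_le (ind_le _)) (ind (e₃ ≠ 0)) (Nat.lt_succ_of_le (ind_le _))
      rw [← hb, ← hb, ← hb] at this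
      refine (Finset.card_insert_le _ _).trans (Nat.succ_le_of_lt (lt_of_eq_of_lt ?_ this))
      congr 1
      ext q
      have hi : ∀ e : ℕ, ind (e ≠ 0) = 0 ↔ e = 0 := by
        intro e
        by_cases he : e = 0 <;> simp [ind, he]
      simp only [agr, Finset.mem_filter, Agrees, hi]
      have hor : ∀ {e c c' x : ℕ}, (e = 0 ∨ c = c') → ((e = 0 ∨ x = c') ↔ (e = 0 ∨ x = c)) := by
        rintro e c c' x (h | rfl)
        · simp [h]
        · rfl
      rw [hor h1, hor h2, hor h3]
    · exact h.count _ _ _ _ _ _ _ _ _ ha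

theorem card_agr_le_push (h : D.Valid adj col n m M) (i j u v w g a b g' e₁ e₂ e₃ c₁ c₂ c₃ : ℕ)
    (ha : a ≠ 0) :
    (D.agr a b g' e₁ e₂ e₃ c₁ c₂ c₃).card ≤
      ((D.push col i j u v w g).agr a b g' e₁ e₂ e₃ c₁ c₂ c₃).card := by
  rw [agr_push h _ _ _ _ _ _ _ _ _ _ _ _ _ _ _ ha]
  split_ifs
  · exact Finset.card_le_card (Finset.subset_insert _ _)
  · exact le_rfl

/-- The number of vertices is bounded in terms of `m` and `M`. -/
theorem Valid.N_le (h : D.Valid adj col n m M) : D.N ≤ m + 3 * (M ^ 3 * (m * (m * 32))) := by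
  set S := (Finset.range D.N).filter fun q => D.A q ≠ 0 with hS
  have h1 : D.N - m ≤ S.card * 3 := by
    have hsub : Finset.Ico m D.N ⊆ S.biUnion fun q => {q, q + 1, q + 2} := by
      intro p hp
      rw [Finset.mem_Ico] at hp
      obtain ⟨g1, g2, g3⟩ := h.sg_triple p hp.1 hp.2
      rw [Finset.mem_biUnion]
      refine ⟨D.sg p, by simp [hS, g3]; omega, ?_⟩
      simp only [Finset.mem_insert, Finset.mem_singleton]
      omega
    have := (Finset.card_le_card hsub).trans
      (Finset.card_biUnion_le_card_mul S _ 3 fun q _ => Finset.card_le_three)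
    rwa [Nat.card_Ico] at this
  -- The fibers are the groups, bounded by the invariant with all three positions free.
  have h2 : S.card ≤ M ^ 3 * (S.image fun q => (D.A q, D.B q, D.G q)).card := by
    refine Finset.card_le_mul_card_image _ _ ?_
    rintro ⟨a, b, g⟩ hx
    obtain ⟨q, hq, hx⟩ := Finset.mem_image.1 hx
    have ha : a ≠ 0 := by
      simp only [Prod.mk.injEq] at hx
      rw [← hx.1]
      exact (Finset.mem_filter.1 hq).2
    have := h.count a b g 0 0 0 0 0 0 ha
    have hb : bd M 0 * bd M 0 * bd M 0 = M ^ 3 := by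
      simp [bd]
      ring
    rw [hb] at this
    refine le_trans (Finset.card_le_card ?_) this
    intro q' hq'
    simp only [hS, Finset.mem_filter, Prod.mk.injEq] at hq'
    simp only [agr, Finset.mem_filter, Agrees, true_or, and_true]
    exact ⟨hq'.1.1, hq'.2⟩
  have h3 : (S.image fun q => (D.A q, D.B q, D.G q)).card ≤ m * (m * 32) := by
    have hsub : (S.image fun q => (D.A q, D.B q, D.G q)) ⊆
        Finset.Icc 1 m ×ˢ Finset.Icc 1 m ×ˢ Finset.range 32 := by
      intro x hx
      obtain ⟨q, hq, rfl⟩ := Finset.mem_image.1 hx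
      have hA := (Finset.mem_filter.1 hq).2
      have := h.ends q hA
      have hG := h.code q hA
      have := gcode_lt (D.org q) (D.org (q + 1)) (D.org (q + 2)) (D.oc q) (D.oc (q + 1))
        (D.oc (q + 2))
      simp only [Finset.mem_product, Finset.mem_Icc, Finset.mem_range]
      omega
    have := Finset.card_le_card hsub
    simpa [Finset.card_product] using this
  have h4 := h2.trans (Nat.mul_le_mul_left _ h3)
  omega

/-- If a candidate was rejected, there is a triple in the same group that avoids prescribed small
sets of colors, provided that the candidate avoids them. -/
theorem Valid.exists_avoiding (h : D.Valid adj col n m M) {a b g e₁ e₂ e₃ c₁ c₂ c₃ : ℕ}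
    (ha : a ≠ 0)
    (hc : bd M e₁ * bd M e₂ * bd M e₃ ≤ (D.agr a b g e₁ e₂ e₃ c₁ c₂ c₃).card)
    {Y₁ Y₂ Y₃ : Finset ℕ} (h₁ : c₁ ∉ Y₁) (h₂ : c₂ ∉ Y₂) (h₃ : c₃ ∉ Y₃)
    (k₁ : 3 * Y₁.card < M) (k₂ : 3 * Y₂.card < M) (k₃ : 3 * Y₃.card < M) :
    ∃ q, D.A q = a ∧ D.B q = b ∧ D.G q = g ∧ D.oc q ∉ Y₁ ∧ D.oc (q + 1) ∉ Y₂ ∧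
      D.oc (q + 2) ∉ Y₃ := by
  by_contra! hno
  set S := D.agr a b g e₁ e₂ e₃ c₁ c₂ c₃ with hS
  have hMb : ∀ e, 0 < bd M e := by
    intro e
    have := h.Mpos
    unfold bd
    split_ifs <;> omega
  set F := bd M e₁ * bd M e₂ * bd M e₃ with hF
  have hFpos : 0 < F := Nat.mul_pos (Nat.mul_pos (hMb _) (hMb _)) (hMb _)
  -- At each position fewer than a third of `F` triples are bad. A fixed position carries the
  -- candidate's color and is never bad; at a free one, fixing it to a forbidden color leaves at
  -- most `F / M` triples by the invariant, and there are fewer than `M / 3` such colors.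
  have part : ∀ (f : ℕ → ℕ) (Y : Finset ℕ) (P : ℕ) (e c : ℕ), 3 * Y.card < M →
      (e ≠ 0 → ∀ q ∈ S, f q ∉ Y) → (e = 0 → F = M * P ∧
        ∀ y, (S.filter fun q => f q = y).card ≤ P) →
      3 * (S.filter fun q => f q ∈ Y).card < F := by
    intro f Y P e c hY hne heq
    by_cases he : e = 0
    · obtain ⟨hFP, hy⟩ := heq he
      have hle : (S.filter fun q => f q ∈ Y).card ≤ Y.card * P := by
        have : (S.filter fun q => f q ∈ Y) ⊆ Y.biUnion fun y => S.filter fun q => f q = y := by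
          intro q hq
          rw [Finset.mem_filter] at hq
          rw [Finset.mem_biUnion]
          exact ⟨f q, hq.2, Finset.mem_filter.2 ⟨hq.1, rfl⟩⟩
        exact (Finset.card_le_card this).trans
          (Finset.card_biUnion_le_card_mul _ _ _ fun y _ => hy y)
      have hP : 0 < P := by
        rcases Nat.eq_zero_or_pos P with rfl | hP
        · simp at hFP
          omega
        · exact hP
      calc 3 * (S.filter fun q => f q ∈ Y).card ≤ 3 * (Y.card * P) := Nat.mul_le_mul_left _ hle
        _ = 3 * Y.card * P := by ring
        _ < M * P := Nat.mul_lt_mul_of_pos_right hY hP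
        _ = F := hFP.symm
    · rw [Finset.filter_false_of_mem (hne he)]
      simpa using hFpos
  have p₁ : 3 * (S.filter fun q => D.oc q ∈ Y₁).card < F := by
    refine part (fun q => D.oc q) Y₁ (bd M e₂ * bd M e₃) e₁ c₁ k₁ ?_ ?_
    · intro he q hq
      simp only [hS, agr, Finset.mem_filter, Agrees, he, false_or] at hq
      rw [hq.2.2.2.2.1]
      exact h₁
    · intro he
      refine ⟨by rw [hF, show bd M e₁ = M by simp [bd, he]]; ring, fun y => ?_⟩
      have := h.count a b g 1 e₂ e₃ y c₂ c₃ ha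
      simp only [bd, one_ne_zero, if_false, one_mul] at this
      refine le_trans (Finset.card_le_card fun q hq => ?_) this
      simp only [hS, agr, Finset.mem_filter, Agrees] at hq ⊢
      tauto
  have p₂ : 3 * (S.filter fun q => D.oc (q + 1) ∈ Y₂).card < F := by
    refine part (fun q => D.oc (q + 1)) Y₂ (bd M e₁ * bd M e₃) e₂ c₂ k₂ ?_ ?_
    · intro he q hq
      simp only [hS, agr, Finset.mem_filter, Agrees, he, false_or] at hq
      rw [hq.2.2.2.2.2.1]
      exact h₂
    · intro he
      refine ⟨by rw [hF, show bd M e₂ = M by simp [bd, he]]; ring, fun y => ?_⟩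
      have := h.count a b g e₁ 1 e₃ c₁ y c₃ ha
      simp only [bd, one_ne_zero, if_false, mul_one] at this
      refine le_trans (Finset.card_le_card fun q hq => ?_) this
      simp only [hS, agr, Finset.mem_filter, Agrees] at hq ⊢
      tauto
  have p₃ : 3 * (S.filter fun q => D.oc (q + 2) ∈ Y₃).card < F := by
    refine part (fun q => D.oc (q + 2)) Y₃ (bd M e₁ * bd M e₂) e₃ c₃ k₃ ?_ ?_
    · intro he q hq
      simp only [hS, agr, Finset.mem_filter, Agrees, he, false_or] at hq
      rw [hq.2.2.2.2.2.2]
      exact h₃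
    · intro he
      refine ⟨by rw [hF, show bd M e₃ = M by simp [bd, he]]; ring, fun y => ?_⟩
      have := h.count a b g e₁ e₂ 1 c₁ c₂ y ha
      simp only [bd, one_ne_zero, if_false, mul_one] at this
      refine le_trans (Finset.card_le_card fun q hq => ?_) this
      simp only [hS, agr, Finset.mem_filter, Agrees] at hq ⊢
      tauto
  have hsub : S ⊆ (S.filter fun q => D.oc q ∈ Y₁) ∪ ((S.filter fun q => D.oc (q + 1) ∈ Y₂) ∪
      (S.filter fun q => D.oc (q + 2) ∈ Y₃)) := by
    intro q hq
    have hq' := hq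
    simp only [hS, agr, Finset.mem_filter, Agrees] at hq'
    have := hno q hq'.2.1 hq'.2.2.1 hq'.2.2.2.1
    simp only [Finset.mem_union, Finset.mem_filter]
    tauto
  have h5 := Finset.card_le_card hsub
  have h6 := Finset.card_union_le (S.filter fun q => D.oc q ∈ Y₁)
    ((S.filter fun q => D.oc (q + 1) ∈ Y₂) ∪ (S.filter fun q => D.oc (q + 2) ∈ Y₃))
  have h7 := Finset.card_union_le (S.filter fun q => D.oc (q + 1) ∈ Y₂)
    (S.filter fun q => D.oc (q + 2) ∈ Y₃)
  omega

/-- Every candidate was rejected. -/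
def Closed (D : KData) (adj : ℕ → ℕ → Prop) (col : ℕ → ℕ) (n m M : ℕ) : Prop :=
  ∀ i < m, ∀ j < m, ∀ u < n, ∀ v < n, ∀ w < n, Link adj (D.org i) u v w (D.org j) →
    ∃ e₁ e₂ e₃, bd M e₁ * bd M e₂ * bd M e₃ ≤
      (D.agr (i + 1) (j + 1) (gcode u v w (col u) (col v) (col w)) e₁ e₂ e₃
        (col u) (col v) (col w)).card

end

end KData

end BalanceFair

namespace BalanceFair

/-! ### The kernel as a graph -/

/-- Adjacency, as a relation on natural numbers. -/
def Inst.adjN (I : Inst) (i j : ℕ) : Prop :=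
  ∃ (hi : i < I.n) (hj : j < I.n), I.graph.Adj ⟨i, hi⟩ ⟨j, hj⟩

/-- The color, as a function on natural numbers. -/
def Inst.colN (I : Inst) (v : ℕ) : ℕ := if h : v < I.n then (I.color ⟨v, h⟩ : ℕ) else 0

theorem Inst.adjN_val {I : Inst} {u v : Fin I.n} : I.adjN u v ↔ I.graph.Adj u v :=
  ⟨fun ⟨_, _, h⟩ => h, fun h => ⟨u.2, v.2, h⟩⟩

theorem Inst.adjN_symm {I : Inst} {u v : ℕ} (h : I.adjN u v) : I.adjN v u := by
  obtain ⟨h1, h2, h3⟩ := h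
  exact ⟨h2, h1, h3.symm⟩

theorem Inst.adjN_irrefl {I : Inst} {u : ℕ} : ¬ I.adjN u u :=
  fun ⟨_, _, h⟩ => I.graph.loopless.irrefl _ h

@[simp] theorem Inst.colN_val {I : Inst} (v : Fin I.n) : I.colN v = I.color v := by
  simp [Inst.colN]

theorem Inst.colN_lt (I : Inst) (v : ℕ) : I.colN v < I.c := by
  unfold Inst.colN
  split_ifs
  · exact Fin.is_lt _
  · exact (Nat.zero_le _).trans_lt (I.color I.s).2

/-- Vertices `p` and `q` belong to the same triple, or are both initial, or one of them is
initial and joined by the triple of the other. -/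
def KData.Rel (D : KData) (p q : ℕ) : Prop :=
  D.sg p = D.sg q ∨ D.A (D.sg q) = p + 1 ∨ D.B (D.sg q) = p + 1 ∨ D.A (D.sg p) = q + 1 ∨
    D.B (D.sg p) = q + 1

theorem KData.Rel.symm {D : KData} {p q : ℕ} (h : D.Rel p q) : D.Rel q p := by
  unfold KData.Rel at *
  tauto

/-- The graph of the kernel. -/
def KData.graph (D : KData) (I : Inst) : SimpleGraph (Fin D.N) where
  Adj p q := D.Rel p q ∧ I.adjN (D.org p) (D.org q)
  symm := ⟨fun _ _ h => ⟨h.1.symm, Inst.adjN_symm h.2⟩⟩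
  loopless := ⟨fun _ h => Inst.adjN_irrefl h.2⟩

/-- The relation between an instance and the data constructed from it; `X` is the modulator. -/
structure IsKernel (I : Inst) (m : ℕ) (X : Finset ℕ) (idx : ℕ → ℕ) (D : KData) : Prop where
  valid : D.Valid I.adjN I.colN I.n m (16 * m)
  closed : D.Closed I.adjN I.colN I.n m (16 * m)
  s_mem : (I.s : ℕ) ∈ X
  t_mem : (I.t : ℕ) ∈ X
  idx_spec : ∀ v ∈ X, v < I.n ∧ idx v < m ∧ D.org (idx v) = v
  hit : ∀ a b c d, IsP4 I.adjN a b c d → a ∈ X ∨ b ∈ X ∨ c ∈ X ∨ d ∈ X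
  m_le : m ≤ 4 * I.param + 2

/-! ### Decomposition of shortest paths and their lifting to the kernel -/

namespace IsKernel

variable {I : Inst} {m : ℕ} {X : Finset ℕ} {idx : ℕ → ℕ} {D : KData}

theorem idx_lt (h : IsKernel I m X idx D) {v : ℕ} (hv : v ∈ X) : idx v < D.N :=
  (h.idx_spec v hv).2.1.trans_le h.valid.mN

theorem dist_tail {V : Type*} {G : SimpleGraph V} {x u t : V} {e : G.Adj x u} {p : G.Walk u t}
    (h : (SimpleGraph.Walk.cons e p).length = G.dist x t) : p.length = G.dist u t := by
  obtain ⟨q, hq⟩ := p.reachable.exists_walk_length_eq_dist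
  have h1 := SimpleGraph.dist_le p
  have h2 := SimpleGraph.dist_le (SimpleGraph.Walk.cons e q)
  simp only [SimpleGraph.Walk.length_cons] at h h2
  omega

/-- A shortest path that starts and ends in the modulator is composed of pieces with at most
three inner vertices between vertices of the modulator. -/
theorem walk_induction (h : IsKernel I m X idx D)
    {motive : ∀ x : Fin I.n, I.graph.Walk x I.t → Prop}
    (nil : motive I.t .nil)
    (one : ∀ x y (e : I.graph.Adj x y) (p : I.graph.Walk y I.t), (x : ℕ) ∈ X → (y : ℕ) ∈ X →
      motive y p → motive x (.cons e p))
    (two : ∀ x u y (e : I.graph.Adj x u) (e₁ : I.graph.Adj u y) (p : I.graph.Walk y I.t),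
      (x : ℕ) ∈ X → (y : ℕ) ∈ X → motive y p → motive x (.cons e (.cons e₁ p)))
    (three : ∀ x u v y (e : I.graph.Adj x u) (e₁ : I.graph.Adj u v) (e₂ : I.graph.Adj v y)
      (p : I.graph.Walk y I.t), (x : ℕ) ∈ X → (y : ℕ) ∈ X → u ≠ v → motive y p →
      motive x (.cons e (.cons e₁ (.cons e₂ p))))
    (four : ∀ x u v w y (e : I.graph.Adj x u) (e₁ : I.graph.Adj u v) (e₂ : I.graph.Adj v w)
      (e₃ : I.graph.Adj w y) (p : I.graph.Walk y I.t), (x : ℕ) ∈ X → (y : ℕ) ∈ X →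
      u ≠ v → v ≠ w → motive y p →
      motive x (.cons e (.cons e₁ (.cons e₂ (.cons e₃ p)))))
    (x : Fin I.n) (p : I.graph.Walk x I.t) (hp : p.length = I.graph.dist x I.t)
    (hx : (x : ℕ) ∈ X) : motive x p := by
  suffices H : ∀ ℓ (x : Fin I.n) (p : I.graph.Walk x I.t), p.length = ℓ →
      p.length = I.graph.dist x I.t → (x : ℕ) ∈ X → motive x p from H _ x p rfl hp hx
  intro ℓ
  induction ℓ using Nat.strong_induction_on with
  | _ ℓ ih =>
  have htX := h.t_mem
  intro x p hℓ hp hx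
  cases p with
  | nil => exact nil
  | @cons _ u _ e p₁ =>
  have hp₁ := dist_tail hp
  simp only [SimpleGraph.Walk.length_cons] at hℓ
  by_cases hu : (u : ℕ) ∈ X
  · exact one _ _ e p₁ hx hu (ih _ (by omega) u p₁ rfl hp₁ hu)
  cases p₁ with
  | nil => exact absurd htX hu
  | @cons _ v _ e₁ p₂ =>
  have hp₂ := dist_tail hp₁
  simp only [SimpleGraph.Walk.length_cons] at hℓ
  by_cases hv : (v : ℕ) ∈ X
  · exact two _ _ _ e e₁ p₂ hx hv (ih _ (by omega) v p₂ rfl hp₂ hv)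
  cases p₂ with
  | nil => exact absurd htX hv
  | @cons _ w _ e₂ p₃ =>
  have hp₃ := dist_tail hp₂
  simp only [SimpleGraph.Walk.length_cons] at hℓ
  by_cases hw : (w : ℕ) ∈ X
  · exact three _ _ _ _ e e₁ e₂ p₃ hx hw e₁.ne (ih _ (by omega) w p₃ rfl hp₃ hw)
  cases p₃ with
  | nil => exact absurd htX hw
  | @cons _ y _ e₃ p₄ =>
  have hp₄ := dist_tail hp₃
  simp only [SimpleGraph.Walk.length_cons] at hℓ
  by_cases hy : (y : ℕ) ∈ X
  · exact four _ _ _ _ _ e e₁ e₂ e₃ p₄ hx hy e₁.ne e₂.ne (ih _ (by omega) y p₄ rfl hp₄ hy)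
  exfalso
  simp only [SimpleGraph.Walk.length_cons] at hp₁ hp₂ hp₃
  have := h.hit u v w y ⟨Inst.adjN_val.2 e₁, Inst.adjN_val.2 e₂, Inst.adjN_val.2 e₃, ?_, ?_, ?_⟩
  · tauto
  · intro hadj
    have := SimpleGraph.dist_le
      (SimpleGraph.Walk.cons (Inst.adjN_val.1 hadj) (SimpleGraph.Walk.cons e₃ p₄))
    simp only [SimpleGraph.Walk.length_cons] at this
    omega
  · intro hadj
    have := SimpleGraph.dist_le (SimpleGraph.Walk.cons (Inst.adjN_val.1 hadj) p₄)
    simp only [SimpleGraph.Walk.length_cons] at this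
    omega
  · intro hadj
    have := SimpleGraph.dist_le (SimpleGraph.Walk.cons (Inst.adjN_val.1 hadj) p₄)
    simp only [SimpleGraph.Walk.length_cons] at this
    omega

/-- A shortest path that starts in the modulator has at most `4 * m` edges. -/
theorem length_le (h : IsKernel I m X idx D) {x : Fin I.n} (p : I.graph.Walk x I.t)
    (hp : p.length = I.graph.dist x I.t) (hx : (x : ℕ) ∈ X) : p.length ≤ 4 * m := by
  -- A piece has at most four edges and is charged to its final vertex, which lies in the modulator;
  -- a path visits each such vertex once.
  have h1 : p.length ≤ 4 * (p.support.tail.filter fun v : Fin I.n => (v : ℕ) ∈ X).length := by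
    refine h.walk_induction (motive := fun x p =>
      p.length ≤ 4 * (p.support.tail.filter fun v : Fin I.n => (v : ℕ) ∈ X).length) ?_ ?_ ?_ ?_ ?_ x p hp hx
    · simp
    · intro x y e p _ hy ih
      rw [SimpleGraph.Walk.support_cons, List.tail_cons, ← SimpleGraph.Walk.cons_tail_support p,
        List.filter_cons_of_pos (by simpa using hy)]
      simp only [SimpleGraph.Walk.length_cons, List.length_cons]
      omega
    · intro x u y e e₁ p _ hy ih
      rw [SimpleGraph.Walk.support_cons, List.tail_cons, SimpleGraph.Walk.support_cons,
        ← SimpleGraph.Walk.cons_tail_support p, List.filter_cons, List.filter_cons_of_pos (a := y)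
        (by simpa using hy)]
      split_ifs <;> simp only [SimpleGraph.Walk.length_cons, List.length_cons] <;> omega
    · intro x u v y e e₁ e₂ p _ hy _ ih
      rw [SimpleGraph.Walk.support_cons, List.tail_cons, SimpleGraph.Walk.support_cons,
        SimpleGraph.Walk.support_cons, ← SimpleGraph.Walk.cons_tail_support p, List.filter_cons,
        List.filter_cons, List.filter_cons_of_pos (a := y) (by simpa using hy)]
      split_ifs <;> simp only [SimpleGraph.Walk.length_cons, List.length_cons] <;> omega
    · intro x u v w y e e₁ e₂ e₃ p _ hy _ _ ih
      rw [SimpleGraph.Walk.support_cons, List.tail_cons, SimpleGraph.Walk.support_cons,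
        SimpleGraph.Walk.support_cons, SimpleGraph.Walk.support_cons,
        ← SimpleGraph.Walk.cons_tail_support p, List.filter_cons,
        List.filter_cons, List.filter_cons, List.filter_cons_of_pos (a := y) (by simpa using hy)]
      split_ifs <;> simp only [SimpleGraph.Walk.length_cons, List.length_cons] <;> omega
  have hnd : (p.support.tail.filter fun v : Fin I.n => (v : ℕ) ∈ X).Nodup :=
    ((SimpleGraph.Walk.isPath_of_length_eq_dist p hp).support_nodup.tail).filter _
  rw [← List.toFinset_card_of_nodup hnd] at h1
  have h2 : (p.support.tail.filter fun v : Fin I.n => (v : ℕ) ∈ X).toFinset.card ≤ (Finset.range m).card := by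
    refine Finset.card_le_card_of_injOn (fun v : Fin I.n => idx v) ?_ ?_
    · intro v hv
      simp only [List.coe_toFinset, List.mem_filter, decide_eq_true_eq, Set.mem_ofPred_eq] at hv
      simpa using (h.idx_spec v hv.2).2.1
    · intro v hv w hw hvw
      simp only [List.coe_toFinset, List.mem_filter, decide_eq_true_eq, Set.mem_ofPred_eq] at hv hw
      have h1 := (h.idx_spec v hv.2).2.2
      have h2 := (h.idx_spec w hw.2).2.2
      simp only at hvw
      rw [hvw] at h1
      exact Fin.ext (h1.symm.trans h2)
  rw [Finset.card_range] at h2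
  omega

/-- Small sets of colors to avoid: the complement of the own color if there are few colors, and
otherwise the colors in the list `L`, if possible. -/
theorem exists_avoided (I : Inst) {m : ℕ} (hm : 0 < m) (u v w : ℕ) {L : List ℕ}
    (hL : L.length ≤ 4 * m) :
    ∃ Y : ℕ → Finset ℕ,
      (∀ c, (c = I.colN u ∨ c = I.colN v ∨ c = I.colN w) → c ∉ Y c ∧ 3 * (Y c).card < 16 * m) ∧
      ∀ c d, (c = I.colN u ∨ c = I.colN v ∨ c = I.colN w) → d < I.c → d ∉ Y c →
        (3 * I.c ≤ 16 * m → d = c) ∧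
        ((I.colN u ∉ L ∧ I.colN v ∉ L ∧ I.colN w ∉ L) → d ∉ L) := by
  have hlt : ∀ c, (c = I.colN u ∨ c = I.colN v ∨ c = I.colN w) → c < I.c := by
    rintro c (rfl | rfl | rfl) <;> exact I.colN_lt _
  by_cases h3 : 3 * I.c ≤ 16 * m
  -- Few colors: forbidding all but the own color forces equality, and `3 * (c - 1) < 16 * m` keeps
  -- the forbidden set small enough.
  · refine ⟨fun c => (Finset.range I.c).erase c, fun c hc => ⟨by simp, ?_⟩, ?_⟩
    · rw [Finset.card_erase_of_mem (Finset.mem_range.2 (hlt c hc)), Finset.card_range]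
      have := hlt c hc
      omega
    · intro c d hc hd hdY
      have : d = c := by
        by_contra hne
        exact hdY (Finset.mem_erase.2 ⟨hne, Finset.mem_range.2 hd⟩)
      subst this
      refine ⟨fun _ => rfl, ?_⟩
      rintro ⟨h1, h2, h3⟩
      rcases hc with rfl | rfl | rfl <;> assumption
  · by_cases hLc : I.colN u ∉ L ∧ I.colN v ∉ L ∧ I.colN w ∉ L
    -- Many colors: the size condition holds because `3 * (4 * m) < 16 * m`. If the piece itself
    -- meets `L`, nothing is demanded and the empty sets below serve.
    · refine ⟨fun _ => L.toFinset, fun c hc => ⟨?_, ?_⟩, ?_⟩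
      · rcases hc with rfl | rfl | rfl <;> simp [hLc]
      · have := L.toFinset_card_le
        change 3 * L.toFinset.card < 16 * m
        omega
      · intro c d _ _ hd
        exact ⟨fun h' => absurd h' h3, fun _ => by simpa using hd⟩
    · refine ⟨fun _ => ∅, fun c hc => ⟨by simp, by simp; omega⟩, ?_⟩
      intro c d _ _ hd
      exact ⟨fun h' => absurd h' h3, fun h' => absurd h' hLc⟩

/-- Every piece can be replaced by a triple of the kernel that avoids a given short list of
colors, if the piece does, and has the same colors if there are few colors. -/
theorem exists_triple (h : IsKernel I m X idx D) {x u v w y : ℕ} (hx : x ∈ X) (hy : y ∈ X)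
    (hu : u < I.n) (hv : v < I.n) (hw : w < I.n) (hl : Link I.adjN x u v w y)
    (L : List ℕ) (hL : L.length ≤ 4 * m) (a b : Fin D.N) (ha : (a : ℕ) = idx x)
    (hb : (b : ℕ) = idx y) :
    ∃ a₁ a₂ a₃ : Fin D.N, (D.graph I).Adj a a₁ ∧ (u ≠ v → (D.graph I).Adj a₁ a₂) ∧
      (v ≠ w → (D.graph I).Adj a₂ a₃) ∧ (D.graph I).Adj a₃ b ∧
      (v = w → (D.graph I).Adj a₂ b) ∧ (u = v → v = w → (D.graph I).Adj a₁ b) ∧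
      (3 * I.c ≤ 16 * m → D.oc a₁ = I.colN u ∧ D.oc a₂ = I.colN v ∧ D.oc a₃ = I.colN w) ∧
      ((I.colN u ∉ L ∧ I.colN v ∉ L ∧ I.colN w ∉ L) →
        (D.oc a₁ ∉ L ∧ D.oc a₂ ∉ L ∧ D.oc a₃ ∉ L)) ∧
      (I.colN u = I.colN v ↔ D.oc a₁ = D.oc a₂) ∧ (I.colN v = I.colN w ↔ D.oc a₂ = D.oc a₃) ∧
      (I.colN u = I.colN w ↔ D.oc a₁ = D.oc a₃) := by
  have hval := h.valid
  have hm := hval.mpos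
  obtain ⟨hxn, hix, hox⟩ := h.idx_spec x hx
  obtain ⟨hyn, hiy, hoy⟩ := h.idx_spec y hy
  obtain ⟨e₁, e₂, e₃, hc⟩ := h.closed (idx x) hix (idx y) hiy u hu v hv w hw
    (by rw [hox, hoy]; exact hl)
  obtain ⟨Y, hYc, hY⟩ := exists_avoided I hm u v w hL
  obtain ⟨q, hA, hB, hG, k₁, k₂, k₃⟩ := hval.exists_avoiding (by omega) hc
    (hYc _ (Or.inl rfl)).1 (hYc _ (Or.inr (Or.inl rfl))).1 (hYc _ (Or.inr (Or.inr rfl))).1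
    (hYc _ (Or.inl rfl)).2 (hYc _ (Or.inr (Or.inl rfl))).2 (hYc _ (Or.inr (Or.inr rfl))).2
  have hA0 : D.A q ≠ 0 := by omega
  obtain ⟨_, hqN, s₀, s₁, s₂⟩ := hval.base q hA0
  have hcode := (hval.code q hA0).symm.trans hG
  obtain ⟨g₁, g₂, g₃, g₄, g₅⟩ := gcode_eq hcode
  obtain ⟨l₁, l₂, l₃, l₄⟩ := hval.link q hA0
  rw [hA, Nat.add_sub_cancel] at l₁
  rw [hB, Nat.add_sub_cancel] at l₄
  have oclt : ∀ p < D.N, D.oc p < I.c := fun p hp => by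
    rw [hval.oc_eq p hp]
    exact I.colN_lt _
  have y₁ := hY _ _ (Or.inl rfl) (oclt q (by omega)) k₁
  have y₂ := hY _ _ (Or.inr (Or.inl rfl)) (oclt (q + 1) (by omega)) k₂
  have y₃ := hY _ _ (Or.inr (Or.inr rfl)) (oclt (q + 2) (by omega)) k₃
  have relb : ∀ r, D.sg r = q → D.Rel r (idx y) := fun r hr => by
    refine Or.inr (Or.inr (Or.inr (Or.inr ?_)))
    rw [hr, hB]
  -- A pause gives two copies of one vertex, which are not adjacent. The walk then leaves early from
  -- `q` or `q + 1`, whose origin agrees with that of `q + 2` and hence is adjacent to the end.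
  refine ⟨⟨q, by omega⟩, ⟨q + 1, by omega⟩, ⟨q + 2, by omega⟩, ⟨?_, ?_⟩, fun hne => ⟨?_, ?_⟩,
    fun hne => ⟨?_, ?_⟩, ⟨?_, ?_⟩, fun he => ⟨?_, ?_⟩, fun he he' => ⟨?_, ?_⟩,
    fun h3 => ⟨y₁.1 h3, y₂.1 h3, y₃.1 h3⟩,
    fun hL => ⟨y₁.2 hL, y₂.2 hL, y₃.2 hL⟩, g₃.symm, g₄.symm, g₅.symm⟩
  · refine Or.inr (Or.inl ?_)
    rw [s₀, hA, ha]
  · simpa only [ha] using l₁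
  · exact Or.inl (s₀.trans s₁.symm)
  · exact l₂.resolve_left fun h => hne (g₁.1 h)
  · exact Or.inl (s₁.trans s₂.symm)
  · exact l₃.resolve_left fun h => hne (g₂.1 h)
  · simpa only [hb] using relb _ s₂
  · simpa only [hb] using l₄
  · simpa only [hb] using relb _ s₁
  · simpa only [hb, g₂.2 he] using l₄
  · simpa only [hb] using relb _ s₀
  · simpa only [hb, g₁.2 he, g₂.2 he'] using l₄

/-- The list of the original colors along a walk. -/
def cl (I : Inst) {x y : Fin I.n} (p : I.graph.Walk x y) : List ℕ :=
  p.support.map fun v : Fin I.n => I.colN v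

/-- The list of the original colors along a walk in the kernel. -/
def cl' (I : Inst) (D : KData) {x y : Fin D.N} (p : (D.graph I).Walk x y) : List ℕ :=
  p.support.map fun v : Fin D.N => D.oc v

/-- This isolates the colors `T` of one piece from all other colors of the path, which are exactly
those that the replacement has to avoid. -/
theorem nodup_insert_iff {Z T L : List ℕ} {x : ℕ} : (Z ++ x :: (T ++ L)).Nodup ↔
    T.Nodup ∧ (Z ++ x :: L).Nodup ∧ ∀ c ∈ T, c ∉ Z ++ x :: L := by
  have hp : (Z ++ x :: (T ++ L)).Perm (T ++ (Z ++ x :: L)) := by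
    have : Z ++ x :: (T ++ L) = (Z ++ [x]) ++ T ++ L := by simp
    rw [this]
    have h2 : T ++ (Z ++ x :: L) = T ++ (Z ++ [x]) ++ L := by simp
    rw [h2]
    exact List.Perm.append_right _ List.perm_append_comm
  rw [hp.nodup_iff, List.nodup_append']
  rfl

/-- Shortest paths of the instance can be realized in the kernel. -/
theorem exists_lift (h : IsKernel I m X idx D) (b : Fin D.N) (hb : (b : ℕ) = idx I.t)
    (x : Fin I.n) (p : I.graph.Walk x I.t) (hp : p.length = I.graph.dist x I.t)
    (hx : (x : ℕ) ∈ X) (a : Fin D.N) (ha : (a : ℕ) = idx x) (Z : List ℕ)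
    (hZ : Z.length + (cl I p).length ≤ 4 * m + 1) :
    ∃ p' : (D.graph I).Walk a b, p'.length = p.length ∧
      (3 * I.c ≤ 16 * m → cl' I D p' = cl I p) ∧
      ((Z ++ cl I p).Nodup → (Z ++ cl' I D p').Nodup) := by
  have hoc : ∀ (x : Fin I.n) (a : Fin D.N), (x : ℕ) ∈ X → (a : ℕ) = idx x →
      D.oc a = I.colN x := by
    intro x a hx ha
    rw [h.valid.oc_eq a a.2, ha, (h.idx_spec x hx).2.2]
  -- The list `Z` holds the colors of the part already replaced. One step exchanges the inner colors
  -- `T` of the next piece for `T'` and hands the longer prefix to the induction hypothesis; lengths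
  -- agree, so the bound `4 * m + 1` persists.
  have key : ∀ {x y : Fin I.n} {a a' : Fin D.N} (hx : (x : ℕ) ∈ X) (ha : (a : ℕ) = idx x)
      (Z T T' : List ℕ) (p : I.graph.Walk y I.t)
      (_ : Z.length + (T.length + (cl I p).length + 1) ≤ 4 * m + 1)
      (_ : T'.length = T.length)
      (_ : 3 * I.c ≤ 16 * m → T' = T)
      (_ : (∀ c ∈ T, c ∉ Z ++ I.colN x :: cl I p) → ∀ c ∈ T', c ∉ Z ++ I.colN x :: cl I p)
      (_ : T.Nodup → T'.Nodup)
      (_ : ∀ Z : List ℕ, Z.length + (cl I p).length ≤ 4 * m + 1 →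
        ∃ p' : (D.graph I).Walk a' b, p'.length = p.length ∧
          (3 * I.c ≤ 16 * m → cl' I D p' = cl I p) ∧
          ((Z ++ cl I p).Nodup → (Z ++ cl' I D p').Nodup)),
      ∃ p' : (D.graph I).Walk a' b, p'.length = p.length ∧
        (3 * I.c ≤ 16 * m → D.oc a :: (T' ++ cl' I D p') = I.colN x :: (T ++ cl I p)) ∧
        ((Z ++ I.colN x :: (T ++ cl I p)).Nodup → (Z ++ D.oc a :: (T' ++ cl' I D p')).Nodup) := by
    intro x y a a' hx ha Z T T' p hlen hT h1 h2 h3 ih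
    obtain ⟨p', i1, i2, i3⟩ := ih (Z ++ I.colN x :: T') (by simp; omega)
    refine ⟨p', i1, fun hc => by rw [h1 hc, i2 hc, hoc x a hx ha], fun hnd => ?_⟩
    rw [nodup_insert_iff] at hnd
    have := i3 (by
      rw [List.append_assoc, List.cons_append, nodup_insert_iff]
      exact ⟨h3 hnd.1, hnd.2.1, h2 hnd.2.2⟩)
    rwa [List.append_assoc, List.cons_append, ← hoc x a hx ha] at this
  refine h.walk_induction (motive := fun x p => ∀ (a : Fin D.N), (a : ℕ) = idx x →
      ∀ (Z : List ℕ), Z.length + (cl I p).length ≤ 4 * m + 1 →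
      ∃ p' : (D.graph I).Walk a b, p'.length = p.length ∧
      (3 * I.c ≤ 16 * m → cl' I D p' = cl I p) ∧
      ((Z ++ cl I p).Nodup → (Z ++ cl' I D p').Nodup)) ?_ ?_ ?_ ?_ ?_ x p hp hx a ha Z hZ
  · intro a ha Z hZ
    obtain rfl : a = b := Fin.ext (ha.trans hb.symm)
    refine ⟨.nil, rfl, fun _ => ?_, fun hnd => ?_⟩
    · simpa [cl, cl'] using hoc I.t a h.t_mem ha
    · have := hoc I.t a h.t_mem ha
      simp only [cl, cl', SimpleGraph.Walk.support_nil, List.map_cons, List.map_nil] at hnd ⊢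
      rwa [this]
  · intro x y e p hx hy ih a ha Z hZ
    obtain ⟨p', i1, i2, i3⟩ := key hx ha Z [] [] p (a' := ⟨idx y, h.idx_lt hy⟩)
      (by simp [cl] at hZ ⊢; omega) rfl (fun _ => rfl) (fun h => h) (fun h => h) (ih _ rfl)
    have hadj : (D.graph I).Adj a ⟨idx y, h.idx_lt hy⟩ := by
      refine ⟨Or.inl ?_, ?_⟩
      · rw [h.valid.sg_init _ (by rw [ha]; exact (h.idx_spec x hx).2.1),
          h.valid.sg_init _ (h.idx_spec y hy).2.1]
      · rw [ha, (h.idx_spec x hx).2.2, (h.idx_spec y hy).2.2]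
        exact Inst.adjN_val.2 e
    exact ⟨.cons hadj p', by simp [i1], i2, i3⟩
  · intro x u y e e₁ p hx hy ih a ha Z hZ
    simp only [cl, SimpleGraph.Walk.support_cons, List.map_cons, List.length_cons] at hZ
    -- The avoided list omits at least one inner vertex of the path, so its length is at most `4 *
    -- m`.
    obtain ⟨a₁, a₂, a₃, t₁, -, -, -, -, t₂, tc, tL, -, -, -⟩ := h.exists_triple hx hy u.2 u.2 u.2
      ⟨Inst.adjN_val.2 e, Or.inl rfl, Or.inl rfl, Inst.adjN_val.2 e₁⟩ (Z ++ I.colN x :: cl I p)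
      (by simp [cl]; simp at hZ; omega) a ⟨idx y, h.idx_lt hy⟩ ha rfl
    obtain ⟨p', i1, i2, i3⟩ := key hx ha Z [I.colN u] [D.oc a₁] p (a' := ⟨idx y, h.idx_lt hy⟩)
      (by simp [cl] at hZ ⊢; omega) rfl (fun hc => by rw [(tc hc).1])
      (fun hL => by
        simp only [List.mem_singleton, forall_eq] at hL ⊢
        exact (tL ⟨hL, hL, hL⟩).1) (fun _ => List.nodup_singleton _) (ih _ rfl)
    exact ⟨.cons t₁ (.cons (t₂ rfl rfl) p'), by simp [i1], i2, i3⟩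
  · intro x u v y e e₁ e₂ p hx hy huv ih a ha Z hZ
    simp only [cl, SimpleGraph.Walk.support_cons, List.map_cons, List.length_cons] at hZ
    obtain ⟨a₁, a₂, a₃, t₁, t₂, -, -, t₃, -, tc, tL, q₁, -, -⟩ := h.exists_triple hx hy u.2 v.2 v.2
      ⟨Inst.adjN_val.2 e, Or.inr (Inst.adjN_val.2 e₁), Or.inl rfl, Inst.adjN_val.2 e₂⟩
      (Z ++ I.colN x :: cl I p)
      (by simp [cl]; simp at hZ; omega) a ⟨idx y, h.idx_lt hy⟩ ha rfl
    obtain ⟨p', i1, i2, i3⟩ := key hx ha Z [I.colN u, I.colN v] [D.oc a₁, D.oc a₂] p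
      (a' := ⟨idx y, h.idx_lt hy⟩)
      (by simp [cl] at hZ ⊢; omega) rfl (fun hc => by rw [(tc hc).1, (tc hc).2.1])
      (fun hL => by
        simp only [List.mem_cons, List.not_mem_nil, or_false, forall_eq_or_imp, forall_eq]
          at hL ⊢
        exact ⟨(tL ⟨hL.1, hL.2, hL.2⟩).1, (tL ⟨hL.1, hL.2, hL.2⟩).2.1⟩)
      (fun hnd => by
        simp only [List.nodup_cons, List.mem_singleton, List.not_mem_nil, not_false_eq_true,
          List.nodup_nil, and_true] at hnd ⊢
        rwa [← q₁]) (ih _ rfl)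
    exact ⟨.cons t₁ (.cons (t₂ (Fin.val_ne_of_ne huv)) (.cons (t₃ rfl) p')), by simp [i1], i2, i3⟩
  · intro x u v w y e e₁ e₂ e₃ p hx hy huv hvw ih a ha Z hZ
    simp only [cl, SimpleGraph.Walk.support_cons, List.map_cons, List.length_cons] at hZ
    obtain ⟨a₁, a₂, a₃, t₁, t₂, t₃, t₄, -, -, tc, tL, q₁, q₂, q₃⟩ :=
      h.exists_triple hx hy u.2 v.2 w.2
      ⟨Inst.adjN_val.2 e, Or.inr (Inst.adjN_val.2 e₁), Or.inr (Inst.adjN_val.2 e₂),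
        Inst.adjN_val.2 e₃⟩ (Z ++ I.colN x :: cl I p)
      (by simp [cl]; simp at hZ; omega) a ⟨idx y, h.idx_lt hy⟩ ha rfl
    obtain ⟨p', i1, i2, i3⟩ := key hx ha Z [I.colN u, I.colN v, I.colN w]
      [D.oc a₁, D.oc a₂, D.oc a₃] p (a' := ⟨idx y, h.idx_lt hy⟩)
      (by simp [cl] at hZ ⊢; omega) rfl
      (fun hc => by rw [(tc hc).1, (tc hc).2.1, (tc hc).2.2])
      (fun hL => by
        simp only [List.mem_cons, List.not_mem_nil, or_false, forall_eq_or_imp, forall_eq]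
          at hL ⊢
        exact tL hL)
      (fun hnd => by
        simp only [List.nodup_cons, List.mem_cons, List.not_mem_nil, not_false_eq_true,
          List.nodup_nil, and_true, or_false] at hnd ⊢
        rwa [← q₁, ← q₂, ← q₃]) (ih _ rfl)
    exact ⟨.cons t₁ (.cons (t₂ (Fin.val_ne_of_ne huv)) (.cons (t₃ (Fin.val_ne_of_ne hvw))
      (.cons t₄ p'))), by simp [i1], i2, i3⟩

end IsKernel

end BalanceFair

/-! ### Fairness as a property of color lists, equivalence of the instances, size of the kernel -/

namespace BalanceFair

/-- The numbers of occurrences of any two of `c` colors differ by at most one. -/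
def FairList (c : ℕ) (L : List ℕ) : Prop := ∀ i < c, ∀ j < c, L.count i ≤ L.count j + 1

/-- On a path no vertex repeats, so counting a color in the set of vertices is counting it in the
list. -/
theorem Inst.isBalanceFair_iff (I : Inst) {u v : Fin I.n} (p : I.graph.Walk u v)
    (hp : p.IsPath) :
    I.IsBalanceFair p ↔ FairList I.c (p.support.map fun v => (I.color v : ℕ)) := by
  have hc : ∀ i : Fin I.c, I.colorCount p i =
      (p.support.map fun v => (I.color v : ℕ)).count (i : ℕ) := by
    intro i
    have h1 : p.support.toFinset.filter (fun w => I.color w = i) =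
        (p.support.filter fun w => I.color w = i).toFinset := by
      ext
      simp
    rw [Inst.colorCount, h1, List.toFinset_card_of_nodup (hp.support_nodup.filter _), List.count,
      List.countP_map, List.countP_eq_length_filter]
    congr 2
    funext w
    rw [Bool.eq_iff_iff]
    simp [Fin.ext_iff]
  unfold Inst.IsBalanceFair FairList
  constructor
  · intro h i hi j hj
    rw [← hc ⟨i, hi⟩, ← hc ⟨j, hj⟩]
    exact h _ _
  · intro h i j
    rw [hc, hc]
    exact h i i.2 j j.2

/-- A color that is absent has count zero, which caps every other count at one. -/
theorem fairList_iff_nodup {c : ℕ} {L : List ℕ} (h : ∃ j < c, j ∉ L) (hL : ∀ i ∈ L, i < c) :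
    FairList c L ↔ L.Nodup := by
  rw [List.nodup_iff_count_le_one]
  constructor
  · intro hf i
    obtain ⟨j, hj, hjL⟩ := h
    by_cases hi : i ∈ L
    · have := hf i (hL i hi) j hj
      rwa [List.count_eq_zero_of_not_mem hjL] at this
    · rw [List.count_eq_zero_of_not_mem hi]
      exact Nat.zero_le _
  · intro h i _ j _
    have := h i
    omega

/-- A new coloring of the vertices of the kernel, with `c'` colors: the old one if there are few
colors, and one that identifies the same vertices, with one more color, otherwise. -/
def IsRelabeling (c m N : ℕ) (oc : ℕ → ℕ) (c' : ℕ) (f : ℕ → ℕ) : Prop :=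
  (3 * c ≤ 16 * m ∧ c' = c ∧ ∀ p < N, f (oc p) = oc p) ∨
  (16 * m < 3 * c ∧ c' = N + 1 ∧ (∀ p < N, f (oc p) < N) ∧
    ∀ p < N, ∀ q < N, f (oc p) = f (oc q) → oc p = oc q)

namespace IsKernel

variable {I : Inst} {m : ℕ} {X : Finset ℕ} {idx : ℕ → ℕ} {D : KData} {c' : ℕ} {f : ℕ → ℕ}

theorem relabel_lt (h : IsKernel I m X idx D) (hf : IsRelabeling I.c m D.N D.oc c' f) :
    ∀ p < D.N, f (D.oc p) < c' := by
  intro p hp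
  rcases hf with ⟨_, rfl, h3⟩ | ⟨_, rfl, h3, _⟩
  · rw [h3 p hp, h.valid.oc_eq p hp]
    exact I.colN_lt _
  · have := h3 p hp
    omega

/-- The instance that the kernelization returns. -/
def out (h : IsKernel I m X idx D) (hf : IsRelabeling I.c m D.N D.oc c' f) : Inst where
  n := D.N
  graph := D.graph I
  c := c'
  color p := ⟨f (D.oc p), h.relabel_lt hf p p.2⟩
  s := ⟨idx I.s, h.idx_lt h.s_mem⟩
  t := ⟨idx I.t, h.idx_lt h.t_mem⟩

/-- Every vertex of the kernel comes from a vertex of the instance. -/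
def hom (h : IsKernel I m X idx D) : D.graph I →g I.graph where
  toFun p := ⟨D.org p, h.valid.org_lt p p.2⟩
  map_rel' hadj := Inst.adjN_val.1 hadj.2

theorem cl_map_hom (h : IsKernel I m X idx D) {a b : Fin D.N} (p : (D.graph I).Walk a b) :
    cl I (p.map h.hom) = cl' I D p := by
  unfold cl cl'
  rw [SimpleGraph.Walk.support_map, List.map_map]
  refine List.map_congr_left fun v _ => ?_
  exact (h.valid.oc_eq v v.2).symm

theorem hom_idx (h : IsKernel I m X idx D) {v : Fin I.n} (hv : (v : ℕ) ∈ X) :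
    h.hom ⟨idx v, h.idx_lt hv⟩ = v :=
  Fin.ext (h.idx_spec v hv).2.2

/-- The projection to original vertices is a homomorphism that preserves colors; hence no distance
between the terminals is shortened in the kernel. -/
theorem exists_lower (h : IsKernel I m X idx D)
    (q : (D.graph I).Walk ⟨idx I.s, h.idx_lt h.s_mem⟩ ⟨idx I.t, h.idx_lt h.t_mem⟩) :
    ∃ r : I.graph.Walk I.s I.t, r.length = q.length ∧ cl I r = cl' I D q := by
  refine ⟨(q.map h.hom).copy (h.hom_idx h.s_mem) (h.hom_idx h.t_mem), ?_, ?_⟩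
  · rw [SimpleGraph.Walk.length_copy, SimpleGraph.Walk.length_map]
  · rw [← h.cl_map_hom q]
    unfold cl
    rw [SimpleGraph.Walk.support_copy]

/-- With few colors the two color lists coincide. With many, each side has a color its path misses,
so fairness on both sides becomes distinctness of the colors. -/
theorem fair_iff (h : IsKernel I m X idx D) (hf : IsRelabeling I.c m D.N D.oc c' f)
    {p : I.graph.Walk I.s I.t} {q : (h.out hf).graph.Walk (h.out hf).s (h.out hf).t}
    (hp : p.length ≤ 4 * m) (hpp : p.IsPath) (hqp : q.IsPath)
    (hA : 3 * I.c ≤ 16 * m → cl' I D q = cl I p) :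
    (3 * I.c ≤ 16 * m → (I.IsBalanceFair p ↔ (h.out hf).IsBalanceFair q)) ∧
    (16 * m < 3 * I.c → (I.IsBalanceFair p ↔ (cl I p).Nodup) ∧
      ((h.out hf).IsBalanceFair q ↔ (cl' I D q).Nodup)) := by
  have hcol : (p.support.map fun v => (I.color v : ℕ)) = cl I p :=
    List.map_congr_left fun v _ => (Inst.colN_val v).symm
  have hcol' : (q.support.map fun v => ((h.out hf).color v : ℕ)) = (cl' I D q).map f := by
    unfold cl'
    rw [List.map_map]
    rfl
  have hmem : ∀ x ∈ cl' I D q, ∃ p < D.N, x = D.oc p := by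
    intro x hx
    obtain ⟨v, _, rfl⟩ := List.mem_map.1 hx
    exact ⟨v, v.2, rfl⟩
  rw [I.isBalanceFair_iff p hpp, (h.out hf).isBalanceFair_iff q hqp, hcol, hcol']
  rcases hf with ⟨h1, rfl, h3⟩ | ⟨h1, rfl, h3, h4⟩
  · refine ⟨fun _ => ?_, fun h' => by omega⟩
    rw [← hA h1]
    have : (cl' I D q).map f = cl' I D q := by
      conv_rhs => rw [← List.map_id (cl' I D q)]
      refine List.map_congr_left fun x hx => ?_
      obtain ⟨p, hp, rfl⟩ := hmem x hx
      exact h3 p hp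
    rw [this]
    rfl
  · refine ⟨fun h' => by omega, fun _ => ⟨fairList_iff_nodup ?_ ?_, ?_⟩⟩
    -- The path has at most `4 * m + 1` vertices, and `16 * m < 3 * c` with `1 ≤ m` gives `4 * m + 1
    -- < c`.
    · by_contra! hno
      have hsub : Finset.range I.c ⊆ (cl I p).toFinset := by
        intro j hj
        exact List.mem_toFinset.2 (hno j (Finset.mem_range.1 hj))
      have := (Finset.card_le_card hsub).trans (List.toFinset_card_le _)
      simp only [Finset.card_range, cl, List.length_map, SimpleGraph.Walk.length_support] at this
      have := h.valid.mpos
      omega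
    · intro i hi
      obtain ⟨v, _, rfl⟩ := List.mem_map.1 hi
      exact I.colN_lt v
    -- New labels are below `N`, so the extra color `N` occurs nowhere in the kernel.
    · refine (fairList_iff_nodup ⟨D.N, Nat.lt_succ_self _, ?_⟩ ?_).trans ?_
      · intro hN
        obtain ⟨x, hx, hxN⟩ := List.mem_map.1 hN
        obtain ⟨p, hp, rfl⟩ := hmem x hx
        exact absurd (h3 p hp) (by omega)
      · intro i hi
        obtain ⟨x, hx, rfl⟩ := List.mem_map.1 hi
        obtain ⟨p, hp, rfl⟩ := hmem x hx
        exact (h3 p hp).trans (Nat.lt_succ_self _)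
      · refine ⟨fun hnd => List.Nodup.of_map f hnd, fun hnd => List.Nodup.map_on ?_ hnd⟩
        intro x hx y hy hxy
        obtain ⟨p, hp, rfl⟩ := hmem x hx
        obtain ⟨q, hq, rfl⟩ := hmem y hy
        exact h4 p hp q hq hxy

/-- Lifting and projecting both preserve length, so the two terminal distances agree and shortest
paths correspond. Lifting preserves fairness by the choice of triples; projecting does not change
the color list at all. -/
theorem isYes_iff (h : IsKernel I m X idx D) (hf : IsRelabeling I.c m D.N D.oc c' f) :
    I.IsYes ↔ (h.out hf).IsYes := by
  have lower : ∀ q : (h.out hf).graph.Walk (h.out hf).s (h.out hf).t,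
      ∃ r : I.graph.Walk I.s I.t, r.length = q.length ∧ cl I r = cl' I D q := by
    exact fun q => h.exists_lower q
  have upper : ∀ p : I.graph.Walk I.s I.t, p.length = I.graph.dist I.s I.t →
      ∃ q : (h.out hf).graph.Walk (h.out hf).s (h.out hf).t, q.length = p.length ∧
      q.length = (h.out hf).graph.dist (h.out hf).s (h.out hf).t ∧
      (3 * I.c ≤ 16 * m → cl' I D q = cl I p) ∧ ((cl I p).Nodup → (cl' I D q).Nodup) := by
    intro p hp
    obtain ⟨q, h1, h2, h3⟩ := h.exists_lift ⟨idx I.t, h.idx_lt h.t_mem⟩ rfl I.s p hp h.s_mem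
      ⟨idx I.s, h.idx_lt h.s_mem⟩ rfl [] (by
        have := h.length_le p hp h.s_mem
        simp only [cl, List.length_map, SimpleGraph.Walk.length_support, List.length_nil]
        omega)
    refine ⟨q, h1, le_antisymm ?_ (SimpleGraph.dist_le (G := (h.out hf).graph) q), h2, h3⟩
    obtain ⟨q', hq'⟩ := SimpleGraph.Reachable.exists_walk_length_eq_dist
      (G := (h.out hf).graph) (SimpleGraph.Walk.reachable q)
    obtain ⟨r, hr, _⟩ := lower q'
    have := SimpleGraph.dist_le r
    have h4 : q'.length = (h.out hf).graph.dist (h.out hf).s (h.out hf).t := hq'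
    exact h1.le.trans (hp.le.trans (this.trans (hr.trans h4).le))
  constructor
  · rintro ⟨p, hpp, hp, hfair⟩
    obtain ⟨q, h1, h2, h3, h4⟩ := upper p hp
    have hqp := SimpleGraph.Walk.isPath_of_length_eq_dist q h2
    obtain ⟨k1, k2⟩ := h.fair_iff hf (h.length_le p hp h.s_mem) hpp hqp h3
    refine ⟨q, hqp, h2, ?_⟩
    rcases le_or_gt (3 * I.c) (16 * m) with hc | hc
    · exact (k1 hc).1 hfair
    · exact (k2 hc).2.2 (h4 ((k2 hc).1.1 hfair))
  · rintro ⟨q, hqp, hq, hfair⟩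
    obtain ⟨r, hr, hcl⟩ := lower q
    obtain ⟨p, hp⟩ := r.reachable.exists_walk_length_eq_dist
    obtain ⟨q', h1, h2, _⟩ := upper p hp
    have hrd : r.length = I.graph.dist I.s I.t := by omega
    have hrp := SimpleGraph.Walk.isPath_of_length_eq_dist r hrd
    obtain ⟨k1, k2⟩ := h.fair_iff hf (h.length_le r hrd h.s_mem) hrp hqp fun _ => hcl.symm
    refine ⟨r, hrp, hrd, ?_⟩
    rcases le_or_gt (3 * I.c) (16 * m) with hc | hc
    · exact (k1 hc).2 hfair
    · refine (k2 hc).1.2 ?_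
      rw [hcl]
      exact (k2 hc).2.1 hfair

/-- An edge not inside the modulator has an endpoint in a triple, and the other endpoint is one of
the two ends of that triple or one of its three members. -/
theorem edges_le (h : IsKernel I m X idx D) : (D.graph I).edgeSet.ncard ≤ m * m + D.N * 5 := by
  have hval := h.valid
  set g : ℕ → ℕ → ℕ := fun q r => if r = 0 then D.A (D.sg q) - 1 else if r = 1 then
    D.B (D.sg q) - 1 else D.sg q + (r - 2) with hg
  set E : Finset (Sym2 ℕ) :=
    ((Finset.range m ×ˢ Finset.range m).image fun x => s(x.1, x.2)) ∪
    ((Finset.range D.N ×ˢ Finset.range 5).image fun x => s(x.1, g x.1 x.2)) with hE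
  have key : ∀ a b : Fin D.N, (D.graph I).Adj a b → m ≤ (b : ℕ) → s((a : ℕ), (b : ℕ)) ∈ E := by
    intro a b hab hb
    obtain ⟨hrel, -⟩ := hab
    obtain ⟨t1, t2, t3⟩ := hval.sg_triple b hb b.2
    obtain ⟨b1, -⟩ := hval.base _ t3
    have hmpos := hval.mpos
    obtain ⟨r, hr, hgr⟩ : ∃ r < 5, g b r = a := by
      have hsame : D.sg a = D.sg b → ∃ r < 5, g b r = a := by
        intro hs
        have ham : m ≤ (a : ℕ) := by
          by_contra hlt
          have := hval.sg_init a (by omega)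
          omega
        obtain ⟨u1, u2, u3⟩ := hval.sg_triple a ham a.2
        refine ⟨a - D.sg b + 2, by omega, ?_⟩
        simp only [hg]
        rw [if_neg (by omega), if_neg (by omega)]
        omega
      have hin : (D.A (D.sg a) = b + 1 ∨ D.B (D.sg a) = b + 1) → False := by
        intro hs
        have hne : D.A (D.sg a) ≠ 0 := by
          intro h0
          have := hval.B_zero _ h0
          omega
        have := hval.ends _ hne
        omega
      rcases hrel with hs | hs | hs | hs | hs
      · exact hsame hs
      · refine ⟨0, by omega, ?_⟩
        simp only [hg, if_true]
        omega
      · refine ⟨1, by omega, ?_⟩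
        simp only [hg, if_true, one_ne_zero, if_false]
        omega
      · exact (hin (Or.inl hs)).elim
      · exact (hin (Or.inr hs)).elim
    refine Finset.mem_union_right _ (Finset.mem_image.2 ⟨((b : ℕ), r), ?_, ?_⟩)
    · simp [hr]
    · simp only [hgr]
      exact Sym2.eq_swap
  have hsub : Sym2.map (fun a : Fin D.N => (a : ℕ)) '' (D.graph I).edgeSet ⊆ (E : Set (Sym2 ℕ)) := by
    rintro _ ⟨e, he, rfl⟩
    induction e with
    | _ a b =>
    rw [SimpleGraph.mem_edgeSet] at he
    rw [Sym2.map_mk, Finset.mem_coe]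
    rcases le_or_gt m (b : ℕ) with hb | hb
    · exact key a b he hb
    rcases le_or_gt m (a : ℕ) with ha | ha
    · have := key b a he.symm ha
      rwa [Sym2.eq_swap]
    · exact Finset.mem_union_left _ (Finset.mem_image.2 ⟨((a : ℕ), (b : ℕ)), by simp [ha, hb], rfl⟩)
  rw [← Set.ncard_image_of_injective _ (Sym2.map.injective Fin.val_injective)]
  refine (Set.ncard_le_ncard hsub E.finite_toSet).trans ?_
  rw [Set.ncard_coe_finset]
  refine (Finset.card_union_le _ _).trans (add_le_add ?_ ?_)
  · refine Finset.card_image_le.trans ?_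
    simp
  · refine Finset.card_image_le.trans ?_
    simp

/-- After removal of the initial vertices, edges stay inside triples. An induced four-vertex path
would put four distinct vertices into one interval of length three. -/
theorem param_le (h : IsKernel I m X idx D) : distToCographs (D.graph I) ≤ m := by
  have hval := h.valid
  set S : Finset (Fin D.N) := Finset.univ.filter fun p => (p : ℕ) < m with hS
  have hcard : S.card ≤ m := by
    have := Finset.card_le_card_of_injOn (s := S) (t := Finset.range m) (fun p => (p : ℕ))
      (fun p hp => by simpa [hS] using hp) (fun p _ q _ hpq => Fin.ext hpq)
    simpa using this
  refine le_trans (Nat.sInf_le ⟨S, rfl, ⟨fun φ => ?_⟩⟩) hcard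
  have hge : ∀ i, m ≤ ((φ i : {v | v ∉ S}) : Fin D.N).val := by
    intro i
    have := (φ i).2
    simp only [hS, Finset.mem_filter, Finset.mem_univ, true_and, Set.mem_ofPred_eq, not_lt] at this
    exact this
  have hadj : ∀ i j, (SimpleGraph.pathGraph 4).Adj i j →
      D.sg (φ i : {v | v ∉ S}).1 = D.sg (φ j : {v | v ∉ S}).1 := by
    intro i j hij
    have h1 : (D.graph I).Adj (φ i).1 (φ j).1 := φ.map_rel_iff.2 hij
    have hin : ∀ a b : ℕ, m ≤ b → (D.A (D.sg a) = b + 1 ∨ D.B (D.sg a) = b + 1) → False := by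
      intro a b hb hs
      have hne : D.A (D.sg a) ≠ 0 := by
        intro h0
        have := hval.B_zero _ h0
        omega
      have := hval.ends _ hne
      omega
    rcases h1.1 with hs | hs | hs | hs | hs
    · exact hs
    · exact (hin _ _ (hge i) (Or.inl hs)).elim
    · exact (hin _ _ (hge i) (Or.inr hs)).elim
    · exact (hin _ _ (hge j) (Or.inl hs)).elim
    · exact (hin _ _ (hge j) (Or.inr hs)).elim
  have e01 := hadj 0 1 (by simp [SimpleGraph.pathGraph_adj])
  have e12 := hadj 1 2 (by simp [SimpleGraph.pathGraph_adj])
  have e23 := hadj 2 3 (by simp [SimpleGraph.pathGraph_adj])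
  have hne : ∀ i j, i ≠ j → ((φ i).1 : Fin D.N).val ≠ ((φ j).1 : Fin D.N).val := by
    intro i j hij heq
    exact hij (φ.injective (Subtype.ext (Fin.ext heq)))
  have t : ∀ i, _ := fun i => hval.sg_triple _ (hge i) (φ i).1.2
  have t0 := t 0
  have t1 := t 1
  have t2 := t 2
  have t3 := t 3
  have n01 := hne 0 1 (by decide)
  have n02 := hne 0 2 (by decide)
  have n03 := hne 0 3 (by decide)
  have n12 := hne 1 2 (by decide)
  have n13 := hne 1 3 (by decide)
  have n23 := hne 2 3 (by decide)
  omega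

theorem size_le (h : IsKernel I m X idx D) (hf : IsRelabeling I.c m D.N D.oc c' f) :
    (h.out hf).size + (h.out hf).param ≤ 4000000000 * (I.param + 1) ^ 5 := by
  have h1 := h.edges_le
  have h2 := h.param_le
  have h3 := h.valid.N_le
  have hm := h.valid.mpos
  have hc : c' ≤ 16 * m + D.N + 1 := by
    rcases hf with ⟨_, rfl, _⟩ | ⟨_, rfl, _⟩ <;> omega
  have h4 : (h.out hf).size + (h.out hf).param =
    D.N + (D.graph I).edgeSet.ncard + c' + distToCographs (D.graph I) := rfl
  have h5 : (16 * m) ^ 3 * (m * (m * 32)) = 131072 * m ^ 5 := by ring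
  have h6 : m ≤ m ^ 5 := Nat.le_self_pow (by norm_num) m
  have h7 : m * m ≤ m ^ 5 := by
    rw [← sq]
    exact Nat.pow_le_pow_right hm (by norm_num)
  -- The slack turns `4k + 2` into `4 * (k + 1)`, which costs a factor `4 ^ 5 = 1024`.
  have h8 : m ^ 5 ≤ (4 * (I.param + 1)) ^ 5 :=
    Nat.pow_le_pow_left (by have := h.m_le; omega) 5
  rw [mul_pow] at h8
  norm_num at h8
  omega

end IsKernel

end BalanceFair

namespace BalanceFair

/-! ### The program -/

namespace Expr

theorem eval_mul_ne {σ : State} {e f : Expr} :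
    (Expr.mul e f).eval σ ≠ 0 ↔ e.eval σ ≠ 0 ∧ f.eval σ ≠ 0 := by
  simp [eval]

theorem eval_add_ne {σ : State} {e f : Expr} :
    (Expr.add e f).eval σ ≠ 0 ↔ e.eval σ ≠ 0 ∨ f.eval σ ≠ 0 := by
  simp [eval]
  tauto

theorem eval_eq_ne {σ : State} {e f : Expr} :
    (Expr.eq e f).eval σ ≠ 0 ↔ e.eval σ = f.eval σ := by
  simp [eval]

theorem eval_lt_ne {σ : State} {e f : Expr} :
    (Expr.lt e f).eval σ ≠ 0 ↔ e.eval σ < f.eval σ := by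
  simp [eval]

end Expr

/-- The entry of the input adjacency matrix at the row `e` and the column `f`. -/
def adjE (e f : Expr) : Expr := .get 0 (.add (.mul e (.var 0)) f)

/-- Sequential composition of a list of programs. -/
def seqs : List Prog → Prog
  | [] => .skip
  | p :: l => .seq p (seqs l)

/-- Do the registers `4, 5, 6, 7` hold an induced path that avoids the marked vertices? -/
def freeP4E : Expr :=
  .mul (.mul (.mul (adjE (.var 4) (.var 5)) (adjE (.var 5) (.var 6)))
    (.mul (adjE (.var 6) (.var 7)) (.eq (adjE (.var 4) (.var 6)) (.lit 0))))
  (.mul (.mul (.eq (adjE (.var 4) (.var 7)) (.lit 0)) (.eq (adjE (.var 5) (.var 7)) (.lit 0)))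
    (.mul (.mul (.eq (.get 2 (.var 4)) (.lit 0)) (.eq (.get 2 (.var 5)) (.lit 0)))
      (.mul (.eq (.get 2 (.var 6)) (.lit 0)) (.eq (.get 2 (.var 7)) (.lit 0)))))

/-- Mark the modulator. -/
def markBody : Prog :=
  .cond freeP4E (seqs [.store 2 (.var 4) (.lit 1), .store 2 (.var 5) (.lit 1),
    .store 2 (.var 6) (.lit 1), .store 2 (.var 7) (.lit 1)]) .skip

def markNest : Prog := nest [(4, 0), (5, 0), (6, 0), (7, 0)] markBody

/-- Enumerate the modulator. -/
def enumBody : Prog :=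
  .cond (.get 2 (.var 4)) (seqs [.store 3 (.var 9) (.var 4), .store 4 (.var 9) (.get 1 (.var 4)),
    .store 10 (.var 4) (.var 9), .assign 9 (.add (.var 9) (.lit 1))]) .skip

/-- Do the registers `4, …, 8` hold a candidate for a triple? -/
def linkE : Expr :=
  .mul (.mul (adjE (.get 3 (.var 4)) (.var 6))
      (.add (.eq (.var 6) (.var 7)) (adjE (.var 6) (.var 7))))
    (.mul (.add (.eq (.var 7) (.var 8)) (adjE (.var 7) (.var 8)))
      (adjE (.var 8) (.get 3 (.var 5))))

/-- The code of the candidate. -/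
def gcodeE : Expr :=
  .add (.add (.add (.add (.eq (.var 6) (.var 7)) (.mul (.lit 2) (.eq (.var 7) (.var 8))))
    (.mul (.lit 4) (.eq (.var 13) (.var 14)))) (.mul (.lit 8) (.eq (.var 14) (.var 15))))
    (.mul (.lit 16) (.eq (.var 13) (.var 15)))

/-- Does the triple at the content of the register `21` agree with the candidate? -/
def agreesE : Expr :=
  .mul (.mul (.eq (.get 6 (.var 21)) (.add (.var 4) (.lit 1)))
      (.eq (.get 7 (.var 21)) (.add (.var 5) (.lit 1))))
    (.mul (.mul (.eq (.get 8 (.var 21)) (.var 12))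
        (.lt (.var 16) (.add (.eq (.get 4 (.var 21)) (.var 13)) (.lit 1))))
      (.mul (.lt (.var 17) (.add (.eq (.get 4 (.add (.var 21) (.lit 1))) (.var 14)) (.lit 1)))
        (.lt (.var 18) (.add (.eq (.get 4 (.add (.var 21) (.lit 2))) (.var 15)) (.lit 1)))))

def thresholdE : Expr := .mul (.lit 16) (.var 9)

/-- The form `M - e * (M - 1)` realizes the case distinction for `e` in `{0, 1}` by arithmetic. -/
def bdE (x : ℕ) : Expr := .sub thresholdE (.mul (.var x) (.sub thresholdE (.lit 1)))

/-- Count the triples that agree with the candidate in given positions, and drop the candidate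
if there are many. -/
def countBody : Prog :=
  seqs [.assign 19 (.lit 0), forP 21 10 (.assign 19 (.add (.var 19) agreesE)),
    .cond (.lt (.var 19) (.mul (.mul (bdE 16) (bdE 17)) (bdE 18))) .skip (.assign 11 (.lit 0))]

def countNest : Prog := nest [(16, 20), (17, 20), (18, 20)] countBody

/-- Append the triple. -/
def pushProg : Prog :=
  seqs [.store 3 (.var 10) (.var 6), .store 3 (.add (.var 10) (.lit 1)) (.var 7),
    .store 3 (.add (.var 10) (.lit 2)) (.var 8),
    .store 4 (.var 10) (.var 13), .store 4 (.add (.var 10) (.lit 1)) (.var 14),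
    .store 4 (.add (.var 10) (.lit 2)) (.var 15),
    .store 5 (.var 10) (.var 10), .store 5 (.add (.var 10) (.lit 1)) (.var 10),
    .store 5 (.add (.var 10) (.lit 2)) (.var 10),
    .store 6 (.var 10) (.add (.var 4) (.lit 1)), .store 7 (.var 10) (.add (.var 5) (.lit 1)),
    .store 8 (.var 10) (.var 12), .assign 10 (.add (.var 10) (.lit 3))]

def candBody : Prog :=
  .cond linkE
    (seqs [.assign 13 (.get 1 (.var 6)), .assign 14 (.get 1 (.var 7)),
      .assign 15 (.get 1 (.var 8)), .assign 12 gcodeE, .assign 11 (.lit 1), countNest,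
      .cond (.var 11) pushProg .skip]) .skip

def candNest : Prog := nest [(4, 9), (5, 9), (6, 0), (7, 0), (8, 0)] candBody

/-- The number `1` if the colors are kept, and `0` otherwise. -/
def keepE : Expr := .eq (.lt thresholdE (.mul (.lit 3) (.var 1))) (.lit 0)

/-- A conditional expression, governed by the flag in register `22`. -/
def chooseE (e f : Expr) : Expr :=
  .add (.mul (.var 22) e) (.mul (.sub (.lit 1) (.var 22)) f)

/-- Array `9` is indexed by old colors. With many colors, each one is finally labeled by the last
kernel vertex that carries it. -/
def labelBody : Prog := .store 9 (.get 4 (.var 4)) (chooseE (.get 4 (.var 4)) (.var 4))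

def colorBody : Prog := .store 1 (.var 4) (.get 9 (.get 4 (.var 4)))

def cellE : Expr := .add (.mul (.var 4) (.var 10)) (.var 5)

/-- Adjacency in the kernel. -/
def outAdjE : Expr :=
  .lt (.lit 0) (.mul (adjE (.get 3 (.var 4)) (.get 3 (.var 5)))
    (.add (.eq (.get 5 (.var 4)) (.get 5 (.var 5)))
      (.add (.add (.eq (.get 6 (.get 5 (.var 5))) (.add (.var 4) (.lit 1)))
          (.eq (.get 7 (.get 5 (.var 5))) (.add (.var 4) (.lit 1))))
        (.add (.eq (.get 6 (.get 5 (.var 4))) (.add (.var 5) (.lit 1)))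
          (.eq (.get 7 (.get 5 (.var 4))) (.add (.var 5) (.lit 1)))))))

/-- The output matrix is first built in a scratch array, since its entries are computed from the
input matrix, which occupies the place of the output. -/
def adjNest : Prog := nest [(4, 10), (5, 10)] (.store 11 cellE outAdjE)

def copyNest : Prog := nest [(4, 10), (5, 10)] (.store 0 cellE (.get 11 cellE))

def markProg : Prog :=
  seqs [.store 2 (.var 2) (.lit 1), .store 2 (.var 3) (.lit 1), markNest]

def enumProg : Prog := seqs [.assign 9 (.lit 0), forP 4 0 enumBody]

def candProg : Prog := seqs [.assign 10 (.var 9), .assign 20 (.lit 2), candNest]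

def labelProg : Prog := seqs [.assign 22 keepE, forP 4 10 labelBody, forP 4 10 colorBody]

def finalProg : Prog :=
  seqs [.assign 2 (.get 10 (.var 2)), .assign 3 (.get 10 (.var 3)),
    .assign 1 (chooseE (.var 1) (.add (.var 10) (.lit 1))), .assign 0 (.var 10)]

/-- The kernelization. -/
def kernelProg : Prog :=
  seqs [markProg, enumProg, candProg, adjNest, labelProg, copyNest, finalProg]

/-! ### Correctness of the program -/

/-- The memory still holds the graph, the colors and the terminals. -/
structure Base (I : Inst) (τ : State) : Prop where
  n : τ.reg 0 = I.n
  c : τ.reg 1 = I.c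
  s : τ.reg 2 = I.s
  t : τ.reg 3 = I.t
  adj : ∀ i < I.n, ∀ j < I.n, (τ.arr 0 (i * I.n + j) ≠ 0 ↔ I.adjN i j)
  col : ∀ v < I.n, τ.arr 1 v = I.colN v

theorem cell_inj {N p q p' q' : ℕ} (hq : q < N) (hq' : q' < N) (h : p * N + q = p' * N + q') :
    p = p' ∧ q = q' := by
  have hN : 0 < N := by omega
  have h1 : (p * N + q) / N = p := by
    rw [mul_comm, Nat.mul_add_div hN, Nat.div_eq_of_lt hq, add_zero]
  have h2 : (p' * N + q') / N = p' := by
    rw [mul_comm, Nat.mul_add_div hN, Nat.div_eq_of_lt hq', add_zero]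
  have : p = p' := by rw [← h1, ← h2, h]
  subst this
  exact ⟨rfl, by omega⟩

theorem base_input (I : Inst) : Base I I.input := by
  refine ⟨rfl, rfl, rfl, rfl, ?_, ?_⟩
  · intro i hi j hj
    simp only [Inst.input, if_true, ne_eq, ite_eq_right_iff, one_ne_zero, imp_false, not_not]
    constructor
    · rintro ⟨i', j', hadj, heq⟩
      obtain ⟨rfl, rfl⟩ := cell_inj hj j'.2 heq
      exact ⟨hi, hj, hadj⟩
    · rintro ⟨_, _, hadj⟩
      exact ⟨_, _, hadj, rfl⟩
  · intro v hv
    simp [Inst.input, Inst.colN, hv]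

theorem Base.frame {I : Inst} {p : Prog} {σ τ : State} (h : Base I σ) (hf : Frame p σ τ)
    (h0 : p.wr 0 = false) (h1 : p.wr 1 = false) (h2 : p.wr 2 = false) (h3 : p.wr 3 = false)
    (ha : p.wa 0 = false) (hb : p.wa 1 = false) : Base I τ := by
  refine ⟨?_, ?_, ?_, ?_, ?_, ?_⟩
  · rw [hf.reg 0 h0, h.n]
  · rw [hf.reg 1 h1, h.c]
  · rw [hf.reg 2 h2, h.s]
  · rw [hf.reg 3 h3, h.t]
  · rw [hf.arr 0 ha]
    exact h.adj
  · rw [hf.arr 1 hb]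
    exact h.col

theorem Base.eval_adjE {I : Inst} {τ : State} (h : Base I τ) {e f : Expr} {i j : ℕ}
    (he : e.eval τ = i) (hf : f.eval τ = j) (hi : i < I.n) (hj : j < I.n) :
    (adjE e f).eval τ ≠ 0 ↔ I.adjN i j := by
  have := h.adj i hi j hj
  simpa only [adjE, Expr.eval, he, hf, h.n] using this

/-! #### Marking -/

/-- The marked vertices. -/
def marked (n : ℕ) (mk : ℕ → ℕ) : Finset ℕ := (Finset.range n).filter fun v => mk v ≠ 0

/-- The invariant of the marking phase. -/
def MarkInv (I : Inst) (mk : ℕ → ℕ) : Prop :=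
  mk I.s ≠ 0 ∧ mk I.t ≠ 0 ∧ ∀ M : Finset ℕ,
    (∀ a b c d, IsP4 I.adjN a b c d → a ∈ M ∨ b ∈ M ∨ c ∈ M ∨ d ∈ M) →
    (marked I.n mk \ {(I.s : ℕ), (I.t : ℕ)}).card ≤ 4 * (marked I.n mk ∩ M).card

/-- Each round marks four fresh vertices, at least one of which lies in the hitting set `M`: the
left side grows by at most four, and the intersection by at least one. -/
theorem MarkInv.update {I : Inst} {mk mk' : ℕ → ℕ} (h : MarkInv I mk) {a b c d : ℕ}
    (ha : a < I.n) (hb : b < I.n) (hc : c < I.n) (hd : d < I.n)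
    (hP : IsP4 I.adjN a b c d) (ha' : mk a = 0) (hb' : mk b = 0) (hc' : mk c = 0) (hd' : mk d = 0)
    (hmk : ∀ v, mk' v ≠ 0 ↔ (v = a ∨ v = b ∨ v = c ∨ v = d ∨ mk v ≠ 0)) : MarkInv I mk' := by
  obtain ⟨h1, h2, h3⟩ := h
  refine ⟨(hmk _).2 (by tauto), (hmk _).2 (by tauto), fun M hM => ?_⟩
  have h4 := h3 M hM
  have hset : marked I.n mk' = marked I.n mk ∪ {a, b, c, d} := by
    ext v
    simp only [marked, Finset.mem_filter, Finset.mem_range, hmk, Finset.mem_union,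
      Finset.mem_insert, Finset.mem_singleton]
    constructor
    · tauto
    · rintro (h | rfl | rfl | rfl | rfl) <;> tauto
  have h5 : (marked I.n mk' \ {(I.s : ℕ), (I.t : ℕ)}).card ≤
      (marked I.n mk \ {(I.s : ℕ), (I.t : ℕ)}).card + 4 := by
    have hsub : marked I.n mk' \ {(I.s : ℕ), (I.t : ℕ)} ⊆
        (marked I.n mk \ {(I.s : ℕ), (I.t : ℕ)}) ∪ {a, b, c, d} := by
      rw [hset]
      intro v
      simp only [Finset.mem_sdiff, Finset.mem_union]
      tauto
    exact (Finset.card_le_card hsub).trans ((Finset.card_union_le _ _).trans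
      (add_le_add le_rfl Finset.card_le_four))
  have h6 : (marked I.n mk ∩ M).card + 1 ≤ (marked I.n mk' ∩ M).card := by
    obtain ⟨v, hv, hvM⟩ : ∃ v, v ∈ ({a, b, c, d} : Finset ℕ) ∧ v ∈ M := by
      rcases hM a b c d hP with h | h | h | h
      · exact ⟨a, by simp, h⟩
      · exact ⟨b, by simp, h⟩
      · exact ⟨c, by simp, h⟩
      · exact ⟨d, by simp, h⟩
    have hv0 : v ∉ marked I.n mk := by
      simp only [Finset.mem_insert, Finset.mem_singleton] at hv
      simp only [marked, Finset.mem_filter, not_and, not_not]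
      rcases hv with rfl | rfl | rfl | rfl <;> intro <;> assumption
    rw [← Finset.card_insert_of_notMem (a := v) (fun h => hv0 (Finset.mem_inter.1 h).1)]
    refine Finset.card_le_card fun w hw => ?_
    rw [hset]
    rcases Finset.mem_insert.1 hw with rfl | hw
    · exact Finset.mem_inter.2 ⟨Finset.mem_union_right _ hv, hvM⟩
    · exact Finset.mem_inter.2 ⟨Finset.mem_union_left _ (Finset.mem_inter.1 hw).1,
        (Finset.mem_inter.1 hw).2⟩
  omega

/-- The invariant holds for every hitting set, so it may be applied to an optimal one; the summand
`2` pays for `s` and `t`. -/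
theorem MarkInv.card_le {I : Inst} {mk : ℕ → ℕ} (h : MarkInv I mk) :
    (marked I.n mk).card ≤ 4 * I.param + 2 := by
  obtain ⟨Y, hY, hcog⟩ : ∃ Y : Finset (Fin I.n), Y.card = I.param ∧
      IsCograph (I.graph.induce {v | v ∉ Y}) := by
    refine Nat.sInf_mem (s := {m | ∃ Y : Finset (Fin I.n), Y.card = m ∧
      IsCograph (I.graph.induce {v | v ∉ Y})}) ⟨_, Finset.univ, rfl, ⟨fun φ => ?_⟩⟩
    exact (φ 0).2 (Finset.mem_univ _)
  have hM : ∀ a b c d, IsP4 I.adjN a b c d → a ∈ Y.map Fin.valEmbedding ∨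
      b ∈ Y.map Fin.valEmbedding ∨ c ∈ Y.map Fin.valEmbedding ∨ d ∈ Y.map Fin.valEmbedding := by
    intro a b c d hP
    by_contra! hno
    obtain ⟨ha, hb, hc, hd⟩ := hno
    obtain ⟨⟨an, bn, hab⟩, ⟨_, cn, hbc⟩, ⟨_, dn, hcd⟩, nac, nad, nbd⟩ := hP
    have hmem : ∀ v (hv : v < I.n), v ∉ Y.map Fin.valEmbedding → (⟨v, hv⟩ : Fin I.n) ∉ Y := by
      intro v hv hvY hv'
      exact hvY (Finset.mem_map.2 ⟨_, hv', rfl⟩)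
    have nac' : ¬ I.graph.Adj ⟨a, an⟩ ⟨c, cn⟩ := fun h => nac ⟨_, _, h⟩
    have nad' : ¬ I.graph.Adj ⟨a, an⟩ ⟨d, dn⟩ := fun h => nad ⟨_, _, h⟩
    have nbd' : ¬ I.graph.Adj ⟨b, bn⟩ ⟨d, dn⟩ := fun h => nbd ⟨_, _, h⟩
    have nca' : ¬ I.graph.Adj ⟨c, cn⟩ ⟨a, an⟩ := fun h => nac' h.symm
    have nda' : ¬ I.graph.Adj ⟨d, dn⟩ ⟨a, an⟩ := fun h => nad' h.symm
    have ndb' : ¬ I.graph.Adj ⟨d, dn⟩ ⟨b, bn⟩ := fun h => nbd' h.symm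
    -- `IsP4` does not demand distinct vertices; distinctness follows from the adjacencies and
    -- non-adjacencies.
    have e1 : a ≠ b := fun h => hab.ne (Fin.ext h)
    have e2 : b ≠ c := fun h => hbc.ne (Fin.ext h)
    have e3 : c ≠ d := fun h => hcd.ne (Fin.ext h)
    have e4 : a ≠ c := by
      rintro rfl
      exact nad' hcd
    have e5 : b ≠ d := by
      rintro rfl
      exact nad' hab
    have e6 : a ≠ d := by
      rintro rfl
      exact nca' hcd
    let F : Fin 4 → {v : Fin I.n | v ∉ Y} := ![⟨⟨a, an⟩, hmem a an ha⟩, ⟨⟨b, bn⟩, hmem b bn hb⟩,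
      ⟨⟨c, cn⟩, hmem c cn hc⟩, ⟨⟨d, dn⟩, hmem d dn hd⟩]
    refine hcog.false ⟨⟨F, ?_⟩, ?_⟩
    · intro i j hij
      fin_cases i <;> fin_cases j <;> simp [F] at hij ⊢ <;> omega
    · intro i j
      change I.graph.Adj (F i).1 (F j).1 ↔ (SimpleGraph.pathGraph 4).Adj i j
      fin_cases i <;> fin_cases j <;>
        simp [F, SimpleGraph.pathGraph_adj, hab, hbc, hcd, hab.symm, hbc.symm, hcd.symm, nac', nad',
          nbd', nca', nda', ndb']
  have h1 := h.2.2 _ hM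
  have h2 : (marked I.n mk ∩ Y.map Fin.valEmbedding).card ≤ I.param := by
    rw [← hY, ← Finset.card_map Fin.valEmbedding]
    exact Finset.card_le_card Finset.inter_subset_right
  have h3 : (marked I.n mk).card ≤ (marked I.n mk \ {(I.s : ℕ), (I.t : ℕ)}).card + 2 := by
    have := Finset.le_card_sdiff {(I.s : ℕ), (I.t : ℕ)} (marked I.n mk)
    have h4 : ({(I.s : ℕ), (I.t : ℕ)} : Finset ℕ).card ≤ 2 := Finset.card_le_two
    omega
  omega

end BalanceFair

/-! ### Execution of the marking and enumeration phases -/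

namespace BalanceFair

variable {W B : ℕ}

theorem Ok.store_seq (env : Env W B) {σ : State} {q : Prog} {T : ℕ} {Q : State → Prop}
    (hσ : Bdd B σ) {a : ℕ} {e f : Expr} (he : e.ok = true) (hf : f.ok = true)
    (hB : f.eval σ ≤ B)
    (h : Bdd B (σ.setArr a (e.eval σ) (f.eval σ)) →
      Ok W B (σ.setArr a (e.eval σ) (f.eval σ)) q T Q) :
    Ok W B σ (.seq (.store a e f) q) (e.cost + f.cost + 1 + T) Q :=
  Ok.seq (Ok.store env hσ he hf hB h)

theorem Ok.assign_seq (env : Env W B) {σ : State} {q : Prog} {T : ℕ} {Q : State → Prop}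
    (hσ : Bdd B σ) {x : ℕ} {e : Expr} (he : e.ok = true) (hB : e.eval σ ≤ B)
    (h : Bdd B (σ.setReg x (e.eval σ)) → Ok W B (σ.setReg x (e.eval σ)) q T Q) :
    Ok W B σ (.seq (.assign x e) q) (e.cost + 1 + T) Q :=
  Ok.seq (Ok.assign env hσ he hB h)

theorem freeP4E_ne {I : Inst} {τ : State} (h : Base I τ) {a b c d : ℕ} (ha : a < I.n)
    (hb : b < I.n) (hc : c < I.n) (hd : d < I.n) (h4 : τ.reg 4 = a) (h5 : τ.reg 5 = b)
    (h6 : τ.reg 6 = c) (h7 : τ.reg 7 = d) :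
    freeP4E.eval τ ≠ 0 ↔ IsP4 I.adjN a b c d ∧ τ.arr 2 a = 0 ∧ τ.arr 2 b = 0 ∧ τ.arr 2 c = 0 ∧
      τ.arr 2 d = 0 := by
  have v4 : (Expr.var 4).eval τ = a := h4
  have v5 : (Expr.var 5).eval τ = b := h5
  have v6 : (Expr.var 6).eval τ = c := h6
  have v7 : (Expr.var 7).eval τ = d := h7
  have hz : ∀ {e : Expr} {P : Prop}, (e.eval τ ≠ 0 ↔ P) → (e.eval τ = (Expr.lit 0).eval τ ↔ ¬ P) := by
    intro e P he
    rw [← he, not_not]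
    rfl
  simp only [freeP4E, Expr.eval_mul_ne, Expr.eval_eq_ne, h.eval_adjE v4 v5 ha hb,
    h.eval_adjE v5 v6 hb hc, h.eval_adjE v6 v7 hc hd, hz (h.eval_adjE v4 v6 ha hc),
    hz (h.eval_adjE v4 v7 ha hd), hz (h.eval_adjE v5 v7 hb hd), IsP4]
  simp only [Expr.eval, h4, h5, h6, h7]
  tauto

/-- One pass suffices because marks are never removed: a quadruple that was hit, or marked, when
visited stays hit. -/
theorem ok_markProg (env : Env W B) {I : Inst} {σ : State} (hσ : Bdd B σ) (hI : Base I σ)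
    (h0 : ∀ v, σ.arr 2 v = 0) :
    Ok W B σ markProg (nestTime [I.n, I.n, I.n, I.n] 200 + 20) (fun τ => MarkInv I (τ.arr 2) ∧
      ∀ a b c d, IsP4 I.adjN a b c d → τ.arr 2 a ≠ 0 ∨ τ.arr 2 b ≠ 0 ∨ τ.arr 2 c ≠ 0 ∨
        τ.arr 2 d ≠ 0) := by
  have h1B : 1 ≤ B := le_trans (by norm_num) env.lit
  refine Ok.time (Ok.store_seq env hσ rfl rfl h1B fun hb₁ =>
    Ok.store_seq env hb₁ rfl rfl h1B fun hb₂ => Ok.seq (T := nestTime [I.n, I.n, I.n, I.n] 200)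
      (T' := 1) ?_) (by simp [Expr.cost]; omega)
  generalize hσ₂ : State.setArr _ _ _ _ = σ₂ at hb₂ ⊢
  have hI₂ : Base I σ₂ := by
    subst hσ₂
    exact ⟨hI.n, hI.c, hI.s, hI.t, hI.adj, hI.col⟩
  have harr : ∀ v, σ₂.arr 2 v = if v = I.t then 1 else if v = I.s then 1 else 0 := by
    intro v
    subst hσ₂
    simp [Expr.eval, Function.update_apply, hI.s, hI.t, h0]
  -- Initially only the terminals are marked, so the left side of the inequality is zero.
  have hinv : MarkInv I (σ₂.arr 2) := by
    refine ⟨by simp [harr], by simp [harr], fun M _ => ?_⟩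
    have : marked I.n (σ₂.arr 2) \ {(I.s : ℕ), (I.t : ℕ)} = ∅ := by
      ext v
      simp only [marked, harr, Finset.mem_sdiff, Finset.mem_filter, Finset.mem_insert,
        Finset.mem_singleton, Finset.notMem_empty, iff_false]
      split_ifs <;> simp_all
    rw [this]
    simp
  have key := Ok.nest env hb₂ (fun τ => τ.arr 2) (MarkInv I)
    (fun mk mk' => ∀ v, mk v ≠ 0 → mk' v ≠ 0)
    (fun is mk => ∀ a b c d, is = [a, b, c, d] → IsP4 I.adjN a b c d →
      mk a ≠ 0 ∨ mk b ≠ 0 ∨ mk c ≠ 0 ∨ mk d ≠ 0) (p := markBody) (T := 200)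
    (l := [(4, 0), (5, 0), (6, 0), (7, 0)]) hinv rfl (fun _ _ _ _ => rfl) (fun _ _ h => h)
    (fun _ _ _ h h' v hv => h' v (h v hv)) ?_ ?_
  · rw [show List.map (fun xr : ℕ × ℕ => σ₂.reg xr.2) [(4, 0), (5, 0), (6, 0), (7, 0)] =
      [I.n, I.n, I.n, I.n] by simp [hI₂.n]] at key
    refine key.mono le_rfl fun τ hb _ ⟨h1, _, h3⟩ hb' => Ok.skip hb' ⟨h1, ?_⟩
    intro a b c d hP
    refine h3 [a, b, c, d] ?_ a b c d rfl hP
    obtain ⟨⟨ha, hb, _⟩, ⟨_, hc, _⟩, ⟨_, hd, _⟩, -⟩ := hP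
    simp [hI₂.n, ha, hb, hc, hd]
  · rintro is mk mk' h h' a b c d rfl hP
    rcases h a b c d rfl hP with h | h | h | h
    · exact Or.inl (h' _ h)
    · exact Or.inr (Or.inl (h' _ h))
    · exact Or.inr (Or.inr (Or.inl (h' _ h)))
    · exact Or.inr (Or.inr (Or.inr (h' _ h)))
  · intro is τ hb hf his hinvτ
    have hIτ : Base I τ := hI₂.frame hf rfl rfl rfl rfl rfl rfl
    simp only [List.forall₂_cons_right_iff, List.forall₂_nil_right_iff] at his
    obtain ⟨a, _, ⟨ha, h4⟩, ⟨b, _, ⟨hb', h5⟩, ⟨c, _, ⟨hc, h6⟩, ⟨d, _, ⟨hd, h7⟩, rfl, rfl⟩, rfl⟩,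
      rfl⟩, rfl⟩ := his
    simp only [hIτ.n] at ha hb' hc hd
    have hP := freeP4E_ne hIτ ha hb' hc hd h4 h5 h6 h7
    refine Ok.time (T := freeP4E.cost + 1 + 17) (Ok.cond env hb rfl (fun hne => ?_) fun he => ?_)
      (by decide)
    · obtain ⟨hP4, ma, mb, mc, md⟩ := hP.1 hne
      refine Ok.time (Ok.store_seq env hb rfl rfl h1B fun hb₁ =>
        Ok.store_seq env hb₁ rfl rfl h1B fun hb₂ => Ok.store_seq env hb₂ rfl rfl h1B fun hb₃ =>
        Ok.store_seq env hb₃ rfl rfl h1B fun hb₄ => Ok.skip hb₄ ?_) (by decide)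
      have hmk : ∀ v, State.arr (State.setArr (State.setArr (State.setArr (State.setArr τ 2
          (τ.reg 4) 1) 2 (τ.reg 5) 1) 2 (τ.reg 6) 1) 2 (τ.reg 7) 1) 2 v ≠ 0 ↔
          (v = a ∨ v = b ∨ v = c ∨ v = d ∨ τ.arr 2 v ≠ 0) := by
        intro v
        simp only [State.setArr_arr, if_true, Function.update_apply, h4, h5, h6, h7]
        split_ifs <;> simp_all
      refine ⟨hinvτ.update ha hb' hc hd hP4 ma mb mc md hmk, ?_, ?_⟩
      · intro v hv
        exact (hmk v).2 (by tauto)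
      · rintro a' b' c' d' his -
        simp only [List.cons.injEq] at his
        exact Or.inl ((hmk _).2 (by tauto))
    · refine Ok.time (Ok.skip hb ⟨hinvτ, fun _ h => h, ?_⟩) (by decide)
      rintro a' b' c' d' his hP'
      simp only [List.cons.injEq, and_true] at his
      obtain ⟨rfl, rfl, rfl, rfl⟩ := his
      by_contra! hno
      exact hP.2 ⟨hP', hno⟩ he

/-- The situation after the enumeration of the modulator: there are `m` marked vertices, listed in
`org`, with colors in `oc` and positions in `idx`. -/
structure EnumInv (I : Inst) (mk : ℕ → ℕ) (k m : ℕ) (org oc idx : ℕ → ℕ) : Prop where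
  lt : ∀ p < m, org p < k ∧ mk (org p) ≠ 0 ∧ oc p = I.colN (org p) ∧ idx (org p) = p
  idx_lt : ∀ v < k, mk v ≠ 0 → idx v < m ∧ org (idx v) = v

theorem EnumInv.m_le {I : Inst} {mk : ℕ → ℕ} {m k : ℕ} {org oc idx : ℕ → ℕ} (hk : k ≤ I.n)
    (h : EnumInv I mk k m org oc idx) : m ≤ (marked I.n mk).card := by
  have := Finset.card_le_card_of_injOn (s := Finset.range m) (t := marked I.n mk) org ?_ ?_
  · simpa using this
  · intro p hp
    obtain ⟨h1, h2, -⟩ := h.lt p (by simpa using hp)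
    simp [marked, h2]
    omega
  · intro p hp q hq hpq
    have h1 := (h.lt p (by simpa using hp)).2.2.2
    have h2 := (h.lt q (by simpa using hq)).2.2.2
    rw [← h1, hpq, h2]

theorem EnumInv.m_le_n {I : Inst} {mk : ℕ → ℕ} {m k : ℕ} {org oc idx : ℕ → ℕ} (hk : k ≤ I.n)
    (h : EnumInv I mk k m org oc idx) : m ≤ I.n := by
  refine (h.m_le hk).trans ((Finset.card_filter_le _ _).trans ?_)
  simp

theorem ok_enumProg (env : Env W B) {I : Inst} {σ : State} (hσ : Bdd B σ) (hI : Base I σ)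
    (hn : I.n + 1 ≤ B) :
    Ok W B σ enumProg (10 + (6 + I.n * (50 + 8))) (fun τ =>
      EnumInv I (σ.arr 2) I.n (τ.reg 9) (τ.arr 3) (τ.arr 4) (τ.arr 10)) := by
  refine Ok.time (Ok.assign_seq env hσ rfl (Nat.zero_le _) fun hb₁ => Ok.seq
    (T := 6 + I.n * (50 + 8)) (T' := 1) ?_) (by simp [Expr.cost]; omega)
  refine (Ok.forP env hb₁ (T := 50) (N := I.n) rfl rfl (by decide)
    (show (State.setReg σ 9 _).reg 0 = I.n from hI.n)
    (fun i τ => EnumInv I (σ.arr 2) i (τ.reg 9) (τ.arr 3) (τ.arr 4) (τ.arr 10)) ?_ ?_).mono le_rfl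
    fun τ _ _ h hb => Ok.skip hb h
  · refine ⟨fun p hp => absurd hp ?_, fun v hv => absurd hv (by omega)⟩
    simp [Expr.eval]
  · intro i hi τ hb hf h4 hinv
    have hIτ : Base I τ := Base.frame (p := forP 4 0 enumBody) (σ := σ.setReg 9 0)
      ⟨hI.n, hI.c, hI.s, hI.t, hI.adj, hI.col⟩ hf rfl rfl rfl rfl rfl rfl
    have hmk : τ.arr 2 = σ.arr 2 := hf.arr 2 rfl
    refine Ok.time (T := 2 + 1 + 40) (Ok.cond env hb rfl (fun hne => ?_) fun he => ?_)
      (by decide)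
    · have hne' : σ.arr 2 i ≠ 0 := by
        simpa only [Expr.eval, h4, hmk] using hne
      have hm := hinv.m_le_n hi.le
      have hmi : ∀ p < τ.reg 9, τ.arr 3 p ≠ i := fun p hp => ((hinv.lt p hp).1).ne
      refine Ok.time (Ok.store_seq env hb rfl rfl ?_ fun hb₁ => Ok.store_seq env hb₁ rfl rfl ?_
        fun hb₂ => Ok.store_seq env hb₂ rfl rfl ?_ fun hb₃ => Ok.assign_seq env hb₃ rfl ?_
        fun hb₄ => Ok.skip hb₄ ?_) (by decide)
      · simp only [Expr.eval, h4]
        omega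
      · exact hb₁.2 _ _
      · exact hb₂.1 _
      · have hlt : τ.reg 9 + 1 ≤ B := by
          omega
        exact hlt
      · have hcol := hIτ.col i hi
        simp only [Expr.eval, State.setReg_reg, State.setReg_arr, State.setArr_reg,
          State.setArr_arr, h4]
        norm_num
        refine ⟨fun p hp => ?_, fun v hv hv' => ?_⟩
        · simp only [Function.update_apply]
          rcases Nat.lt_succ_iff_lt_or_eq.1 hp with hp | rfl
          · rw [if_neg hp.ne, if_neg hp.ne, if_neg (hmi p hp)]
            obtain ⟨g1, g2⟩ := hinv.lt p hp
            exact ⟨by omega, g2⟩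
          · simp [hne', hcol]
        · simp only [Function.update_apply]
          rcases Nat.lt_succ_iff_lt_or_eq.1 hv with hv | rfl
          · obtain ⟨g1, g2⟩ := hinv.idx_lt v hv hv'
            rw [if_neg hv.ne, if_neg g1.ne]
            exact ⟨by omega, g2⟩
          · simp
    · refine Ok.time (Ok.skip hb ?_) (by decide)
      have he' : σ.arr 2 i = 0 := by
        simpa only [Expr.eval, h4, hmk] using he
      refine ⟨fun p hp => ?_, fun v hv hv' => ?_⟩
      · obtain ⟨g1, g2⟩ := hinv.lt p hp
        exact ⟨Nat.lt_succ_of_lt g1, g2⟩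
      · rcases Nat.lt_succ_iff_lt_or_eq.1 hv with hv | rfl
        · exact hinv.idx_lt v hv hv'
        · exact absurd he' hv'

end BalanceFair

/-! ### Greedy selection of the triples -/

namespace BalanceFair

variable {W B : ℕ}

/-- The data that the memory holds during the construction of the kernel. -/
def kview (τ : State) : KData where
  N := τ.reg 10
  org := τ.arr 3
  oc := τ.arr 4
  sg := τ.arr 5
  A := τ.arr 6
  B := τ.arr 7
  G := τ.arr 8

theorem kview_frame {p : Prog} {σ τ : State} (h : Frame p σ τ) (h0 : p.wr 10 = false)
    (h1 : p.wa 3 = false) (h2 : p.wa 4 = false) (h3 : p.wa 5 = false) (h4 : p.wa 6 = false)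
    (h5 : p.wa 7 = false) (h6 : p.wa 8 = false) : kview τ = kview σ := by
  simp [kview, h.reg 10 h0, h.arr 3 h1, h.arr 4 h2, h.arr 5 h3, h.arr 6 h4, h.arr 7 h5, h.arr 8 h6]

/-- The registers hold the candidate with terminals `i, j`, code `g` and colors `c₁, c₂, c₃`. -/
structure CandRegs (τ : State) (i j g c₁ c₂ c₃ m : ℕ) : Prop where
  r4 : τ.reg 4 = i
  r5 : τ.reg 5 = j
  r12 : τ.reg 12 = g
  r13 : τ.reg 13 = c₁
  r14 : τ.reg 14 = c₂
  r15 : τ.reg 15 = c₃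
  r9 : τ.reg 9 = m

theorem CandRegs.frame {p : Prog} {σ τ : State} {i j g c₁ c₂ c₃ m : ℕ}
    (h : CandRegs σ i j g c₁ c₂ c₃ m) (hf : Frame p σ τ) (h4 : p.wr 4 = false)
    (h5 : p.wr 5 = false) (h12 : p.wr 12 = false) (h13 : p.wr 13 = false) (h14 : p.wr 14 = false)
    (h15 : p.wr 15 = false) (h9 : p.wr 9 = false) : CandRegs τ i j g c₁ c₂ c₃ m :=
  ⟨(hf.reg 4 h4).trans h.r4, (hf.reg 5 h5).trans h.r5, (hf.reg 12 h12).trans h.r12,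
    (hf.reg 13 h13).trans h.r13, (hf.reg 14 h14).trans h.r14, (hf.reg 15 h15).trans h.r15,
    (hf.reg 9 h9).trans h.r9⟩

theorem agreesE_eval {τ : State} {i j g c₁ c₂ c₃ m e₁ e₂ e₃ q : ℕ}
    (h : CandRegs τ i j g c₁ c₂ c₃ m) (h16 : τ.reg 16 = e₁) (h17 : τ.reg 17 = e₂)
    (h18 : τ.reg 18 = e₃) (h21 : τ.reg 21 = q) (h₁ : e₁ < 2) (h₂ : e₂ < 2) (h₃ : e₃ < 2) :
    agreesE.eval τ = if (kview τ).Agrees (i + 1) (j + 1) g e₁ e₂ e₃ c₁ c₂ c₃ q then 1 else 0 := by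
  have hle : agreesE.eval τ ≤ 1 := by
    have hmul : ∀ a b : ℕ, a ≤ 1 → b ≤ 1 → a * b ≤ 1 := fun a b ha hb => by
      simpa using Nat.mul_le_mul ha hb
    have hite : ∀ (p : Prop) [Decidable p], (if p then 1 else 0) ≤ 1 := fun p _ => by
      split_ifs <;> omega
    simp only [agreesE, Expr.eval]
    refine hmul _ _ (hmul _ _ (hite _) (hite _)) (hmul _ _ (hmul _ _ (hite _) (hite _))
      (hmul _ _ (hite _) (hite _)))
  -- For a selector in `{0, 1}`, the comparison with the indicator plus one expresses "free, or the
  -- colors agree".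
  have hlt : ∀ (e : ℕ) (p : Prop) [Decidable p], e < 2 →
      (e < (if p then 1 else 0) + 1 ↔ (e = 0 ∨ p)) := by
    intro e p _ he
    split_ifs with hp
    · simp only [hp, or_true, iff_true]
      omega
    · simp only [hp, or_false]
      omega
  have hne : agreesE.eval τ ≠ 0 ↔ (kview τ).Agrees (i + 1) (j + 1) g e₁ e₂ e₃ c₁ c₂ c₃ q := by
    simp only [agreesE, Expr.eval_mul_ne, Expr.eval_eq_ne, Expr.eval_lt_ne]
    simp only [Expr.eval, h.r4, h.r5, h.r12, h.r13, h.r14, h.r15, h16, h17, h18, h21, hlt _ _ h₁,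
      hlt _ _ h₂, hlt _ _ h₃, KData.Agrees, kview]
    tauto
  split_ifs with hA
  · have := hne.2 hA
    omega
  · by_contra h0
    exact hA (hne.1 h0)

theorem bdE_eval {τ : State} {x e m : ℕ} (hx : τ.reg x = e) (h9 : τ.reg 9 = m) (he : e < 2)
    (hm : 0 < m) : (bdE x).eval τ = bd (16 * m) e := by
  simp only [bdE, thresholdE, Expr.eval, hx, h9, bd]
  have : e = 0 ∨ e = 1 := by omega
  rcases this with rfl | rfl
  · simp
  · simp only [one_mul, one_ne_zero, if_false]
    omega

/-- Time for one execution of `countBody` with `N` vertices. -/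
def countTime (N : ℕ) : ℕ := 150 + (6 + N * 100)

theorem ok_countBody (env : Env W B) {τ : State} (hb : Bdd B τ) {i j g c₁ c₂ c₃ m e₁ e₂ e₃ : ℕ}
    (h : CandRegs τ i j g c₁ c₂ c₃ m) (h16 : τ.reg 16 = e₁) (h17 : τ.reg 17 = e₂)
    (h18 : τ.reg 18 = e₃) (h₁ : e₁ < 2) (h₂ : e₂ < 2) (h₃ : e₃ < 2) (hm : 0 < m) :
    Ok W B τ countBody (countTime (τ.reg 10)) (fun τ' => τ'.reg 11 =
      if ((kview τ).agr (i + 1) (j + 1) g e₁ e₂ e₃ c₁ c₂ c₃).card <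
        bd (16 * m) e₁ * bd (16 * m) e₂ * bd (16 * m) e₃ then τ.reg 11 else 0) := by
  set D := kview τ with hD
  have hNB : τ.reg 10 ≤ B := hb.1 10
  refine Ok.time (Ok.assign_seq env hb rfl (Nat.zero_le _) fun hb₁ => Ok.seq
    (T := 6 + τ.reg 10 * (92 + 8)) (T' := 140) ?_) (by simp [Expr.cost, countTime]; omega)
  generalize hτ₁ : State.setReg τ 19 _ = τ₁ at hb₁ ⊢
  have f₁ : Frame (.assign 19 (.lit 0)) τ τ₁ := by
    subst hτ₁
    exact ⟨fun y hy => by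
      have : y ≠ 19 := by
        rintro rfl
        simp [Prog.wr] at hy
      simp [this], fun _ _ => rfl⟩
  have h₁' : CandRegs τ₁ i j g c₁ c₂ c₃ m := h.frame f₁ rfl rfl rfl rfl rfl rfl rfl
  have hD₁ : kview τ₁ = D := kview_frame f₁ rfl rfl rfl rfl rfl rfl rfl
  refine (Ok.forP env hb₁ (T := 92) (N := τ.reg 10) rfl rfl (by decide) (f₁.reg 10 rfl)
    (fun k υ => υ.reg 19 = ((Finset.range k).filter
      (D.Agrees (i + 1) (j + 1) g e₁ e₂ e₃ c₁ c₂ c₃)).card) ?_ ?_).mono le_rfl ?_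
  · subst hτ₁
    simp [Expr.eval]
  · intro k hk υ hbυ hf h21 hinv
    have hυ := h₁'.frame hf rfl rfl rfl rfl rfl rfl rfl
    have hDυ : kview υ = D := (kview_frame hf rfl rfl rfl rfl rfl rfl rfl).trans hD₁
    have hev := agreesE_eval hυ ((hf.reg 16 rfl).trans ((f₁.reg 16 rfl).trans h16))
      ((hf.reg 17 rfl).trans ((f₁.reg 17 rfl).trans h17))
      ((hf.reg 18 rfl).trans ((f₁.reg 18 rfl).trans h18)) h21 h₁ h₂ h₃
    rw [hDυ] at hev
    have hcard : ((Finset.range (k + 1)).filter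
        (D.Agrees (i + 1) (j + 1) g e₁ e₂ e₃ c₁ c₂ c₃)).card = υ.reg 19 + agreesE.eval υ := by
      rw [Finset.range_add_one, Finset.filter_insert, hev, hinv]
      split_ifs
      · rw [Finset.card_insert_of_notMem (by simp)]
      · rfl
    have hle : υ.reg 19 + agreesE.eval υ ≤ B := by
      rw [← hcard]
      refine (Finset.card_filter_le _ _).trans ?_
      rw [Finset.card_range]
      omega
    exact Ok.time (Ok.assign env hbυ rfl hle (by simpa [Expr.eval] using hcard.symm)) (by decide)
  · intro υ _ hf hcount hbυ
    have h16' := (hf.reg 16 rfl).trans ((f₁.reg 16 rfl).trans h16)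
    have h17' := (hf.reg 17 rfl).trans ((f₁.reg 17 rfl).trans h17)
    have h18' := (hf.reg 18 rfl).trans ((f₁.reg 18 rfl).trans h18)
    have h9' := (hf.reg 9 rfl).trans ((f₁.reg 9 rfl).trans h.r9)
    have h11' : υ.reg 11 = τ.reg 11 := (hf.reg 11 rfl).trans (f₁.reg 11 rfl)
    have hcard : υ.reg 19 = (D.agr (i + 1) (j + 1) g e₁ e₂ e₃ c₁ c₂ c₃).card := hcount
    have hiff : (Expr.lt (.var 19) (.mul (.mul (bdE 16) (bdE 17)) (bdE 18))).eval υ ≠ 0 ↔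
        (D.agr (i + 1) (j + 1) g e₁ e₂ e₃ c₁ c₂ c₃).card <
          bd (16 * m) e₁ * bd (16 * m) e₂ * bd (16 * m) e₃ := by
      rw [Expr.eval_lt_ne, ← hcard]
      simp only [Expr.eval, bdE_eval h16' h9' h₁ hm, bdE_eval h17' h9' h₂ hm,
        bdE_eval h18' h9' h₃ hm]
    refine Ok.time (Ok.seq (T := (Expr.lt (.var 19) (.mul (.mul (bdE 16) (bdE 17)) (bdE 18))).cost
      + 1 + 2) (T' := 1) (Ok.cond env hbυ rfl (fun hne => ?_) fun he => ?_)) (by decide)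
    · refine Ok.time (Ok.skip hbυ fun hb' => Ok.skip hb' ?_) (by decide)
      rw [if_pos (hiff.1 hne), h11']
    · refine Ok.time (Ok.assign env hbυ rfl (Nat.zero_le _) fun hb' => Ok.skip hb' ?_) (by decide)
      rw [if_neg (fun hlt => hiff.2 hlt he)]
      simp [Expr.eval]

/-- The flag in register `11` can only drop to zero. A zero witnesses a saturated choice of
positions; a nonzero flag at the end certifies that all eight tests passed. -/
theorem ok_countNest (env : Env W B) {σ : State} (hb : Bdd B σ) {i j g c₁ c₂ c₃ m : ℕ}
    (h : CandRegs σ i j g c₁ c₂ c₃ m) (hm : 0 < m) (h11 : σ.reg 11 = 1) (h20 : σ.reg 20 = 2) :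
    Ok W B σ countNest (nestTime [2, 2, 2] (countTime (σ.reg 10))) (fun τ =>
      (τ.reg 11 = 0 → ∃ e₁ e₂ e₃, bd (16 * m) e₁ * bd (16 * m) e₂ * bd (16 * m) e₃ ≤
        ((kview σ).agr (i + 1) (j + 1) g e₁ e₂ e₃ c₁ c₂ c₃).card) ∧
      (τ.reg 11 ≠ 0 → ∀ e₁ < 2, ∀ e₂ < 2, ∀ e₃ < 2,
        ((kview σ).agr (i + 1) (j + 1) g e₁ e₂ e₃ c₁ c₂ c₃).card <
          bd (16 * m) e₁ * bd (16 * m) e₂ * bd (16 * m) e₃)) := by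
  set D := kview σ with hD
  have key := Ok.nest env hb (fun τ => τ.reg 11)
    (fun fl => fl = 0 → ∃ e₁ e₂ e₃, bd (16 * m) e₁ * bd (16 * m) e₂ * bd (16 * m) e₃ ≤
        (D.agr (i + 1) (j + 1) g e₁ e₂ e₃ c₁ c₂ c₃).card)
    (fun fl fl' => fl = 0 → fl' = 0)
    (fun is fl => fl ≠ 0 → ∀ e₁ e₂ e₃, is = [e₁, e₂, e₃] →
      (D.agr (i + 1) (j + 1) g e₁ e₂ e₃ c₁ c₂ c₃).card <
          bd (16 * m) e₁ * bd (16 * m) e₂ * bd (16 * m) e₃) (p := countBody)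
    (T := countTime (σ.reg 10)) (l := [(16, 20), (17, 20), (18, 20)])
    (fun h0 => by rw [h11] at h0; exact absurd h0 one_ne_zero) rfl
    (by simp) (fun _ h => h) (fun _ _ _ h h' h0 => h' (h h0))
    (fun _ _ _ h h' h0 => h fun h1 => h0 (h' h1)) ?_
  · rw [show List.map (fun xr : ℕ × ℕ => σ.reg xr.2) [(16, 20), (17, 20), (18, 20)] =
      [2, 2, 2] by simp [h20]] at key
    refine key.mono le_rfl fun τ _ _ ⟨g1, _, g3⟩ => ⟨g1, fun h0 e₁ he₁ e₂ he₂ e₃ he₃ => ?_⟩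
    exact g3 [e₁, e₂, e₃] (by simp [h20, he₁, he₂, he₃]) h0 _ _ _ rfl
  · intro is τ hbτ hf his hinv
    simp only [List.forall₂_cons_right_iff, List.forall₂_nil_right_iff] at his
    obtain ⟨e₁, _, ⟨he₁, h16⟩, ⟨e₂, _, ⟨he₂, h17⟩, ⟨e₃, _, ⟨he₃, h18⟩, rfl, rfl⟩, rfl⟩,
      rfl⟩ := his
    rw [hf.reg 20 rfl, h20] at he₁ he₂ he₃
    have h10 : τ.reg 10 = σ.reg 10 := hf.reg 10 rfl
    have hDτ : kview τ = D := kview_frame hf rfl rfl rfl rfl rfl rfl rfl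
    have hbody := ok_countBody env hbτ (h.frame hf rfl rfl rfl rfl rfl rfl rfl) h16 h17 h18
      he₁ he₂ he₃ hm
    rw [h10, hDτ] at hbody
    refine hbody.mono le_rfl fun τ' _ _ hτ' => ?_
    simp only [hτ']
    split_ifs with hlt
    · refine ⟨hinv, fun h => h, ?_⟩
      rintro - e₁' e₂' e₃' heq
      simp only [List.cons.injEq, and_true] at heq
      obtain ⟨rfl, rfl, rfl⟩ := heq
      exact hlt
    · exact ⟨fun _ => ⟨e₁, e₂, e₃, not_lt.1 hlt⟩, fun _ => rfl, fun h => absurd rfl h⟩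

/-- Bounds on everything that is stored. -/
structure Large (I : Inst) (B : ℕ) : Prop where
  n : I.n + 2 ≤ B
  c : I.c ≤ B
  N : ∀ m ≤ I.n, m + 3 * ((16 * m) ^ 3 * (m * (m * 32))) + 2 ≤ B
  lit : 32 ≤ B

theorem gcodeE_eval {τ : State} {u v w a b c : ℕ} (h6 : τ.reg 6 = u) (h7 : τ.reg 7 = v)
    (h8 : τ.reg 8 = w) (h13 : τ.reg 13 = a) (h14 : τ.reg 14 = b) (h15 : τ.reg 15 = c) :
    gcodeE.eval τ = gcode u v w a b c := by
  simp only [gcodeE, Expr.eval, h6, h7, h8, h13, h14, h15, gcode, ind]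

theorem ok_pushProg (env : Env W B) {I : Inst} {τ : State} (hb : Bdd B τ) {i j u v w g m : ℕ}
    (h : CandRegs τ i j g (I.colN u) (I.colN v) (I.colN w) m)
    (h6 : τ.reg 6 = u) (h7 : τ.reg 7 = v) (h8 : τ.reg 8 = w) (hi : i + 1 ≤ B) (hj : j + 1 ≤ B)
    (hN : τ.reg 10 + 3 ≤ B) :
    Ok W B τ pushProg 100 (fun τ' => kview τ' = (kview τ).push I.colN i j u v w g) := by
  have r4 := h.r4
  have r5 := h.r5
  refine Ok.time (Ok.store_seq env hb rfl rfl (hb.1 _) fun hb => Ok.store_seq env hb rfl rfl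
    (hb.1 _) fun hb => Ok.store_seq env hb rfl rfl (hb.1 _) fun hb => Ok.store_seq env hb rfl rfl
    (hb.1 _) fun hb => Ok.store_seq env hb rfl rfl (hb.1 _) fun hb => Ok.store_seq env hb rfl rfl
    (hb.1 _) fun hb => Ok.store_seq env hb rfl rfl (hb.1 _) fun hb => Ok.store_seq env hb rfl rfl
    (hb.1 _) fun hb => Ok.store_seq env hb rfl rfl (hb.1 _) fun hb => Ok.store_seq env hb rfl rfl
    (by simpa [Expr.eval, r4] using hi) fun hb => Ok.store_seq env hb rfl rfl
    (by simpa [Expr.eval, r5] using hj) fun hb => Ok.store_seq env hb rfl rfl (hb.1 _) fun hb =>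
    Ok.assign_seq env hb rfl (by simpa [Expr.eval] using hN) fun hb => Ok.skip hb ?_) (by decide)
  simp [kview, KData.push, Expr.eval, h.r4, h.r5, h.r12, h.r13, h.r14, h.r15, h6, h7, h8]

end BalanceFair

/-! ### Processing all candidates -/

namespace BalanceFair

variable {W B : ℕ}

theorem linkE_ne {I : Inst} {τ : State} (h : Base I τ) {i j u v w : ℕ} (hu : u < I.n)
    (hv : v < I.n) (hw : w < I.n) (h4 : τ.reg 4 = i) (h5 : τ.reg 5 = j) (h6 : τ.reg 6 = u)
    (h7 : τ.reg 7 = v) (h8 : τ.reg 8 = w) (hi : τ.arr 3 i < I.n) (hj : τ.arr 3 j < I.n) :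
    linkE.eval τ ≠ 0 ↔ Link I.adjN (τ.arr 3 i) u v w (τ.arr 3 j) := by
  have v6 : (Expr.var 6).eval τ = u := h6
  have v7 : (Expr.var 7).eval τ = v := h7
  have v8 : (Expr.var 8).eval τ = w := h8
  have g4 : (Expr.get 3 (.var 4)).eval τ = τ.arr 3 i := by simp [Expr.eval, h4]
  have g5 : (Expr.get 3 (.var 5)).eval τ = τ.arr 3 j := by simp [Expr.eval, h5]
  simp only [linkE, Expr.eval_mul_ne, Expr.eval_add_ne, Expr.eval_eq_ne, h.eval_adjE g4 v6 hi hu,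
    h.eval_adjE v6 v7 hu hv, h.eval_adjE v7 v8 hv hw, h.eval_adjE v8 g5 hw hj, v6, v7, v8, Link]
  tauto

/-- The invariant of the construction of triples; `org₀` lists the modulator. -/
def CandInv (I : Inst) (m : ℕ) (org₀ : ℕ → ℕ) (D : KData) : Prop :=
  D.Valid I.adjN I.colN I.n m (16 * m) ∧ ∀ p < m, D.org p = org₀ p

/-- The candidate was rejected. -/
def Rejected (I : Inst) (m : ℕ) (D : KData) (i j u v w : ℕ) : Prop :=
  ∃ e₁ e₂ e₃, bd (16 * m) e₁ * bd (16 * m) e₂ * bd (16 * m) e₃ ≤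
    (D.agr (i + 1) (j + 1) (gcode u v w (I.colN u) (I.colN v) (I.colN w)) e₁ e₂ e₃
      (I.colN u) (I.colN v) (I.colN w)).card

/-- Triples are only added. -/
def Grows (D D' : KData) : Prop := ∀ a b g e₁ e₂ e₃ c₁ c₂ c₃, a ≠ 0 →
  (D.agr a b g e₁ e₂ e₃ c₁ c₂ c₃).card ≤ (D'.agr a b g e₁ e₂ e₃ c₁ c₂ c₃).card

theorem Rejected.mono {I : Inst} {m : ℕ} {D D' : KData} {i j u v w : ℕ}
    (h : Rejected I m D i j u v w) (h' : Grows D D') : Rejected I m D' i j u v w := by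
  obtain ⟨e₁, e₂, e₃, h⟩ := h
  exact ⟨e₁, e₂, e₃, h.trans (h' _ _ _ _ _ _ _ _ _ (Nat.succ_ne_zero _))⟩

/-- With all three positions fixed the threshold is one, and the new triple itself attains it.
Accepted and rejected candidates thus end in the same state. -/
theorem rejected_push {I : Inst} {m M n : ℕ} {D : KData} {i j u v w : ℕ}
    (h : D.Valid I.adjN I.colN n m M) :
    Rejected I m (D.push I.colN i j u v w (gcode u v w (I.colN u) (I.colN v) (I.colN w)))
      i j u v w := by
  refine ⟨1, 1, 1, ?_⟩
  have h1 := KData.agr_push h i j u v w (gcode u v w (I.colN u) (I.colN v) (I.colN w)) (i + 1)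
    (j + 1) (gcode u v w (I.colN u) (I.colN v) (I.colN w)) 1 1 1 (I.colN u) (I.colN v) (I.colN w)
    (Nat.succ_ne_zero _)
  rw [h1, if_pos (by simp)]
  simp only [bd, one_ne_zero, if_false, mul_one]
  exact Finset.card_pos.2 ⟨_, Finset.mem_insert_self _ _⟩

/-- Time for one candidate. -/
def candTime (N : ℕ) : ℕ := 500 + nestTime [2, 2, 2] (countTime N)

theorem candTime_mono {N N' : ℕ} (h : N ≤ N') : candTime N ≤ candTime N' := by
  simp only [candTime, nestTime, countTime]
  omega

theorem ok_candBody (env : Env W B) {I : Inst} (big : Large I B) {τ : State} (hb : Bdd B τ)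
    (hI : Base I τ) {i j u v w m : ℕ} {org₀ : ℕ → ℕ} (hi : i < m) (hj : j < m) (hu : u < I.n)
    (hv : v < I.n) (hw : w < I.n) (h4 : τ.reg 4 = i) (h5 : τ.reg 5 = j) (h6 : τ.reg 6 = u)
    (h7 : τ.reg 7 = v) (h8 : τ.reg 8 = w) (h9 : τ.reg 9 = m) (h20 : τ.reg 20 = 2) (hmn : m ≤ I.n)
    (hinv : CandInv I m org₀ (kview τ)) :
    Ok W B τ candBody (candTime (τ.reg 10)) (fun τ' => CandInv I m org₀ (kview τ') ∧
      Grows (kview τ) (kview τ') ∧ (Link I.adjN (org₀ i) u v w (org₀ j) →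
        Rejected I m (kview τ') i j u v w)) := by
  obtain ⟨hval, horg⟩ := hinv
  set D := kview τ with hD
  have hmN := hval.mN
  have hoi : τ.arr 3 i < I.n := hval.org_lt i (hi.trans_le hmN)
  have hoj : τ.arr 3 j < I.n := hval.org_lt j (hj.trans_le hmN)
  have hlink := linkE_ne hI hu hv hw h4 h5 h6 h7 h8 hoi hoj
  have hei : τ.arr 3 i = org₀ i := horg i hi
  have hej : τ.arr 3 j = org₀ j := horg j hj
  refine Ok.time (T := linkE.cost + 1 + (nestTime [2, 2, 2] (countTime (τ.reg 10)) + 300))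
    (Ok.cond env hb rfl (fun hne => ?_) fun he => ?_) ?_
  · set g := gcode u v w (I.colN u) (I.colN v) (I.colN w) with hg
    have hlk := hlink.1 hne
    have hcol : ∀ x < I.n, τ.arr 1 x = I.colN x := hI.col
    refine Ok.time (Ok.assign_seq env hb rfl (hb.2 _ _) fun hb => Ok.assign_seq env hb rfl
      (hb.2 _ _) fun hb => Ok.assign_seq env hb rfl (hb.2 _ _) fun hb => Ok.assign_seq env hb rfl
      ?_ fun hb => Ok.assign_seq env hb rfl (le_trans (by norm_num [Expr.eval]) big.lit)
      fun hb => Ok.seq (T := nestTime [2, 2, 2] (countTime (τ.reg 10))) (T' := 120) ?_) ?_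
    · rw [gcodeE_eval rfl rfl rfl rfl rfl rfl]
      exact (gcode_lt _ _ _ _ _ _).le.trans big.lit
    · generalize hτ₁ : State.setReg _ 11 _ = τ₁ at hb ⊢
      have regs : CandRegs τ₁ i j g (I.colN u) (I.colN v) (I.colN w) m := by
        subst hτ₁
        refine ⟨by simp [h4], by simp [h5], ?_, ?_, ?_, ?_, by simp [h9]⟩
        · rw [State.setReg_reg, if_neg (by decide), State.setReg_reg, if_pos rfl,
            gcodeE_eval (u := u) (v := v) (w := w) (a := I.colN u) (b := I.colN v)
            (c := I.colN w)]
          all_goals simp [Expr.eval, h6, h7, h8, hcol, hu, hv, hw]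
        all_goals simp [Expr.eval, h6, h7, h8, hcol, hu, hv, hw]
      have k6 : τ₁.reg 6 = u := by subst hτ₁; simp [h6]
      have k7 : τ₁.reg 7 = v := by subst hτ₁; simp [h7]
      have k8 : τ₁.reg 8 = w := by subst hτ₁; simp [h8]
      have k10 : τ₁.reg 10 = τ.reg 10 := by subst hτ₁; simp
      have k11 : τ₁.reg 11 = 1 := by subst hτ₁; simp [Expr.eval]
      have k20 : τ₁.reg 20 = 2 := by subst hτ₁; simp [h20]
      have hD₁ : kview τ₁ = D := by subst hτ₁; simp [kview, hD]
      have hcount := ok_countNest env hb regs hval.mpos k11 k20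
      rw [k10, hD₁] at hcount
      refine hcount.mono le_rfl fun τ₂ _ hf ⟨c1, c2⟩ hb₂ => ?_
      have hD₂ : kview τ₂ = D := (kview_frame hf rfl rfl rfl rfl rfl rfl rfl).trans hD₁
      refine Ok.time (Ok.seq (T := 1 + 1 + 101) (T' := 1) (Ok.cond env hb₂ rfl (fun h11 => ?_)
        fun h11 => ?_)) (by decide)
      · have hpush := hval.push hi hj hu hv hw hlk (c2 h11)
        rw [← hg] at hpush
        -- The size bound is applied to the data after the push, so the counter increased by three
        -- still respects the memory bound.
        have hN := hpush.N_le
        have hNB := big.N m hmn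
        have hok := ok_pushProg env hb₂ (regs.frame hf rfl rfl rfl rfl rfl rfl rfl)
          ((hf.reg 6 rfl).trans k6) ((hf.reg 7 rfl).trans k7) ((hf.reg 8 rfl).trans k8)
          (by have := big.n; omega) (by have := big.n; omega) (by
            have h10 : τ₂.reg 10 = D.N := (hf.reg 10 rfl).trans k10
            have h3 : (D.push I.colN i j u v w g).N = D.N + 3 := rfl
            rw [h10]
            omega)
        rw [hD₂] at hok
        refine hok.mono (by norm_num) fun τ₃ _ _ hτ₃ hb₃ => Ok.skip hb₃ ?_
        rw [hτ₃]
        refine ⟨⟨hpush, fun p hp => ?_⟩, ?_, fun _ => rejected_push hval⟩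
        · rw [← horg p hp]
          simp only [KData.push, Function.update_apply]
          rw [if_neg (by omega), if_neg (by omega), if_neg (by omega)]
        · intro a b g' e₁ e₂ e₃ c₁ c₂ c₃ ha
          exact KData.card_agr_le_push hval _ _ _ _ _ _ _ _ _ _ _ _ _ _ _ ha
      · refine Ok.time (Ok.skip hb₂ fun hb₃ => Ok.skip hb₃ ?_) (by decide)
        rw [hD₂]
        exact ⟨⟨hval, horg⟩, fun _ _ _ _ _ _ _ _ _ _ => le_rfl, fun _ => c1 h11⟩
    · have : gcodeE.cost = 27 := by decide
      simp only [this, Expr.cost]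
      omega
  · refine Ok.time (Ok.skip hb ⟨⟨hval, horg⟩, fun _ _ _ _ _ _ _ _ _ _ => le_rfl, fun hl => ?_⟩)
      (by omega)
    rw [← hei, ← hej] at hl
    exact absurd he (hlink.2 hl)
  · have : linkE.cost = 37 := by decide
    simp only [candTime, this]
    omega

/-- A bound on the number of vertices of the kernel. -/
def maxN (m : ℕ) : ℕ := m + 3 * ((16 * m) ^ 3 * (m * (m * 32)))

/-- Since counts only grow, saturation persists, and a single pass over the candidates already
leaves the family closed. -/
theorem ok_candProg (env : Env W B) {I : Inst} (big : Large I B) {σ : State} (hσ : Bdd B σ)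
    (hI : Base I σ) {mk idx : ℕ → ℕ}
    (h0 : ∀ v, σ.arr 5 v = 0 ∧ σ.arr 6 v = 0 ∧ σ.arr 7 v = 0 ∧ σ.arr 8 v = 0)
    (hE : EnumInv I mk I.n (σ.reg 9) (σ.arr 3) (σ.arr 4) idx) (hm : 0 < σ.reg 9) :
    Ok W B σ candProg
      (10 + nestTime [σ.reg 9, σ.reg 9, I.n, I.n, I.n] (candTime (maxN (σ.reg 9)))) (fun τ =>
      CandInv I (σ.reg 9) (σ.arr 3) (kview τ) ∧
      (kview τ).Closed I.adjN I.colN I.n (σ.reg 9) (16 * σ.reg 9)) := by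
  set m := σ.reg 9 with hm9
  have hmn : m ≤ I.n := hE.m_le_n le_rfl
  refine Ok.time (Ok.assign_seq env hσ rfl (hσ.1 _) fun hb => Ok.assign_seq env hb rfl
    (le_trans (by norm_num [Expr.eval]) big.lit) fun hb => Ok.seq
    (T := nestTime [m, m, I.n, I.n, I.n] (candTime (maxN m))) (T' := 1) ?_)
    (by simp [Expr.cost]; omega)
  generalize hσ₁ : State.setReg _ 20 _ = σ₁ at hb ⊢
  have hI₁ : Base I σ₁ := by
    subst hσ₁
    exact ⟨hI.n, hI.c, hI.s, hI.t, hI.adj, hI.col⟩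
  have k9 : σ₁.reg 9 = m := by subst hσ₁; simp [hm9]
  have k20 : σ₁.reg 20 = 2 := by subst hσ₁; simp [Expr.eval]
  have hD₁ : kview σ₁ = ⟨m, σ.arr 3, σ.arr 4, σ.arr 5, σ.arr 6, σ.arr 7, σ.arr 8⟩ := by
    subst hσ₁
    simp [kview, Expr.eval, hm9]
  have hinv : CandInv I m (σ.arr 3) (kview σ₁) := by
    rw [hD₁]
    refine ⟨⟨hm, le_rfl, by omega, fun p hp => (hE.lt p hp).1, fun p hp => (hE.lt p hp).2.2.1,
      fun p _ => (h0 p).1, fun p h1 h2 => absurd h2 (not_lt.2 h1),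
      fun q hq => absurd (h0 q).2.1 hq, fun q hq => absurd (h0 q).2.1 hq,
      fun q _ => (h0 q).2.2.1, fun q hq => absurd (h0 q).2.1 hq,
      fun q hq => absurd (h0 q).2.1 hq, ?_⟩, fun _ _ => rfl⟩
    intro a b g e₁ e₂ e₃ c₁ c₂ c₃ ha
    rw [Finset.card_eq_zero.2]
    · exact Nat.zero_le _
    · refine Finset.eq_empty_of_forall_notMem fun q hq => ?_
      exact ha ((KData.mem_agr.1 hq).2.1.symm.trans (h0 q).2.1)
  have key := Ok.nest env hb kview (CandInv I m (σ.arr 3)) Grows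
    (fun is D => ∀ i j u v w, is = [i, j, u, v, w] → Link I.adjN (σ.arr 3 i) u v w (σ.arr 3 j) →
      Rejected I m D i j u v w) (p := candBody) (T := candTime (maxN m))
    (l := [(4, 9), (5, 9), (6, 0), (7, 0), (8, 0)]) hinv rfl
    (by
      intro x hx τ v
      simp only [List.map_cons, List.map_nil, List.mem_cons, List.not_mem_nil, or_false] at hx
      rcases hx with rfl | rfl | rfl | rfl | rfl <;> simp [kview])
    (fun _ _ _ _ _ _ _ _ _ _ _ => le_rfl)
    (fun _ _ _ h h' a b g e₁ e₂ e₃ c₁ c₂ c₃ ha =>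
      (h a b g e₁ e₂ e₃ c₁ c₂ c₃ ha).trans (h' a b g e₁ e₂ e₃ c₁ c₂ c₃ ha))
    (fun _ _ _ h h' i j u v w his hl => (h i j u v w his hl).mono h') ?_
  · rw [show List.map (fun xr : ℕ × ℕ => σ₁.reg xr.2) [(4, 9), (5, 9), (6, 0), (7, 0), (8, 0)] =
      [m, m, I.n, I.n, I.n] by simp [k9, hI₁.n]] at key
    refine key.mono le_rfl fun τ _ _ ⟨g1, _, g3⟩ hb' => Ok.skip hb' ⟨g1, ?_⟩
    intro i hi j hj u hu v hv w hw hl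
    rw [g1.2 i hi, g1.2 j hj] at hl
    exact g3 [i, j, u, v, w] (by simp [k9, hI₁.n, hi, hj, hu, hv, hw]) _ _ _ _ _ rfl hl
  · intro is τ hbτ hf his hinvτ
    simp only [List.forall₂_cons_right_iff, List.forall₂_nil_right_iff] at his
    obtain ⟨i, _, ⟨hi, h4⟩, ⟨j, _, ⟨hj, h5⟩, ⟨u, _, ⟨hu, h6⟩, ⟨v, _, ⟨hv, h7⟩,
      ⟨w, _, ⟨hw, h8⟩, rfl, rfl⟩, rfl⟩, rfl⟩, rfl⟩, rfl⟩ := his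
    have hIτ : Base I τ := hI₁.frame hf rfl rfl rfl rfl rfl rfl
    have h9 : τ.reg 9 = m := (hf.reg 9 rfl).trans k9
    have h20 : τ.reg 20 = 2 := (hf.reg 20 rfl).trans k20
    rw [h9] at hi hj
    rw [hIτ.n] at hu hv hw
    have hN : τ.reg 10 ≤ maxN m := hinvτ.1.N_le
    refine (ok_candBody env big hbτ hIτ hi hj hu hv hw h4 h5 h6 h7 h8 h9 h20 hmn hinvτ).mono
      (candTime_mono hN) fun τ' _ _ ⟨g1, g2, g3⟩ => ⟨g1, g2, ?_⟩
    rintro i' j' u' v' w' his hl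
    simp only [List.cons.injEq, and_true] at his
    obtain ⟨rfl, rfl, rfl, rfl, rfl⟩ := his
    exact g3 hl

end BalanceFair

/-! ### Writing the output -/

namespace BalanceFair

variable {W B : ℕ}

open Classical in
/-- The entry of the adjacency matrix of the kernel. -/
noncomputable def outVal (I : Inst) (D : KData) (p q : ℕ) : ℕ :=
  if D.Rel p q ∧ I.adjN (D.org p) (D.org q) then 1 else 0

theorem outAdjE_eval {I : Inst} {τ : State} (hI : Base I τ) {p q : ℕ} (h4 : τ.reg 4 = p)
    (h5 : τ.reg 5 = q) (hp : τ.arr 3 p < I.n) (hq : τ.arr 3 q < I.n) :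
    outAdjE.eval τ = outVal I (kview τ) p q := by
  have hle : outAdjE.eval τ ≤ 1 := by
    rw [outAdjE, Expr.eval]
    split_ifs <;> omega
  have hne : outAdjE.eval τ ≠ 0 ↔ (kview τ).Rel p q ∧ I.adjN (τ.arr 3 p) (τ.arr 3 q) := by
    have g4 : (Expr.get 3 (.var 4)).eval τ = τ.arr 3 p := by simp [Expr.eval, h4]
    have g5 : (Expr.get 3 (.var 5)).eval τ = τ.arr 3 q := by simp [Expr.eval, h5]
    rw [outAdjE, Expr.eval_lt_ne]
    change 0 < _ ↔ _
    rw [Nat.pos_iff_ne_zero]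
    simp only [Expr.eval_mul_ne, Expr.eval_add_ne, Expr.eval_eq_ne, hI.eval_adjE g4 g5 hp hq]
    simp only [Expr.eval, h4, h5, KData.Rel, kview]
    tauto
  unfold outVal
  split_ifs with h
  · have := hne.2 h
    omega
  · by_contra h0
    exact h (hne.1 h0)

theorem ok_adjNest (env : Env W B) {I : Inst} {σ : State} (hσ : Bdd B σ) (hI : Base I σ)
    (horg : ∀ p < σ.reg 10, σ.arr 3 p < I.n) :
    Ok W B σ adjNest (nestTime [σ.reg 10, σ.reg 10] 100) (fun τ =>
      ∀ p < σ.reg 10, ∀ q < σ.reg 10,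
        τ.arr 11 (p * σ.reg 10 + q) = outVal I (kview σ) p q) := by
  set N := σ.reg 10 with hN
  have key := Ok.nest env hσ (fun τ => τ.arr 11) (fun _ => True)
    (fun a a' => ∀ p < N, ∀ q < N, a (p * N + q) = outVal I (kview σ) p q →
      a' (p * N + q) = outVal I (kview σ) p q)
    (fun is a => ∀ p < N, ∀ q < N, is = [p, q] → a (p * N + q) = outVal I (kview σ) p q)
    (p := .store 11 cellE outAdjE) (T := 100) (l := [(4, 10), (5, 10)]) trivial rfl
    (fun _ _ _ _ => rfl) (fun _ _ _ _ _ h => h)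
    (fun _ _ _ h h' p hp q hq hx => h' p hp q hq (h p hp q hq hx))
    (fun _ _ _ h h' p hp q hq his => h' p hp q hq (h p hp q hq his)) ?_
  · refine key.mono le_rfl fun τ _ _ ⟨_, _, g⟩ p hp q hq => g [p, q] ?_ p hp q hq rfl
    simp [← hN, hp, hq]
  · intro is τ hb hf his _
    simp only [List.forall₂_cons_right_iff, List.forall₂_nil_right_iff] at his
    obtain ⟨p, _, ⟨hp, h4⟩, ⟨q, _, ⟨hq, h5⟩, rfl, rfl⟩, rfl⟩ := his
    have h10 : τ.reg 10 = N := hf.reg 10 rfl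
    have h3 : τ.arr 3 = σ.arr 3 := hf.arr 3 rfl
    rw [h10] at hp hq
    have hev := outAdjE_eval (hI.frame hf rfl rfl rfl rfl rfl rfl) h4 h5
      (by rw [h3]; exact horg p hp) (by rw [h3]; exact horg q hq)
    rw [kview_frame hf rfl rfl rfl rfl rfl rfl rfl] at hev
    have hcell : cellE.eval τ = p * N + q := by
      simp [cellE, Expr.eval, h4, h5, h10]
    refine Ok.time (Ok.store env hb rfl rfl ?_ ⟨trivial, ?_, ?_⟩) (by decide)
    · rw [hev]
      have := env.lit
      unfold outVal
      split_ifs <;> omega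
    · intro p' hp' q' hq' hx
      simp only [State.setArr_arr, if_true, Function.update_apply, hcell]
      split_ifs with heq
      · obtain ⟨rfl, rfl⟩ := cell_inj hq' hq heq
        exact hev
      · exact hx
    · intro p' hp' q' hq' his
      simp only [List.cons.injEq, and_true] at his
      obtain ⟨rfl, rfl⟩ := his
      simp [hcell, hev]

theorem ok_copyNest (env : Env W B) {σ : State} (hσ : Bdd B σ) :
    Ok W B σ copyNest (nestTime [σ.reg 10, σ.reg 10] 100) (fun τ =>
      ∀ p < σ.reg 10, ∀ q < σ.reg 10,
        τ.arr 0 (p * σ.reg 10 + q) = σ.arr 11 (p * σ.reg 10 + q)) := by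
  set N := σ.reg 10 with hN
  have key := Ok.nest env hσ (fun τ => τ.arr 0) (fun _ => True)
    (fun a a' => ∀ x, a x = σ.arr 11 x → a' x = σ.arr 11 x)
    (fun is a => ∀ p q, is = [p, q] → a (p * N + q) = σ.arr 11 (p * N + q))
    (p := .store 0 cellE (.get 11 cellE)) (T := 100) (l := [(4, 10), (5, 10)]) trivial rfl
    (fun _ _ _ _ => rfl) (fun _ _ h => h) (fun _ _ _ h h' x hx => h' x (h x hx))
    (fun _ _ _ h h' p q his => h' _ (h p q his)) ?_
  · refine key.mono le_rfl fun τ _ _ ⟨_, _, g⟩ p hp q hq => g [p, q] ?_ p q rfl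
    simp [← hN, hp, hq]
  · intro is τ hb hf his _
    simp only [List.forall₂_cons_right_iff, List.forall₂_nil_right_iff] at his
    obtain ⟨p, _, ⟨hp, h4⟩, ⟨q, _, ⟨hq, h5⟩, rfl, rfl⟩, rfl⟩ := his
    have h10 : τ.reg 10 = N := hf.reg 10 rfl
    have h11 : τ.arr 11 = σ.arr 11 := hf.arr 11 rfl
    have hcell : cellE.eval τ = p * N + q := by
      simp [cellE, Expr.eval, h4, h5, h10]
    have hget : (Expr.get 11 cellE).eval τ = σ.arr 11 (p * N + q) := by
      rw [Expr.eval, hcell, h11]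
    refine Ok.time (Ok.store env hb rfl rfl ?_ ⟨trivial, ?_, ?_⟩) (by decide)
    · rw [hget]
      exact hσ.2 _ _
    · intro x hx
      simp only [State.setArr_arr, if_true, Function.update_apply, hcell, hget]
      split_ifs with heq
      · rw [heq]
      · exact hx
    · intro p' q' his
      simp only [List.cons.injEq, and_true] at his
      obtain ⟨rfl, rfl⟩ := his
      simp [hcell, hget]

theorem chooseE_eval {τ : State} {e f : Expr} {P : Prop} [Decidable P]
    (h : τ.reg 22 = if P then 1 else 0) :
    (chooseE e f).eval τ = if P then e.eval τ else f.eval τ := by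
  simp only [chooseE, Expr.eval, h]
  split_ifs <;> simp

/-- In the case of many colors the label of a color is a vertex of that color, from which the color
can be read back; this gives injectivity. -/
theorem ok_labelProg (env : Env W B) {σ : State} (hσ : Bdd B σ) {c m N : ℕ}
    (h1 : σ.reg 1 = c) (h9 : σ.reg 9 = m) (h10 : σ.reg 10 = N) :
    Ok W B σ labelProg (40 + 2 * (6 + N * 50)) (fun τ =>
      τ.reg 22 = (if 3 * c ≤ 16 * m then 1 else 0) ∧
      IsRelabeling c m N (σ.arr 4) (if 3 * c ≤ 16 * m then c else N + 1) (τ.arr 9) ∧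
      ∀ p < N, τ.arr 1 p = τ.arr 9 (σ.arr 4 p)) := by
  have hkeep : keepE.eval σ = if 3 * c ≤ 16 * m then 1 else 0 := by
    simp only [keepE, thresholdE, Expr.eval, h1, h9]
    split_ifs <;> first | rfl | omega
  refine Ok.time (Ok.assign_seq env hσ rfl ?_ fun hb => Ok.seq (T := 6 + N * (42 + 8))
    (T' := 6 + N * (42 + 8) + 1) ?_) ?_
  · rw [hkeep]
    have := env.lit
    split_ifs <;> omega
  · generalize hσ₁ : State.setReg _ 22 _ = σ₁ at hb ⊢
    have k22 : σ₁.reg 22 = if 3 * c ≤ 16 * m then 1 else 0 := by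
      subst hσ₁
      simp [hkeep]
    have k10 : σ₁.reg 10 = N := by subst hσ₁; simp [h10]
    have k4 : σ₁.arr 4 = σ.arr 4 := by subst hσ₁; rfl
    refine (Ok.forP env hb (T := 42) (N := N) rfl rfl (by decide) k10 (fun i τ => ∀ p < i,
      if 3 * c ≤ 16 * m then τ.arr 9 (σ.arr 4 p) = σ.arr 4 p else
        τ.arr 9 (σ.arr 4 p) < i ∧ σ.arr 4 (τ.arr 9 (σ.arr 4 p)) = σ.arr 4 p) ?_ ?_).mono le_rfl ?_
    · intro p hp
      exact absurd hp (Nat.not_lt_zero p)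
    · intro i hi τ hbτ hf hτ4 hinv
      have j4 : τ.arr 4 = σ.arr 4 := (hf.arr 4 rfl).trans k4
      have hev : (chooseE (.get 4 (.var 4)) (.var 4)).eval τ =
          if 3 * c ≤ 16 * m then σ.arr 4 i else i := by
        rw [chooseE_eval ((hf.reg 22 rfl).trans k22)]
        simp only [Expr.eval, hτ4, j4]
      have hidx : (Expr.get 4 (.var 4)).eval τ = σ.arr 4 i := by
        simp only [Expr.eval, hτ4, j4]
      refine Ok.time (Ok.store env hbτ rfl rfl ?_ ?_) (by decide)
      · rw [hev]
        split_ifs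
        · exact hσ.2 _ _
        · have := hσ.1 10
          omega
      · intro p hp
        rw [hev, hidx]
        simp only [State.setReg_arr, State.setArr_arr, if_true, Function.update_apply]
        by_cases hpi : σ.arr 4 p = σ.arr 4 i
        · simp only [hpi, if_true]
          split_ifs
          · rfl
          · exact ⟨Nat.lt_succ_self i, rfl⟩
        · simp only [hpi, if_false]
          have hne : p ≠ i := by
            rintro rfl
            exact hpi rfl
          have := hinv p (by omega)
          split_ifs at this ⊢
          · exact this
          · exact ⟨by omega, this.2⟩
    · intro τ _ hf hinv hbτ
      have j4 : τ.arr 4 = σ.arr 4 := (hf.arr 4 rfl).trans k4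
      refine Ok.seq (Ok.mono (Ok.forP env hbτ (T := 42) (N := N) rfl rfl (by decide)
        ((hf.reg 10 rfl).trans k10) (fun i υ => ∀ p < i, υ.arr 1 p = τ.arr 9 (σ.arr 4 p))
        ?_ ?_) le_rfl ?_)
      · intro p hp
        exact absurd hp (Nat.not_lt_zero p)
      · intro i hi υ hbυ hf' hυ4 hinv'
        have i4 : υ.arr 4 = σ.arr 4 := (hf'.arr 4 rfl).trans j4
        have i9 : υ.arr 9 = τ.arr 9 := hf'.arr 9 rfl
        refine Ok.time (Ok.store env hbυ rfl rfl (hbυ.2 _ _) ?_) (by decide)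
        intro p hp
        simp only [State.setReg_arr, State.setArr_arr, if_true, Function.update_apply, Expr.eval,
          hυ4, i4, i9]
        split_ifs with hpi
        · rw [hpi]
        · exact hinv' p (by omega)
      · intro υ _ hf' hinv' hbυ
        have i9 : υ.arr 9 = τ.arr 9 := hf'.arr 9 rfl
        refine Ok.skip hbυ ⟨(hf'.reg 22 rfl).trans ((hf.reg 22 rfl).trans k22), ?_, ?_⟩
        · rw [i9]
          by_cases h3 : 3 * c ≤ 16 * m
          · rw [if_pos h3]
            simp only [h3, if_true] at hinv
            exact Or.inl ⟨h3, rfl, hinv⟩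
          · rw [if_neg h3]
            simp only [h3, if_false] at hinv
            refine Or.inr ⟨not_le.1 h3, rfl, fun p hp => (hinv p hp).1, fun p hp q hq hpq => ?_⟩
            rw [← (hinv p hp).2, hpq, (hinv q hq).2]
        · rw [i9]
          exact hinv'
  · have : keepE.cost = 9 := by decide
    omega

theorem ok_finalProg (env : Env W B) {σ : State} (hσ : Bdd B σ) {P : Prop} [Decidable P]
    (h22 : σ.reg 22 = if P then 1 else 0) (hN : σ.reg 10 + 1 ≤ B) :
    Ok W B σ finalProg 40 (fun τ => τ.reg 0 = σ.reg 10 ∧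
      τ.reg 1 = (if P then σ.reg 1 else σ.reg 10 + 1) ∧ τ.reg 2 = σ.arr 10 (σ.reg 2) ∧
      τ.reg 3 = σ.arr 10 (σ.reg 3) ∧ τ.arr 0 = σ.arr 0 ∧ τ.arr 1 = σ.arr 1) := by
  have hev : ∀ a b, (chooseE (.var 1) (.add (.var 10) (.lit 1))).eval
      ((σ.setReg 2 a).setReg 3 b) = if P then σ.reg 1 else σ.reg 10 + 1 := by
    intro a b
    rw [chooseE_eval (by simpa using h22)]
    simp [Expr.eval]
  refine Ok.time (Ok.assign_seq env hσ rfl (hσ.2 _ _) fun hb => Ok.assign_seq env hb rfl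
    (hb.2 _ _) fun hb => Ok.assign_seq env hb rfl ?_ fun hb => Ok.assign_seq env hb rfl
    (hb.1 _) fun hb => Ok.skip hb ?_) (by decide)
  · rw [hev]
    split_ifs
    · exact hσ.1 _
    · exact hN
  · rw [hev]
    simp [Expr.eval]

end BalanceFair

/-! ### Composition of the phases and resource bounds -/

namespace BalanceFair

variable {W B : ℕ}

theorem nestTime_mono {l l' : List ℕ} (h : List.Forall₂ (· ≤ ·) l l') {T T' : ℕ} (hT : T ≤ T') :
    nestTime l T ≤ nestTime l' T' := by
  induction h with
  | nil => exact hT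
  | cons h _ ih => exact Nat.add_le_add_left (Nat.mul_le_mul h (Nat.add_le_add_right ih 8)) 6

theorem maxN_mono {m m' : ℕ} (h : m ≤ m') : maxN m ≤ maxN m' := by
  unfold maxN
  gcongr

/-- Time of the kernelization for `n` vertices. -/
def totalTime (n : ℕ) : ℕ :=
  nestTime [n, n, n, n] 200 + 20 + (10 + (6 + n * (50 + 8)) +
    (10 + nestTime [n, n, n, n, n] (candTime (maxN n)) + (nestTime [maxN n, maxN n] 100 +
      (40 + 2 * (6 + maxN n * 50) + (nestTime [maxN n, maxN n] 100 + (40 + 1))))))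

/-- The witnesses are snapshots of the memory: the marks after the first phase, the positions in
array `10`, the view after the selection of triples, and the labels in array `9`. -/
theorem ok_kernelProg (env : Env W B) {I : Inst} (big : Large I B) (hσ : Bdd B I.input) :
    Ok W B I.input kernelProg (totalTime I.n) (fun τ => ∃ (m : ℕ) (X : Finset ℕ) (idx : ℕ → ℕ)
      (D : KData) (c' : ℕ) (f : ℕ → ℕ) (h : IsKernel I m X idx D)
      (hf : IsRelabeling I.c m D.N D.oc c' f), (h.out hf).IsOutput τ) := by
  have hn := big.n
  refine Ok.seq ((ok_markProg env hσ (base_input I) fun v => rfl).mono le_rfl ?_)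
  rintro σ₁ - hf₁ ⟨hmark, hhit⟩ hb₁
  have hI₁ : Base I σ₁ := (base_input I).frame hf₁ rfl rfl rfl rfl rfl rfl
  refine Ok.seq ((ok_enumProg env hb₁ hI₁ (by omega)).mono le_rfl ?_)
  rintro σ₂ - hf₂ hE hb₂
  have hI₂ : Base I σ₂ := hI₁.frame hf₂ rfl rfl rfl rfl rfl rfl
  obtain ⟨hs1, hs2⟩ := hE.idx_lt I.s I.s.2 hmark.1
  have hmn := hE.m_le_n le_rfl
  set m := σ₂.reg 9 with hm
  have h0 : ∀ a, markProg.wa a = false → enumProg.wa a = false → I.input.arr a = (fun _ => 0) →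
      ∀ v, σ₂.arr a v = 0 := by
    intro a h1 h2 h3 v
    rw [hf₂.arr a h2, hf₁.arr a h1, h3]
  refine Ok.seq ((ok_candProg env big hb₂ hI₂ (fun v => ⟨h0 5 rfl rfl rfl v, h0 6 rfl rfl rfl v,
    h0 7 rfl rfl rfl v, h0 8 rfl rfl rfl v⟩) hE (Nat.zero_lt_of_lt hs1)).mono
    (Nat.add_le_add_left (nestTime_mono (by simp [← hm, hmn]) (candTime_mono (maxN_mono hmn))) 10) ?_)
  rintro σ₃ - hf₃ ⟨⟨hval, horg⟩, hclosed⟩ hb₃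
  have hI₃ : Base I σ₃ := hI₂.frame hf₃ rfl rfl rfl rfl rfl rfl
  have k9 : σ₃.reg 9 = m := hf₃.reg 9 rfl
  have k10 : σ₃.arr 10 = σ₂.arr 10 := hf₃.arr 10 rfl
  have hNm : (kview σ₃).N ≤ maxN m := hval.N_le
  have hNn : σ₃.reg 10 ≤ maxN I.n := hNm.trans (maxN_mono hmn)
  have hNB := big.N I.n le_rfl
  have hker : IsKernel I m (marked I.n (σ₁.arr 2)) (σ₂.arr 10) (kview σ₃) := by
    have hmem : ∀ {v}, v ∈ marked I.n (σ₁.arr 2) ↔ v < I.n ∧ σ₁.arr 2 v ≠ 0 := by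
      simp [marked]
    refine ⟨hval, hclosed, hmem.2 ⟨I.s.2, hmark.1⟩, hmem.2 ⟨I.t.2, hmark.2.1⟩, ?_, ?_,
      (hE.m_le le_rfl).trans hmark.card_le⟩
    · intro v hv
      obtain ⟨h1, h2⟩ := hmem.1 hv
      obtain ⟨h3, h4⟩ := hE.idx_lt v h1 h2
      exact ⟨h1, h3, (horg _ h3).trans h4⟩
    · intro a b c d hP
      have ⟨⟨an, bn, _⟩, ⟨_, cn, _⟩, ⟨_, dn, _⟩, _⟩ := hP
      simp only [hmem, an, bn, cn, dn, true_and]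
      exact hhit a b c d hP
  refine Ok.seq ((ok_adjNest env hb₃ hI₃ hval.org_lt).mono
    (nestTime_mono (by simp [hNn]) le_rfl) ?_)
  rintro σ₄ - hf₄ hadj hb₄
  have hI₄ : Base I σ₄ := hI₃.frame hf₄ rfl rfl rfl rfl rfl rfl
  have j10 : σ₄.reg 10 = σ₃.reg 10 := hf₄.reg 10 rfl
  refine Ok.seq ((ok_labelProg env hb₄ hI₄.c ((hf₄.reg 9 rfl).trans k9) j10).mono (by omega) ?_)
  rintro σ₅ - hf₅ ⟨h22, hrel, hcol⟩ hb₅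
  have i10 : σ₅.reg 10 = σ₃.reg 10 := (hf₅.reg 10 rfl).trans j10
  rw [show σ₄.arr 4 = (kview σ₃).oc from hf₄.arr 4 rfl] at hrel hcol
  refine Ok.seq ((ok_copyNest env hb₅).mono
    (nestTime_mono (by simp [i10, hNn]) le_rfl) ?_)
  rintro σ₆ - hf₆ hcopy hb₆
  have l10 : σ₆.reg 10 = σ₃.reg 10 := (hf₆.reg 10 rfl).trans i10
  have hN1 : σ₆.reg 10 + 1 ≤ B := by
    unfold maxN at hNn
    omega
  refine Ok.seq ((ok_finalProg env hb₆ ((hf₆.reg 22 rfl).trans h22) hN1).mono le_rfl ?_)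
  rintro τ - hf₇ ⟨r0, r1, r2, r3, a0, a1⟩ hb₇
  refine Ok.skip hb₇ ⟨m, _, _, _, _, _, hker, hrel, r0.trans l10, ?_, ?_, ?_, ?_, ?_⟩
  · rw [r1, l10, show σ₆.reg 1 = I.c from
      (hf₆.reg 1 rfl).trans ((hf₅.reg 1 rfl).trans hI₄.c)]
    rfl
  · rw [r2, hf₆.reg 2 rfl, hf₅.reg 2 rfl, hI₄.s, hf₆.arr 10 rfl, hf₅.arr 10 rfl, hf₄.arr 10 rfl,
      k10]
    rfl
  · rw [r3, hf₆.reg 3 rfl, hf₅.reg 3 rfl, hI₄.t, hf₆.arr 10 rfl, hf₅.arr 10 rfl, hf₄.arr 10 rfl,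
      k10]
    rfl
  · intro i j
    have hi : (i : ℕ) < σ₃.reg 10 := i.2
    have hj : (j : ℕ) < σ₃.reg 10 := j.2
    rw [i10] at hcopy
    rw [a0]
    refine (hcopy i hi j hj).trans ?_
    rw [hf₅.arr 11 rfl, hadj i hi j hj]
    unfold outVal
    exact @if_congr _ _ _ (_) (_) _ _ _ _ Iff.rfl rfl rfl
  · intro i
    have hi : (i : ℕ) < σ₃.reg 10 := i.2
    rw [a1, hf₆.arr 1 rfl]
    exact hcol i hi

/-! ### Bounds -/

theorem nestTime_cons_le {n a k b j N T : ℕ} {l : List ℕ} (hn : 1 ≤ n)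
    (hT : nestTime l T ≤ a * n ^ k) (hN : N ≤ b * n ^ j) :
    nestTime (N :: l) T ≤ (6 + b * (a + 8)) * n ^ (j + k) := by
  have h1 : ∀ i, 1 ≤ n ^ i := fun i => Nat.one_le_pow _ _ hn
  calc nestTime (N :: l) T = 6 + N * (nestTime l T + 8) := rfl
    _ ≤ 6 * n ^ (j + k) + b * n ^ j * (a * n ^ k + 8 * n ^ k) := by
        gcongr
        · exact Nat.le_mul_of_pos_right _ (h1 _)
        · exact Nat.le_mul_of_pos_right _ (h1 _)
    _ = _ := by ring

theorem maxN_le (n : ℕ) : maxN n ≤ 393217 * n ^ 5 := by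
  have h1 : maxN n = n + 393216 * n ^ 5 := by
    unfold maxN
    ring
  have h2 : n ≤ n ^ 5 := Nat.le_self_pow (by norm_num) n
  omega

theorem totalTime_le {n : ℕ} (hn : 1 ≤ n) : totalTime n ≤ 10 ^ 15 * n ^ 10 := by
  have hN := maxN_le n
  have h1 : n ≤ 1 * n ^ 1 := by simp
  have h5 : n ^ 5 ≤ n ^ 10 := Nat.pow_le_pow_right hn (by norm_num)
  have h4 : n ^ 4 ≤ n ^ 10 := Nat.pow_le_pow_right hn (by norm_num)
  have h0 : n ≤ n ^ 10 := Nat.le_self_pow (by norm_num) n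
  have e := fun {a k N : ℕ} {l : List ℕ} {T : ℕ} {b j : ℕ} => @nestTime_cons_le n a k b j N T l hn
  have t1 : nestTime [n, n, n, n] 200 ≤ _ :=
    e (e (e (e (show nestTime [] 200 ≤ 200 * n ^ 0 by simp [nestTime]) h1) h1) h1) h1
  have t2 : nestTime [maxN n, maxN n] 100 ≤ _ :=
    e (e (show nestTime [] 100 ≤ 100 * n ^ 0 by simp [nestTime]) hN) hN
  have h6 : candTime (maxN n) ≤ 400000000 * 8 * n ^ 5 := by
    have : 1 ≤ n ^ 5 := Nat.one_le_pow _ _ hn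
    simp only [candTime, nestTime, countTime]
    omega
  -- Five nested loops around a scan of `O(n ^ 5)` stored vertices reach the exponent `10`, as do
  -- the two loops over pairs of kernel vertices.
  have t3 : nestTime [n, n, n, n, n] (candTime (maxN n)) ≤ _ :=
    e (e (e (e (e (show nestTime [] (candTime (maxN n)) ≤ _ from h6) h1) h1) h1) h1) h1
  norm_num at t1 t2 t3
  unfold totalTime
  norm_num
  omega

/-- A bound on the contents of the memory. -/
def memBound (I : Inst) : ℕ := I.c + 500000 * I.n ^ 5 + 40

theorem large_memBound (I : Inst) : Large I (memBound I) := by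
  have h1 : I.n ≤ I.n ^ 5 := Nat.le_self_pow (by norm_num) _
  unfold memBound
  refine ⟨by omega, by omega, fun m hm => ?_, by omega⟩
  have h2 : maxN m ≤ 393217 * I.n ^ 5 := (maxN_mono hm).trans (maxN_le _)
  unfold maxN at h2
  omega

theorem bdd_input (I : Inst) : Bdd (memBound I) I.input := by
  have h1 : I.n ≤ I.n ^ 5 := Nat.le_self_pow (by norm_num) _
  have hs := I.s.2
  have ht := I.t.2
  refine ⟨fun x => ?_, fun a x => ?_⟩
  · simp only [Inst.input, memBound]
    split_ifs <;> omega
  · simp only [Inst.input, memBound]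
    split_ifs with h₁ h₂ h₃ h₄
    · omega
    · omega
    · have := (I.color ⟨x, h₄⟩).2
      omega
    · omega
    · omega

theorem env_memBound (I : Inst) {C : ℕ} (hC : 4800 ≤ C) :
    Env ((I.n + I.c) ^ C) (memBound I) := by
  have hn : 1 ≤ I.n := Nat.zero_lt_of_lt I.s.2
  have hc : 1 ≤ I.c := Nat.zero_lt_of_lt (I.color I.s).2
  refine ⟨by unfold memBound; omega, ?_⟩
  -- As `n + c ≥ 2`, numerical factors are absorbed by powers: `19` for the constant and `5` for the
  -- polynomial. Together with the exponent `200` allowed for expressions this explains `4800`.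
  have h1 : memBound I + 2 ≤ (I.n + I.c) ^ 24 := by
    have h2 : I.n ^ 5 ≤ (I.n + I.c) ^ 5 := Nat.pow_le_pow_left (by omega) 5
    have h3 : I.n + I.c ≤ (I.n + I.c) ^ 5 := Nat.le_self_pow (by norm_num) _
    have h4 : 2 ^ 19 ≤ (I.n + I.c) ^ 19 := Nat.pow_le_pow_left (by omega) 19
    calc memBound I + 2 ≤ 2 ^ 19 * (I.n + I.c) ^ 5 := by
          unfold memBound
          norm_num
          omega
      _ ≤ (I.n + I.c) ^ 19 * (I.n + I.c) ^ 5 := Nat.mul_le_mul_right _ h4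
      _ = (I.n + I.c) ^ 24 := (pow_add _ 19 5).symm
  refine (Nat.pow_le_pow_left h1 200).trans ?_
  rw [← pow_mul]
  generalize hk : 24 * 200 = k
  exact Nat.pow_le_pow_right (by omega) (by omega)

end BalanceFair

theorem mainTheorem2 :
    ∃ (p : BalanceFair.Prog) (C : ℕ), ∀ I : BalanceFair.Inst,
      ∃ (T : ℕ) (σ : BalanceFair.State) (I' : BalanceFair.Inst),
        BalanceFair.Runs ((I.n + I.c) ^ C) p I.input T σ ∧
        I'.IsOutput σ ∧
        T ≤ C * I.n ^ 10 ∧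
        (I.IsYes ↔ I'.IsYes) ∧
        I'.size + I'.param ≤ C * (I.param + 1) ^ 5 := by
  -- The same constant serves as word exponent (at least `4800`), time factor (`10 ^ 15`) and size
  -- factor (at least `4000000000`).
  obtain ⟨C, hC⟩ : ∃ C, C = 10 ^ 15 := ⟨_, rfl⟩
  refine ⟨BalanceFair.kernelProg, C, fun I => ?_⟩
  obtain ⟨T, σ, hT, hrun, -, m, X, idx, D, c', f, h, hf, hout⟩ :=
    BalanceFair.ok_kernelProg (BalanceFair.env_memBound I (C := C) (by omega))
      (BalanceFair.large_memBound I) (BalanceFair.bdd_input I)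
  have hn : 1 ≤ I.n := Nat.zero_lt_of_lt I.s.2
  refine ⟨T, σ, h.out hf, hrun, hout, ?_, h.isYes_iff hf, (h.size_le hf).trans ?_⟩
  · rw [hC]
    exact hT.trans (BalanceFair.totalTime_le hn)
  · exact Nat.mul_le_mul_right _ (by omega)
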